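/- Let $\Omega\subset\mathbb{R}^n$ be open and simply connected with $0\in\Omega$, with coordinates $u=(u_1,\dots,u_n)$. On $\mathbb{C}^n$ let $\langle Z,W\rangle=\operatorname{Re}(\bar Z^tW)$, $\omega(Z,W)=\operatorname{Im}(\bar Z^tW)$ and let $J$ be multiplication by $i$. Put $\delta=\operatorname{diag}(du_1,\dots,du_n)$. For smooth nowhere-zero functions $h_1,\dots,h_n$ the rotation coefficient matrix of $\sum h_i^2du_i^2$ is $\beta=(\beta_{ij})$, $\beta_{ij}=(h_i)_{u_j}/h_j$ for $i\ne j$, $\beta_{ii}=0$. A matrix one-form $\theta$ is flat if $d\theta+\theta\wedge\theta=0$. **(I) The associated family.** Let $\phi$ be smooth on $\Omega$ with $\phi_{u_i}>0$ such that $\sum\phi_{u_i}du_i^2$ is a flat metric (a flat Egoroff metric), let $h=(h_1,\dots,h_n)^t$ be smooth with $h_i^2=\phi_{u_i}$, let $\beta$ be its rotation coefficient matrix, and set $$\theta_\lambda=\begin{pmatrix} i\lambda\delta+[\delta,\beta]&\delta h\\0&0\end{pmatrix}.$$ Then: 1. $\theta_\lambda$ is flat for all $\lambda\in\mathbb{C}$.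 2. For each $\lambda\in\mathbb{C}$ there is a unique $F(\cdot,\lambda)$ on $\Omega$ with $F^{-1}dF=\theta_\lambda$, $F(0,\lambda)=I$. It is smooth in $u$, has the form $F=\begin{pmatrix}E&X\\0&1\end{pmatrix}$, and is entire in $\lambda$ for each $u\in\Omega$. 3. $E^{-1}dE=i\lambda\delta+[\delta,\beta]$ and $E(0,\lambda)=I$. 4. For each $\lambda\in\mathbb{R}$, $X_\lambda=X(\cdot,\lambda)$ is a flat Lagrangian immersion of $\Omega$ in $\mathbb{C}^n$ with first and second fundamental forms $\mathrm{I}=\sum\phi_{u_i}du_i^2$ and $\mathrm{II}_\lambda=\lambda\sum du_i^2\otimes J(\partial X_\lambda/\partial u_i)$. Moreover $X(\cdot,0)$ takes values in $\mathbb{R}^n\subset\mathbb{C}^n$ and is an Egoroff net: a local diffeomorphism into $\mathbb{R}^n$ with mutually orthogonal partial derivatives such that $\|\partial X(\cdot,0)/\partial u_i\|^2=\psi_{u_i}$ for some smooth function $\psi$ on $\Omega$. **(II) The system and its Lax pair.** Let $\mathcal{P}$ be the $-1$ eigenspace of $A\mapsto TAT$, $T=\operatorname{diag}(I_n,-I_n,1)$,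 on the Lie algebra $$\mathfrak{u}(n)\ltimes\mathbb{R}^{2n}=\left\{\begin{pmatrix}b&-c&x\\c&b&y\\0&0&0\end{pmatrix}: b^t=-b,\ c^t=c \text{ real},\ x,y\in\mathbb{R}^n\right\},$$ put $a_j=e_{n+j,j}-e_{j,n+j}$ and $q=\begin{pmatrix}0&\beta&0\\-\beta&0&-h\\0&0&0\end{pmatrix}$. The $\frac{U(n)\ltimes\mathbb{C}^n}{O(n)\ltimes\mathbb{R}^n}$-system is $$-[a_i,q_{u_j}]+[a_j,q_{u_i}]+[[a_i,q],[a_j,q]]=0\quad(i\ne j),$$ for smooth $q$ with values in $\mathcal{P}$ and $\beta_{jj}=0$. For smooth real symmetric $\beta$ with zero diagonal and smooth $h:\Omega\to\mathbb{R}^n$ the following are equivalent: (a) $q$ solves the system; (b) $[\delta,\beta]$ is flat and $(h_i)_{u_j}=\beta_{ij}h_j$ for $i\neq j$; (c) $\sum(\lambda a_j+[a_j,q])\,du_j$ is flat for all $\lambda\in\mathbb{C}$; (d) $\theta_\lambda$ is flat for all $\lambda\in\mathbb{C}$. For real $\lambda$, the one-form in (c) is $\theta_\lambda$ under the identification of $\begin{pmatrix}P+iQ&x+iy\\0&0\end{pmatrix}$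 with $\begin{pmatrix}P&-Q&x\\Q&P&y\\0&0&0\end{pmatrix}$. **(III) The system is the equation for flat Lagrangian immersions.** Let $h:\Omega\to\mathbb{R}^n$ be smooth with nowhere-zero components and let $\beta$ be a real $n\times n$ matrix function on $\Omega$. Then $q$ (built from $\beta,h$) is a solution of the system in (II) if and only if $\beta$ is the rotation coefficient matrix of $\sum h_i^2du_i^2$ and there is a flat Lagrangian immersion $f:\Omega\to\mathbb{C}^n$ with non-degenerate normal bundle (the space of shape operators has dimension $n$ at every point) whose fundamental forms are $\mathrm{I}=\sum h_i^2du_i^2$ and $\mathrm{II}=\sum du_i^2\otimes J(\partial f/\partial u_i)$. -/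

import Mathlib

open Matrix Set
open scoped ContDiff Manifold

noncomputable section

namespace FlatLagrangian

/-! ### Calculus in the parameters `u = (u₁, …, uₙ)` -/

/-- The parameter space of `u = (u₁, …, uₙ)`. -/
abbrev Params (n : ℕ) : Type := Fin n → ℝ

/-- The target space `ℂⁿ` with its standard Hermitian structure
`⟪Z₁, Z₂⟫ = ∑ conj (Z₁ k) * Z₂ k`; the real part of it is the Euclidean inner product of
`ℝ²ⁿ`. -/
abbrev Cn (n : ℕ) : Type := EuclideanSpace ℂ (Fin n)

/-- The partial derivative `∂f/∂uᵢ` at `u`. -/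
def pd {n : ℕ} {V : Type*} [NormedAddCommGroup V] [NormedSpace ℝ V]
    (i : Fin n) (f : Params n → V) (u : Params n) : V :=
  fderiv ℝ f u (Pi.single i 1)

/-- The entrywise partial derivative `∂A/∂uᵢ` of a matrix valued function. -/
def pdMat {n : ℕ} {m : Type*} {R : Type*} [NormedRing R] [NormedAlgebra ℝ R]
    (i : Fin n) (A : Params n → Matrix m m R) (u : Params n) : Matrix m m R :=
  Matrix.of fun a b => pd i (fun v => A v a b) u

/-! ### Riemannian metrics in coordinates -/

/-- Christoffel symbols `Γᵏᵢⱼ = ½ ∑ₗ gᵏˡ (∂ᵢ gⱼₗ + ∂ⱼ gᵢₗ - ∂ₗ gᵢⱼ)`. -/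
def christoffel {n : ℕ} (g : Params n → Matrix (Fin n) (Fin n) ℝ) (k i j : Fin n)
    (u : Params n) : ℝ :=
  (1 / 2) * ∑ l, (g u)⁻¹ k l *
    (pd i (fun v => g v j l) u + pd j (fun v => g v i l) u - pd l (fun v => g v i j) u)

/-- The Riemann curvature tensor
`Rˡₖᵢⱼ = ∂ᵢ Γˡⱼₖ - ∂ⱼ Γˡᵢₖ + ∑ₘ (Γˡᵢₘ Γᵐⱼₖ - Γˡⱼₘ Γᵐᵢₖ)`. -/
def riemann {n : ℕ} (g : Params n → Matrix (Fin n) (Fin n) ℝ) (l k i j : Fin n)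
    (u : Params n) : ℝ :=
  pd i (christoffel g l j k) u - pd j (christoffel g l i k) u
    + ∑ m, (christoffel g l i m u * christoffel g m j k u
      - christoffel g l j m u * christoffel g m i k u)

/-- The metric `∑ gᵢⱼ duᵢ duⱼ` is flat on `Ω`: its curvature tensor vanishes. -/
def IsFlatMetric {n : ℕ} (Ω : Set (Params n)) (g : Params n → Matrix (Fin n) (Fin n) ℝ) :
    Prop :=
  ∀ u ∈ Ω, ∀ l k i j, riemann g l k i j u = 0

/-- `∑ φ_{uᵢ} duᵢ²` is a flat Egoroff metric on `Ω` with potential function `φ`. -/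
structure IsFlatEgoroffMetric {n : ℕ} (Ω : Set (Params n)) (φ : Params n → ℝ) : Prop where
  smooth : ContDiffOn ℝ ∞ φ Ω
  pos : ∀ u ∈ Ω, ∀ i, 0 < pd i φ u
  flat : IsFlatMetric Ω (fun u => Matrix.diagonal fun i => pd i φ u)

/-- The rotation coefficient matrix of `∑ hᵢ² duᵢ²`: `βᵢⱼ = (hᵢ)_{uⱼ} / hⱼ` for `i ≠ j`
and `βᵢᵢ = 0`. -/
def rotationCoeff {n : ℕ} (h : Params n → Fin n → ℝ) (u : Params n) :
    Matrix (Fin n) (Fin n) ℝ :=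
  Matrix.of fun i j => if i = j then 0 else pd j (fun v => h v i) u / h u j

/-! ### Connection one-forms and frames -/

/-- The matrix valued one-form `θ = ∑ θᵢ duᵢ` is flat on `Ω`: `dθ + θ ∧ θ = 0`. -/
def IsFlatConnection {n : ℕ} {m : Type*} [Fintype m] [DecidableEq m]
    {R : Type*} [NormedRing R] [NormedAlgebra ℝ R]
    (Ω : Set (Params n)) (θ : Fin n → Params n → Matrix m m R) : Prop :=
  ∀ u ∈ Ω, ∀ i j, pdMat i (θ j) u - pdMat j (θ i) u + ⁅θ i u, θ j u⁆ = 0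

/-- `F` is a frame on `Ω` for the one-form `θ = ∑ θᵢ duᵢ`:
`F` is invertible, `F⁻¹ dF = θ` and `F(0) = I`. -/
structure IsFrame {n : ℕ} {m : Type*} [Fintype m] [DecidableEq m]
    (Ω : Set (Params n)) (θ : Fin n → Params n → Matrix m m ℂ)
    (F : Params n → Matrix m m ℂ) : Prop where
  differentiable : ∀ a b, DifferentiableOn ℝ (fun u => F u a b) Ω
  invertible : ∀ u ∈ Ω, IsUnit (F u)
  eqn : ∀ u ∈ Ω, ∀ i, (F u)⁻¹ * pdMat i F u = θ i u
  initial : F 0 = 1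

/-- The elementary diagonal matrix `eᵢᵢ`, the coefficient of `duᵢ` in
`δ = diag(du₁, …, duₙ)`. -/
def eDiag {n : ℕ} (R : Type*) [Zero R] [One R] (i : Fin n) : Matrix (Fin n) (Fin n) R :=
  Matrix.single i i 1

/-- The coefficients of the real one-form `[δ, β]`. -/
def deltaBeta {n : ℕ} (β : Params n → Matrix (Fin n) (Fin n) ℝ) (i : Fin n) (u : Params n) :
    Matrix (Fin n) (Fin n) ℝ :=
  ⁅eDiag ℝ i, β u⁆

/-- The coefficients of the one-form `w_λ = i λ δ + [δ, β]`. -/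
def wForm {n : ℕ} (β : Params n → Matrix (Fin n) (Fin n) ℝ) (lam : ℂ) (i : Fin n)
    (u : Params n) : Matrix (Fin n) (Fin n) ℂ :=
  (Complex.I * lam) • eDiag ℂ i + (deltaBeta β i u).map Complex.ofReal

/-- The coefficients of the one-form
`θ_λ = (i λ δ + [δ, β], δ h; 0, 0)`. -/
def thetaForm {n : ℕ} (β : Params n → Matrix (Fin n) (Fin n) ℝ) (h : Params n → Fin n → ℝ)
    (lam : ℂ) (i : Fin n) (u : Params n) : Matrix (Fin n ⊕ Unit) (Fin n ⊕ Unit) ℂ :=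
  Matrix.fromBlocks (wForm β lam i u)
    (Matrix.of fun k _ => ((eDiag ℝ i *ᵥ h u) k : ℂ)) 0 0

/-- The block matrix `(E, X; 0, 1)`. -/
def blockFrame {n : ℕ} (E : Matrix (Fin n) (Fin n) ℂ) (X : Cn n) :
    Matrix (Fin n ⊕ Unit) (Fin n ⊕ Unit) ℂ :=
  Matrix.fromBlocks E (Matrix.of fun k _ => X k) 0 1

/-! ### Immersions into `ℂⁿ` -/

/-- The standard inner product `Re (Z₁* Z₂)` of `ℂⁿ = ℝ²ⁿ`. -/
def innerR {n : ℕ} (Z W : Cn n) : ℝ := (inner ℂ Z W).re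

/-- The standard symplectic form `Im (Z₁* Z₂)` of `ℂⁿ`. -/
def omega {n : ℕ} (Z W : Cn n) : ℝ := (inner ℂ Z W).im

/-- The complex structure of `ℂⁿ`. -/
def J {n : ℕ} (Z : Cn n) : Cn n := Complex.I • Z

/-- The first fundamental form of `f` at `u`, evaluated on coordinate vectors `v`, `w`. -/
def firstFF {n : ℕ} (f : Params n → Cn n) (u v w : Params n) : ℝ :=
  innerR (fderiv ℝ f u v) (fderiv ℝ f u w)

/-- The normal space of `f` at `u`. -/
def normalSpace {n : ℕ} (f : Params n → Cn n) (u : Params n) : Submodule ℝ (Cn n) where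
  carrier := {ν | ∀ v, innerR (fderiv ℝ f u v) ν = 0}
  add_mem' := by
    intro a b ha hb v
    have h1 := ha v
    have h2 := hb v
    simp only [innerR] at h1 h2 ⊢
    rw [inner_add_right, Complex.add_re, h1, h2, add_zero]
  zero_mem' := by
    intro v
    simp [innerR]
  smul_mem' := by
    intro c a ha v
    have h1 := ha v
    simp only [innerR] at h1 ⊢
    rw [← Complex.coe_smul, inner_smul_right, Complex.re_ofReal_mul, h1, mul_zero]

/-- `N` is the value at `(v, w)` of the second fundamental form of `f` at `u`: the component
of the second derivative `D²f(v, w)` normal to the tangent space. -/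
def IsSecondFF {n : ℕ} (f : Params n → Cn n) (u v w : Params n) (N : Cn n) : Prop :=
  N ∈ normalSpace f u ∧ ∃ t : Params n, fderiv ℝ (fderiv ℝ f) u v w = fderiv ℝ f u t + N

/-- `f` is a smooth flat Lagrangian immersion of `Ω` into `ℂⁿ`. -/
structure IsFlatLagrangianImmersion {n : ℕ} (Ω : Set (Params n)) (f : Params n → Cn n) :
    Prop where
  smooth : ContDiffOn ℝ ∞ f Ω
  immersion : ∀ u ∈ Ω, Function.Injective (fderiv ℝ f u)
  lagrangian : ∀ u ∈ Ω, ∀ v w, omega (fderiv ℝ f u v) (fderiv ℝ f u w) = 0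
  flat : IsFlatMetric Ω
    (fun u => Matrix.of fun i j => firstFF f u (Pi.single i 1) (Pi.single j 1))

/-- The first fundamental form of `f` is `∑ gᵢ duᵢ²`. -/
def HasFirstFF {n : ℕ} (Ω : Set (Params n)) (f : Params n → Cn n)
    (g : Params n → Fin n → ℝ) : Prop :=
  ∀ u ∈ Ω, ∀ v w, firstFF f u v w = ∑ i, g u i * v i * w i

/-- The second fundamental form of `f` is `c ∑ duᵢ² ⊗ J (∂f/∂uᵢ)`. -/
def HasSecondFF {n : ℕ} (Ω : Set (Params n)) (f : Params n → Cn n) (c : ℝ) : Prop :=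
  ∀ u ∈ Ω, ∀ v w, IsSecondFF f u v w (c • ∑ i, (v i * w i) • J (pd i f u))

/-- `S` is the shape operator of `f` at `u` in the normal direction `ν`, acting on coordinate
vectors: `⟨S v, w⟩ = ⟨II(v, w), ν⟩`. -/
def IsShapeOperator {n : ℕ} (f : Params n → Cn n) (u : Params n) (ν : Cn n)
    (S : Params n →ₗ[ℝ] Params n) : Prop :=
  ∀ v w N, IsSecondFF f u v w N → firstFF f u (S v) w = innerR N ν

/-- The normal bundle of `f : Ω → ℂⁿ` is non-degenerate: at every point the space of shape
operators has dimension equal to the codimension `n`. -/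
def HasNondegenerateNormalBundle {n : ℕ} (Ω : Set (Params n)) (f : Params n → Cn n) : Prop :=
  ∀ u ∈ Ω, Module.finrank ℝ (Submodule.span ℝ
    {S : Params n →ₗ[ℝ] Params n | ∃ ν ∈ normalSpace f u, IsShapeOperator f u ν S}) = n

/-- `x : Ω → ℝⁿ` is an Egoroff net: a local diffeomorphism with mutually orthogonal parameter
lines, for which there is a potential function `φ` with `φ_{uᵢ} = ‖∂x/∂uᵢ‖²`. -/
structure IsEgoroffNet {n : ℕ} (Ω : Set (Params n))
    (x : Params n → EuclideanSpace ℝ (Fin n)) : Prop where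
  net : IsLocalDiffeomorphOn 𝓘(ℝ, Params n) 𝓘(ℝ, EuclideanSpace ℝ (Fin n)) ∞ x Ω
  orthogonal : ∀ u ∈ Ω, ∀ i j, i ≠ j → inner ℝ (pd i x u) (pd j x u) = 0
  potential : ∃ φ : Params n → ℝ, ContDiffOn ℝ ∞ φ Ω ∧
    ∀ u ∈ Ω, ∀ i, pd i φ u = ‖pd i x u‖ ^ 2

/-! ### The `(U(n) ⋉ ℂⁿ) / (O(n) ⋉ ℝⁿ)`-system -/

/-- Row and column indices of `(2n+1) × (2n+1)` matrices with block sizes `n`, `n`, `1`. -/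
abbrev Idx (n : ℕ) : Type := Fin n ⊕ (Fin n ⊕ Unit)

/-- The block matrix `(A, B, x; C, D, y; 0, 0, 0)`. -/
def block3 {n : ℕ} {R : Type*} [Zero R] (A B C D : Matrix (Fin n) (Fin n) R)
    (x y : Fin n → R) : Matrix (Idx n) (Idx n) R :=
  Matrix.of fun p q =>
    match p, q with
    | .inl i, .inl j => A i j
    | .inl i, .inr (.inl j) => B i j
    | .inl i, .inr (.inr _) => x i
    | .inr (.inl i), .inl j => C i j
    | .inr (.inl i), .inr (.inl j) => D i j
    | .inr (.inl i), .inr (.inr _) => y i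
    | .inr (.inr _), _ => 0

/-- The Lie algebra `𝒰 = u(n) ⋉ ℝ²ⁿ` of matrices `(b, -c, x; c, b, y; 0, 0, 0)` with
`bᵗ = -b` and `cᵗ = c`. -/
def unitaryMotionAlgebra (n : ℕ) : Set (Matrix (Idx n) (Idx n) ℝ) :=
  {M | ∃ (b c : Matrix (Fin n) (Fin n) ℝ) (x y : Fin n → ℝ),
    bᵀ = -b ∧ cᵀ = c ∧ M = block3 b (-c) c b x y}

/-- The matrix `T = diag(Iₙ, -Iₙ, 1)`. -/
def T (n : ℕ) : Matrix (Idx n) (Idx n) ℝ :=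
  Matrix.diagonal (Sum.elim (fun _ => 1) (Sum.elim (fun _ => -1) (fun _ => 1)))

/-- The space `𝒫` of the Cartan decomposition `𝒰 = 𝒦 + 𝒫`: the `-1` eigenspace on `𝒰` of the
involution `A ↦ T A T`, whose fixed point set is `o(n) ⋉ ℝⁿ`. -/
def cartanP (n : ℕ) : Set (Matrix (Idx n) (Idx n) ℝ) :=
  {M | M ∈ unitaryMotionAlgebra n ∧ T n * M * T n = -M}

/-- The generators `aⱼ = e_{n+j,j} - e_{j,n+j}` of a maximal abelian subalgebra in `𝒫`. -/
def aGen {n : ℕ} (j : Fin n) : Matrix (Idx n) (Idx n) ℝ :=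
  Matrix.single (.inr (.inl j)) (.inl j) 1 - Matrix.single (.inl j) (.inr (.inl j)) 1

/-- The matrix `q = (0, β, 0; -β, 0, -h; 0, 0, 0)`. -/
def qField {n : ℕ} (β : Params n → Matrix (Fin n) (Fin n) ℝ) (h : Params n → Fin n → ℝ)
    (u : Params n) : Matrix (Idx n) (Idx n) ℝ :=
  block3 0 (β u) (-(β u)) 0 0 (-(h u))

/-- `q` is a smooth solution on `Ω` of the `(U(n) ⋉ ℂⁿ) / (O(n) ⋉ ℝⁿ)`-system: it has values
in `𝒫`, the diagonal of its `n × n` block vanishes, and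
`-[aᵢ, q_{uⱼ}] + [aⱼ, q_{uᵢ}] + [[aᵢ, q], [aⱼ, q]] = 0` for `i ≠ j`. -/
structure IsUKSystemSolution {n : ℕ} (Ω : Set (Params n))
    (q : Params n → Matrix (Idx n) (Idx n) ℝ) : Prop where
  smooth : ∀ a b, ContDiffOn ℝ ∞ (fun u => q u a b) Ω
  mem : ∀ u ∈ Ω, q u ∈ cartanP n
  diag : ∀ u ∈ Ω, ∀ j, q u (.inl j) (.inr (.inl j)) = 0
  eqn : ∀ u ∈ Ω, ∀ i j, i ≠ j →
    -⁅aGen i, pdMat j q u⁆ + ⁅aGen j, pdMat i q u⁆ + ⁅⁅aGen i, q u⁆, ⁅aGen j, q u⁆⁆ = 0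

/-- The coefficients of the one-form `∑ (λ aⱼ + [aⱼ, q]) duⱼ`. -/
def laxUK {n : ℕ} (q : Params n → Matrix (Idx n) (Idx n) ℝ) (lam : ℂ) (j : Fin n)
    (u : Params n) : Matrix (Idx n) (Idx n) ℂ :=
  lam • (aGen j).map Complex.ofReal + (⁅aGen j, q u⁆).map Complex.ofReal

/-- The identification of `(A, x; 0, 0)`, with `A` a complex `n × n` matrix and `x ∈ ℂⁿ`, with
the real matrix `(Re A, -Im A, Re x; Im A, Re A, Im x; 0, 0, 0)`. -/
def realify {n : ℕ} (M : Matrix (Fin n ⊕ Unit) (Fin n ⊕ Unit) ℂ) :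
    Matrix (Idx n) (Idx n) ℝ :=
  block3 (M.toBlocks₁₁.map Complex.re) (-(M.toBlocks₁₁.map Complex.im))
    (M.toBlocks₁₁.map Complex.im) (M.toBlocks₁₁.map Complex.re)
    (fun k => (M (.inl k) (.inr ())).re) (fun k => (M (.inl k) (.inr ())).im)

end FlatLagrangian

end

/-!
All three parts rest on the structure equations of an adapted frame. For the columns `c₁, …, cₙ` of
a solution `E` of `dE = E (iλδ + [δ, β])` and a solution `X` of `dX = E δ h`, the coordinate vectors
of `X` are `∂X/∂uᵢ = hᵢ cᵢ`. If `λ` is real and `β` is real and symmetric, `iλδ + [δ, β]` is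
skew-Hermitian, so the `cᵢ` are orthonormal for the Hermitian product
(`IsFrame.conjTranspose_mul_self`). This gives at once the first fundamental form `∑ hᵢ² duᵢ²` and
the Lagrangian condition, and the derivative of `cᵢ` shows that the normal component of the second
derivatives is `λ ∑ duᵢ² ⊗ J (∂X/∂uᵢ)` (`IsFrame.immersion`).

Such frames exist over a simply connected domain exactly because the connection is flat. Near a
point a frame is obtained by integrating along rays (`exists_parallel_near`); the local frames
differ by locally constant factors, hence form a covering space of the domain, and a section of the
covering glues them (`exists_parallel_of_simplyConnected`). A Grönwall estimate propagated over the
connected domain (`exists_norm_le_of_fderiv_bound`) gives uniqueness. The same estimate shows that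
the frame is holomorphic in `λ`: the candidate for the derivative is an off-diagonal block of the
frame of the connection `(θ, θ'; 0, θ)`, which is again flat (`differentiable_frame`).

Flatness of `θ_λ` is flatness of `[δ, β]` together with `(hᵢ)_{uⱼ} = βᵢⱼ hⱼ`, for every single `λ`,
because the spectral terms of the curvature cancel by the Jacobi identity (`curvature_spectral`).
The system for `q` and its Lax pair split in the same way, by block multiplication
(`system_eq_block3`). Flatness of `[δ, β]` is in turn flatness of the metric `∑ hᵢ² duᵢ²`, provided
that `β` is symmetric: the Levi-Civita connection in the orthonormal frame `hᵢ⁻¹ ∂ᵢ` is `[δ, β]`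
(`isFlatMetric_diagonal_iff`). For an Egoroff metric the symmetry of `β` is that of the second
derivatives of `φ`. For a flat Lagrangian immersion with the given second fundamental form it
follows from the third derivatives (`pd_comm_of_hasSecondFF`).
-/

noncomputable section

namespace FlatLagrangian

/-! ### Parallel sections of a flat connection -/

section Parallel

open Topology Metric

variable {V : Type*} [NormedAddCommGroup V] [NormedSpace ℝ V]
  {𝔸 : Type*} [NormedRing 𝔸] [NormedAlgebra ℝ 𝔸]

/-- `F` solves `dF = F θ` on `Ω`, for a one-form `θ` with values in a normed algebra. -/
def IsParallelOn (Ω : Set V) (θ : V → V →L[ℝ] 𝔸) (F : V → 𝔸) : Prop :=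
  ∀ u ∈ Ω, HasFDerivAt F (F u • θ u) u

/-- `dθ + θ ∧ θ = 0` on `Ω`, for a one-form `θ` with values in a normed algebra. -/
def IsFlatOn (Ω : Set V) (θ : V → V →L[ℝ] 𝔸) : Prop :=
  ∀ u ∈ Ω, ∀ v w, fderiv ℝ θ u v w - fderiv ℝ θ u w v + (θ u v * θ u w - θ u w * θ u v) = 0

theorem norm_smul_clm_le (a : 𝔸) (f : V →L[ℝ] 𝔸) : ‖a • f‖ ≤ ‖a‖ * ‖f‖ := by
  refine ContinuousLinearMap.opNorm_le_bound _ (by positivity) fun v => ?_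
  calc ‖a * f v‖ ≤ ‖a‖ * ‖f v‖ := norm_mul_le _ _
    _ ≤ ‖a‖ * (‖f‖ * ‖v‖) := by gcongr; exact f.le_opNorm v
    _ = _ := by ring

/-- A family of functions that vanish at a point and satisfy `‖dRᵢ‖ ≤ K (‖Rᵢ‖ + ρᵢ)` locally
uniformly is bounded by a multiple of `ρᵢ` at every point of a connected open set. By Grönwall's
inequality along segments, the set of points where such a bound holds is open and closed. -/
theorem exists_norm_le_of_fderiv_bound {ι E : Type*} [NormedAddCommGroup E] [NormedSpace ℝ E]
    {Ω : Set V} (hΩ : IsOpen Ω) (hc : IsPreconnected Ω) {R : ι → V → E}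
    {R' : ι → V → V →L[ℝ] E} {ρ : ι → ℝ}
    (hR : ∀ i, ∀ u ∈ Ω, HasFDerivAt (R i) (R' i u) u) (hρ : ∀ i, 0 ≤ ρ i)
    (hb : ∀ u ∈ Ω, ∃ K : ℝ, ∀ᶠ x in 𝓝 u, ∀ i, ‖R' i x‖ ≤ K * (‖R i x‖ + ρ i))
    {p : V} (hp : p ∈ Ω) (h0 : ∀ i, R i p = 0) {u : V} (hu : u ∈ Ω) :
    ∃ C : ℝ, ∀ i, ‖R i u‖ ≤ C * ρ i := by
  set S : Set V := {u | u ∈ Ω ∧ ∃ C : ℝ, ∀ i, ‖R i u‖ ≤ C * ρ i} with hS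
  have key : ∀ u ∈ Ω, ∃ r > 0, ∀ x ∈ ball u r, ∀ y ∈ ball u r, x ∈ S → y ∈ S := by
    intro u hu
    obtain ⟨K, hK⟩ := hb u hu
    obtain ⟨r, hr, hball⟩ := Metric.eventually_nhds_iff_ball.1 (hK.and (hΩ.mem_nhds hu))
    refine ⟨r, hr, fun x hx y hy hxS => ⟨(hball y hy).2, ?_⟩⟩
    obtain ⟨-, C, hC⟩ := hxS
    set K' : ℝ := |K| * ‖y - x‖ + 1 with hK'
    have hK'pos : 0 < K' := by positivity
    refine ⟨(C + 1) * Real.exp K', fun i => ?_⟩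
    have hseg : ∀ t ∈ Icc (0 : ℝ) 1, x + t • (y - x) ∈ ball u r := fun t ht =>
      (convex_ball u r).add_smul_sub_mem hx hy ht
    have hd : ∀ t ∈ Icc (0 : ℝ) 1, HasDerivAt (fun t : ℝ => R i (x + t • (y - x)))
        (R' i (x + t • (y - x)) (y - x)) t := by
      intro t ht
      have h1 : HasDerivAt (fun t : ℝ => x + t • (y - x)) (y - x) t := by
        simpa using ((hasDerivAt_id t).smul_const (y - x)).const_add x
      exact (hR i _ (hball _ (hseg t ht)).2).comp_hasDerivAt t h1
    have hg := norm_le_gronwallBound_of_norm_deriv_right_le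
      (δ := ‖R i x‖) (K := K') (ε := K' * ρ i) (a := 0) (b := 1)
      (fun t ht => (hd t ht).continuousAt.continuousWithinAt)
      (fun t ht => (hd t ⟨ht.1, ht.2.le⟩).hasDerivWithinAt) (by simp)
      (fun t ht => by
        have ht' : t ∈ Icc (0 : ℝ) 1 := ⟨ht.1, ht.2.le⟩
        have h1 := (hball _ (hseg t ht')).1 i
        have h2 := (R' i (x + t • (y - x))).le_opNorm (y - x)
        have h3 : 0 ≤ ‖R i (x + t • (y - x))‖ + ρ i := add_nonneg (norm_nonneg _) (hρ i)
        calc _ ≤ _ := h2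
          _ ≤ (K * (‖R i (x + t • (y - x))‖ + ρ i)) * ‖y - x‖ := by gcongr
          _ ≤ (|K| * (‖R i (x + t • (y - x))‖ + ρ i)) * ‖y - x‖ := by
            gcongr; exact le_abs_self K
          _ = (|K| * ‖y - x‖) * (‖R i (x + t • (y - x))‖ + ρ i) := by ring
          _ ≤ K' * (‖R i (x + t • (y - x))‖ + ρ i) := by
            gcongr; rw [hK']; linarith
          _ = _ := by ring) 1 (by simp)
    rw [gronwallBound_of_K_ne_0 hK'pos.ne'] at hg
    have h4 : K' * ρ i / K' = ρ i := by field_simp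
    simp only [one_smul, add_sub_cancel, sub_zero, mul_one, h4] at hg
    have h5 := Real.exp_pos K'
    have h6 := hC i
    have h7 := hρ i
    calc ‖R i y‖ ≤ _ := hg
      _ ≤ C * ρ i * Real.exp K' + ρ i * Real.exp K' := by
        gcongr; linarith
      _ = _ := by ring
  have hSo : IsOpen S := by
    rw [Metric.isOpen_iff]
    intro x hx
    obtain ⟨r, hr, h⟩ := key x hx.1
    exact ⟨r, hr, fun y hy => h x (mem_ball_self hr) y hy hx⟩
  have hsub : Ω ⊆ S := by
    refine hc.subset_of_closure_inter_subset hSo ⟨p, hp, hp, 0, fun i => by simp [h0 i]⟩ ?_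
    rintro x ⟨hx, hxΩ⟩
    obtain ⟨r, hr, h⟩ := key x hxΩ
    obtain ⟨y, hy, hyx⟩ := Metric.mem_closure_iff.1 hx r hr
    exact h y (by rwa [mem_ball, dist_comm]) x (mem_ball_self hr) hy
  exact (hsub hu).2

/-- Parallel sections over a connected open set that agree at one point are equal. -/
theorem IsParallelOn.eqOn {Ω : Set V} (hΩ : IsOpen Ω) (hc : IsPreconnected Ω)
    {θ : V → V →L[ℝ] 𝔸} (hθ : ContinuousOn θ Ω) {F G : V → 𝔸} (hF : IsParallelOn Ω θ F)
    (hG : IsParallelOn Ω θ G) {p : V} (hp : p ∈ Ω) (h : F p = G p) : EqOn F G Ω := by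
  intro u hu
  obtain ⟨C, hC⟩ := exists_norm_le_of_fderiv_bound (ι := Unit) hΩ hc
    (R := fun _ u => F u - G u) (R' := fun _ u => (F u - G u) • θ u) (ρ := fun _ => 0)
    (fun _ u hu => by
      convert! (hF u hu).sub (hG u hu) using 1
      ext v
      simp [sub_mul]) (fun _ => le_rfl)
    (fun u hu => ⟨‖θ u‖ + 1, by
      filter_upwards [(hθ.continuousAt (hΩ.mem_nhds hu)).norm.eventually_lt_const
        (lt_add_one _)] with x hx _
      calc ‖(F x - G x) • θ x‖ ≤ ‖F x - G x‖ * ‖θ x‖ := norm_smul_clm_le _ _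
        _ ≤ ‖F x - G x‖ * (‖θ u‖ + 1) := by gcongr
        _ = _ := by ring⟩) hp (fun _ => by simp [h]) hu
  have := hC ()
  simp only [mul_zero, norm_le_zero_iff, sub_eq_zero] at this
  exact this

theorem IsParallelOn.const_mul {Ω : Set V} {θ : V → V →L[ℝ] 𝔸} {F : V → 𝔸}
    (hF : IsParallelOn Ω θ F) (c : 𝔸) : IsParallelOn Ω θ fun u => c * F u := by
  intro u hu
  have := (hF u hu).const_mul c
  convert! this using 1
  ext v
  simp [mul_assoc]

theorem IsParallelOn.mono {Ω Ω' : Set V} {θ : V → V →L[ℝ] 𝔸} {F : V → 𝔸}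
    (hF : IsParallelOn Ω θ F) (h : Ω' ⊆ Ω) : IsParallelOn Ω' θ F :=
  fun u hu => hF u (h hu)

/-- The linear equation `y' = y A`, `y(0) = 1` with small coefficients is solvable on all of
`[0, 1]` by a single application of the Picard–Lindelöf theorem on the unit ball around `1`. -/
theorem exists_hasDerivWithinAt_mul [CompleteSpace 𝔸] {A : ℝ → 𝔸}
    (hA : ContinuousOn A (Icc 0 1)) {ε : ℝ}
    (hε : ε * (‖(1 : 𝔸)‖ + 1) ≤ 1) (hAε : ∀ t ∈ Icc (0 : ℝ) 1, ‖A t‖ ≤ ε) :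
    ∃ y : ℝ → 𝔸, y 0 = 1 ∧
      ∀ t ∈ Icc (0 : ℝ) 1, HasDerivWithinAt y (y t * A t) (Icc 0 1) t := by
  have hε0 : 0 ≤ ε := (norm_nonneg _).trans (hAε 0 (by simp))
  have hε1 : ε ≤ 1 := by nlinarith [norm_nonneg (1 : 𝔸)]
  have hPL : IsPicardLindelof (fun t x => x * A t) (⟨0, by simp⟩ : Icc (0 : ℝ) 1) (1 : 𝔸)
      1 0 1 1 := by
    refine ⟨fun t ht => ?_, fun x _ => ?_, fun t ht x hx => ?_, by simp⟩
    · refine LipschitzOnWith.of_dist_le_mul fun x _ y _ => ?_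
      rw [dist_eq_norm, dist_eq_norm, ← sub_mul, NNReal.coe_one, one_mul]
      calc ‖(x - y) * A t‖ ≤ ‖x - y‖ * ‖A t‖ := norm_mul_le _ _
        _ ≤ ‖x - y‖ * 1 := by gcongr; exact (hAε t ht).trans hε1
        _ = _ := mul_one _
    · exact continuousOn_const.mul hA
    · have hx' : ‖x‖ ≤ ‖(1 : 𝔸)‖ + 1 := by
        have h1 : ‖x - 1‖ ≤ 1 := by simpa [dist_eq_norm] using hx
        have h2 := norm_le_norm_add_norm_sub (1 : 𝔸) x
        rw [norm_sub_rev] at h1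
        linarith
      calc ‖x * A t‖ ≤ ‖x‖ * ‖A t‖ := norm_mul_le _ _
        _ ≤ (‖(1 : 𝔸)‖ + 1) * ε := by gcongr; exact hAε t ht
        _ ≤ 1 := by rwa [mul_comm]
  exact hPL.exists_eq_forall_mem_Icc_hasDerivWithinAt₀

/-- Comparison of a solution `y` of a linear equation on `[0, 1]` with an approximate solution `z`
of defect at most `ε` and the same initial value. -/
theorem norm_sub_le_of_approx_linear_ode {A y z z' : ℝ → 𝔸} {K ε : ℝ} (hK : 0 < K)
    (hA : ∀ t ∈ Icc (0 : ℝ) 1, ‖A t‖ ≤ K)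
    (hy : ∀ t ∈ Icc (0 : ℝ) 1, HasDerivWithinAt y (y t * A t) (Icc 0 1) t)
    (hz : ∀ t ∈ Icc (0 : ℝ) 1, HasDerivWithinAt z (z' t) (Icc 0 1) t)
    (hε : ∀ t ∈ Icc (0 : ℝ) 1, ‖z' t - z t * A t‖ ≤ ε) (h0 : y 0 = z 0) :
    ‖y 1 - z 1‖ ≤ ε * (Real.exp K / K) := by
  have hd : ∀ t ∈ Icc (0 : ℝ) 1, HasDerivWithinAt (fun t => y t - z t)
      (y t * A t - z' t) (Icc 0 1) t := fun t ht => (hy t ht).sub (hz t ht)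
  have hε0 : 0 ≤ ε := (norm_nonneg _).trans (hε 0 (by simp))
  have hg := norm_le_gronwallBound_of_norm_deriv_right_le
      (δ := 0) (K := K) (ε := ε) (a := 0) (b := 1)
      (fun t ht => (hd t ht).continuousWithinAt)
      (fun t ht => (hd t ⟨ht.1, ht.2.le⟩).mono_of_mem_nhdsWithin
        (Icc_mem_nhdsGE_of_mem ht)) (by simp [h0])
      (fun t ht => by
        have ht' : t ∈ Icc (0 : ℝ) 1 := ⟨ht.1, ht.2.le⟩
        have e : y t * A t - z' t = (y t - z t) * A t - (z' t - z t * A t) := by noncomm_ring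
        rw [e]
        calc _ ≤ ‖(y t - z t) * A t‖ + ‖z' t - z t * A t‖ := norm_sub_le _ _
          _ ≤ ‖y t - z t‖ * ‖A t‖ + ε := add_le_add (norm_mul_le _ _) (hε t ht')
          _ ≤ ‖y t - z t‖ * K + ε := by gcongr; exact hA t ht'
          _ = _ := by ring) 1 (by simp)
  rw [gronwallBound_of_K_ne_0 hK.ne'] at hg
  simp only [zero_mul, sub_zero, mul_one, zero_add] at hg
  calc _ ≤ _ := hg
    _ ≤ ε / K * Real.exp K := by gcongr; linarith
    _ = _ := by ring

end Parallel

/-! ### Local frames of a flat connection -/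

section Local

open Topology Metric

variable {V : Type*} [NormedAddCommGroup V] [NormedSpace ℝ V]
  {𝔸 : Type*} [NormedRing 𝔸] [NormedAlgebra ℝ 𝔸]

theorem norm_taylor_two_le {E : Type*} [NormedAddCommGroup E] [NormedSpace ℝ E]
    {f : V → E} {s : Set V} (hs : Convex ℝ s) {M : ℝ} (hM : 0 ≤ M)
    (hf : ∀ x ∈ s, DifferentiableAt ℝ f x)
    (hL : ∀ x ∈ s, ∀ y ∈ s, ‖fderiv ℝ f x - fderiv ℝ f y‖ ≤ M * ‖x - y‖) {x y : V}
    (hx : x ∈ s) (hy : y ∈ s) :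
    ‖f y - f x - fderiv ℝ f x (y - x)‖ ≤ M * ‖y - x‖ ^ 2 := by
  have hseg : segment ℝ x y ⊆ s := hs.segment_subset hx hy
  have := Convex.norm_image_sub_le_of_norm_hasFDerivWithin_le' (f := f) (f' := fderiv ℝ f)
    (φ := fderiv ℝ f x) (C := M * ‖y - x‖) (s := segment ℝ x y) (x := x) (y := y)
    (fun z hz => (hf z (hseg hz)).hasFDerivAt.hasFDerivWithinAt)
    (fun z hz => (hL z (hseg hz) x hx).trans (by
      have := norm_sub_le_of_mem_segment hz
      gcongr)) (convex_segment x y) (left_mem_segment ℝ x y) (right_mem_segment ℝ x y)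
  calc _ ≤ _ := this
    _ = _ := by ring

/-- The algebraic identity behind the local integration of a flat connection: the curve
`Z(t) = y(t) (1 + t θ(w))` solves the equation of the ray in direction `v + w` up to terms of
second order in `w`. Here `a, b` are `θ(v), θ(w)`, `c` is the form at the displaced point applied
to `v + w`, and `e` is the second-order remainder. -/
theorem ray_defect_identity {y a b c e dvw dwv dww : 𝔸} {t : ℝ}
    (hflat : dvw - dwv + (a * b - b * a) = 0)
    (hc : c = a + b + t • dwv + t • dww + e) :
    (y * a * (1 + t • b) + y * (b + t • dvw)) - y * (1 + t • b) * c
      = -(y * (t • dww + e + t • (b * (c - a)))) := by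
  have h1 : dvw = dwv - (a * b - b * a) := by
    rw [← sub_eq_zero, ← hflat]; abel
  subst h1
  have h2 : c - a = b + t • dwv + t • dww + e := by rw [hc]; abel
  rw [h2, hc]
  simp only [mul_add, add_mul, smul_mul_assoc, mul_smul_comm, smul_add, smul_sub, mul_sub,
    mul_one, mul_assoc, neg_add]
  abel

variable [CompleteSpace 𝔸]

set_option maxHeartbeats 1000000 in
/-- A flat connection has a parallel frame near every point. The frame is obtained by solving
`y' = y θ` along the rays from `p`; its derivative at `p + v` in the direction `w` is found by
comparing the ray in direction `v + w` with an explicit approximate solution. -/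
theorem exists_parallel_near {Ω : Set V} (hΩ : IsOpen Ω) {θ : V → V →L[ℝ] 𝔸}
    (hθ : ContDiffOn ℝ 2 θ Ω) (hflat : IsFlatOn Ω θ) {p : V} (hp : p ∈ Ω) :
    ∃ r > 0, ball p r ⊆ Ω ∧ ∃ F : V → 𝔸, IsParallelOn (ball p r) θ F ∧
      ∀ u ∈ ball p r, IsUnit (F u) := by
  have hθp : ContDiffAt ℝ 2 θ p := hθ.contDiffAt (hΩ.mem_nhds hp)
  obtain ⟨K, s, hs, hK⟩ := (hθp.fderiv_right (m := 1) (by norm_num)).exists_lipschitzOnWith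
  have hev : ∀ᶠ x in 𝓝 p, x ∈ s ∧ x ∈ Ω ∧ ‖θ x‖ < ‖θ p‖ + 1 := by
    filter_upwards [hs, hΩ.mem_nhds hp,
      hθp.continuousAt.norm.eventually_lt_const (lt_add_one _)] with x h1 h2 h3
    exact ⟨h1, h2, h3⟩
  obtain ⟨r₀, hr₀, hball₀⟩ := Metric.eventually_nhds_iff_ball.1 hev
  -- `M` bounds `θ`, its derivative and the Lipschitz constant of the derivative near `p`
  set M : ℝ := (‖θ p‖ + 1) + ‖fderiv ℝ θ p‖ + K with hMdef
  have hMpos : 0 < M := by positivity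
  -- the last term makes `‖θ(v)‖` small enough on the ball to solve the ray equations up to time `1`
  set r : ℝ := min r₀ (min 1 (1 / (M * (‖(1 : 𝔸)‖ + 1)))) with hr
  have hrpos : 0 < r := by
    rw [hr]; refine lt_min hr₀ (lt_min one_pos (by positivity))
  have hr1 : r ≤ 1 := (min_le_right _ _).trans (min_le_left _ _)
  have hrM : M * r * (‖(1 : 𝔸)‖ + 1) ≤ 1 := by
    have h1 : r ≤ 1 / (M * (‖(1 : 𝔸)‖ + 1)) := (min_le_right _ _).trans (min_le_right _ _)
    rw [le_div_iff₀ (by positivity)] at h1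
    linarith
  have hball : ball p r ⊆ ball p r₀ := ball_subset_ball (min_le_left _ _)
  have hΩr : ball p r ⊆ Ω := fun x hx => (hball₀ x (hball hx)).2.1
  have hθM : ∀ x ∈ ball p r, ‖θ x‖ ≤ M := fun x hx => by
    have := (hball₀ x (hball hx)).2.2
    have := norm_nonneg (fderiv ℝ θ p)
    have := K.2
    rw [hMdef]; linarith
  have hDM : ∀ x ∈ ball p r, ‖fderiv ℝ θ x‖ ≤ M := fun x hx => by
    have h1 := hK.dist_le_mul x (hball₀ x (hball hx)).1 p (mem_of_mem_nhds hs)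
    have h2 : dist x p ≤ 1 := (mem_ball.1 hx).le.trans hr1
    have h3 := norm_le_norm_add_norm_sub (fderiv ℝ θ p) (fderiv ℝ θ x)
    rw [norm_sub_rev, ← dist_eq_norm] at h3
    have h4 : (K : ℝ) * dist x p ≤ K := mul_le_of_le_one_right K.2 h2
    have := norm_nonneg (θ p)
    rw [hMdef]; linarith
  have hLip : ∀ x ∈ ball p r, ∀ y ∈ ball p r,
      ‖fderiv ℝ θ x - fderiv ℝ θ y‖ ≤ M * ‖x - y‖ := fun x hx y hy => by
    have h1 := hK.dist_le_mul x (hball₀ x (hball hx)).1 y (hball₀ y (hball hy)).1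
    rw [dist_eq_norm, dist_eq_norm] at h1
    refine h1.trans ?_
    gcongr
    rw [hMdef]
    have := norm_nonneg (fderiv ℝ θ p)
    have := norm_nonneg (θ p)
    linarith
  have hdiff : ∀ x ∈ ball p r, DifferentiableAt ℝ θ x := fun x hx =>
    (hθ.contDiffAt (hΩ.mem_nhds (hΩr hx))).differentiableAt (by norm_num)
  have hray : ∀ v ∈ ball (0 : V) r, ∀ t ∈ Icc (0 : ℝ) 1, p + t • v ∈ ball p r := by
    intro v hv t ht
    have := (convex_ball p r).add_smul_sub_mem (mem_ball_self hrpos)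
      (y := p + v) (by simpa using hv) ht
    simpa using this
  have hAc : ∀ v ∈ ball (0 : V) r, ∀ t ∈ Icc (0 : ℝ) 1,
      HasDerivAt (fun t : ℝ => θ (p + t • v)) (fderiv ℝ θ (p + t • v) v) t := by
    intro v hv t ht
    have h1 : HasDerivAt (fun t : ℝ => p + t • v) v t := by
      simpa using ((hasDerivAt_id t).smul_const v).const_add p
    exact (hdiff _ (hray v hv t ht)).hasFDerivAt.comp_hasDerivAt t h1
  have hAM : ∀ v ∈ ball (0 : V) r, ∀ t ∈ Icc (0 : ℝ) 1, ‖θ (p + t • v) v‖ ≤ M * r := by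
    intro v hv t ht
    have hv' : ‖v‖ ≤ r := by simpa using (mem_ball_zero_iff.1 hv).le
    calc _ ≤ ‖θ (p + t • v)‖ * ‖v‖ := (θ (p + t • v)).le_opNorm v
      _ ≤ M * r := by gcongr; exact hθM _ (hray v hv t ht)
  have hex : ∀ v : V, ∃ y : ℝ → 𝔸, v ∈ ball (0 : V) r → y 0 = 1 ∧
      ∀ t ∈ Icc (0 : ℝ) 1, HasDerivWithinAt y (y t * θ (p + t • v) v) (Icc 0 1) t := by
    intro v
    by_cases hv : v ∈ ball (0 : V) r
    · obtain ⟨y, hy⟩ := exists_hasDerivWithinAt_mul (A := fun t => θ (p + t • v) v)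
        (fun t ht => ((hAc v hv t ht).clm_apply
          (hasDerivAt_const t v)).continuousAt.continuousWithinAt) hrM (hAM v hv)
      exact ⟨y, fun _ => hy⟩
    · exact ⟨0, fun h => absurd h hv⟩
  choose Y hY using hex
  have hpar : IsParallelOn (ball p r) θ fun u => Y (u - p) 1 := by
    intro u hu
    set v : V := u - p with hv
    have hvr : v ∈ ball (0 : V) r := by
      rw [mem_ball_zero_iff, hv, ← dist_eq_norm]; exact hu
    obtain ⟨hy0, hy⟩ := hY v hvr
    set y := Y v with hydef
    have hyc : ContinuousOn y (Icc 0 1) := fun t ht => (hy t ht).continuousWithinAt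
    obtain ⟨B, hB⟩ := isCompact_Icc.exists_bound_of_continuousOn hyc
    have hB0 : 0 ≤ B := (norm_nonneg _).trans (hB 0 (by simp))
    have hu' : p + v = u := by simp [hv]
    -- the remainder is quadratic in `w`
    have hquad : ∀ᶠ w in 𝓝 (0 : V), ‖Y (v + w) 1 - y 1 - y 1 * θ u w‖
        ≤ B * (2 * M + 2 * M ^ 2) * (Real.exp M / M) * ‖w‖ ^ 2 := by
      have hw0 : ∀ᶠ w in 𝓝 (0 : V), v + w ∈ ball (0 : V) r := by
        have : ContinuousAt (fun w : V => v + w) 0 := by fun_prop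
        exact this.eventually_mem (isOpen_ball.mem_nhds (by simpa using hvr))
      filter_upwards [hw0] with w hw
      obtain ⟨hz0, hz⟩ := hY (v + w) hw
      have hvw1 : ‖v + w‖ ≤ 1 := ((mem_ball_zero_iff.1 hw).le).trans hr1
      -- the approximate solution for the ray in direction `v + w`
      have hZ : ∀ t ∈ Icc (0 : ℝ) 1, HasDerivWithinAt
          (fun t : ℝ => y t * (1 + t • θ (p + t • v) w))
          (y t * θ (p + t • v) v * (1 + t • θ (p + t • v) w) +
            y t * (θ (p + t • v) w + t • fderiv ℝ θ (p + t • v) v w)) (Icc 0 1) t := by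
        intro t ht
        have h1 : HasDerivAt (fun t : ℝ => θ (p + t • v) w) (fderiv ℝ θ (p + t • v) v w) t := by
          simpa using (hAc v hvr t ht).clm_apply (hasDerivAt_const t w)
        have h2 : HasDerivAt (fun t : ℝ => 1 + t • θ (p + t • v) w)
            (θ (p + t • v) w + t • fderiv ℝ θ (p + t • v) v w) t := by
          convert! ((hasDerivAt_id t).smul h1).const_add (1 : 𝔸) using 1
          simp [add_comm]
        exact (hy t ht).mul h2.hasDerivWithinAt
      have hdef : ∀ t ∈ Icc (0 : ℝ) 1,
          ‖(y t * θ (p + t • v) v * (1 + t • θ (p + t • v) w) +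
            y t * (θ (p + t • v) w + t • fderiv ℝ θ (p + t • v) v w)) -
            y t * (1 + t • θ (p + t • v) w) * θ (p + t • (v + w)) (v + w)‖
          ≤ B * (2 * M + 2 * M ^ 2) * ‖w‖ ^ 2 := by
        intro t ht
        set q : V := p + t • v with hq
        have hqr : q ∈ ball p r := hray v hvr t ht
        have hqw : p + t • (v + w) = q + t • w := by rw [hq, smul_add, add_assoc]
        have hqwr : q + t • w ∈ ball p r := hqw ▸ hray (v + w) hw t ht
        rw [hqw]
        have ht1 : |t| ≤ 1 := abs_le.2 ⟨by linarith [ht.1], ht.2⟩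
        have hnt : ∀ x : 𝔸, ‖t • x‖ ≤ ‖x‖ := fun x => by
          rw [norm_smul, Real.norm_eq_abs]
          exact mul_le_of_le_one_left (norm_nonneg _) ht1
        have hntw : ‖t • w‖ ≤ ‖w‖ := by
          rw [norm_smul, Real.norm_eq_abs]
          exact mul_le_of_le_one_left (norm_nonneg _) ht1
        set η : V →L[ℝ] 𝔸 := θ (q + t • w) - θ q - fderiv ℝ θ q (t • w) with hη
        have hηM : ‖η‖ ≤ M * ‖w‖ ^ 2 := by
          have := norm_taylor_two_le (convex_ball p r) hMpos.le hdiff hLip hqr hqwr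
          rw [add_sub_cancel_left] at this
          refine this.trans ?_
          gcongr
        have hc : θ (q + t • w) (v + w) = θ q v + θ q w + t • fderiv ℝ θ q w v
            + t • fderiv ℝ θ q w w + η (v + w) := by
          rw [hη]
          simp only [_root_.sub_apply, map_smul, _root_.smul_apply,
            map_add]
          abel
        rw [ray_defect_identity (hflat q (hΩr hqr) v w) hc, norm_neg]
        have hDw : ‖fderiv ℝ θ q w w‖ ≤ M * ‖w‖ ^ 2 := by
          calc _ ≤ ‖fderiv ℝ θ q w‖ * ‖w‖ := (fderiv ℝ θ q w).le_opNorm w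
            _ ≤ (M * ‖w‖) * ‖w‖ := by
              gcongr
              exact ((fderiv ℝ θ q).le_opNorm w).trans (by gcongr; exact hDM q hqr)
            _ = _ := by ring
        have hηvw : ‖η (v + w)‖ ≤ M * ‖w‖ ^ 2 := by
          calc _ ≤ ‖η‖ * ‖v + w‖ := η.le_opNorm _
            _ ≤ (M * ‖w‖ ^ 2) * 1 := by gcongr
            _ = _ := by ring
        have hθw : ‖θ q w‖ ≤ M * ‖w‖ :=
          ((θ q).le_opNorm w).trans (by gcongr; exact hθM q hqr)
        have hca : ‖θ (q + t • w) (v + w) - θ q v‖ ≤ 2 * (M * ‖w‖) := by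
          have e : θ (q + t • w) (v + w) - θ q v =
              θ q w + (θ (q + t • w) - θ q) (v + w) := by
            simp only [_root_.sub_apply, map_add]; abel
          have h1 : ‖θ (q + t • w) - θ q‖ ≤ M * ‖w‖ := by
            have := (convex_ball p r).norm_image_sub_le_of_norm_fderiv_le
              (fun x hx => hdiff x hx) hDM hqr hqwr
            rw [add_sub_cancel_left] at this
            exact this.trans (by gcongr)
          rw [e]
          calc _ ≤ ‖θ q w‖ + ‖(θ (q + t • w) - θ q) (v + w)‖ := norm_add_le _ _
            _ ≤ M * ‖w‖ + ‖θ (q + t • w) - θ q‖ * ‖v + w‖ :=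
              add_le_add hθw (ContinuousLinearMap.le_opNorm _ _)
            _ ≤ M * ‖w‖ + (M * ‖w‖) * 1 := by gcongr
            _ = _ := by ring
        calc _ ≤ ‖y t‖ * ‖t • fderiv ℝ θ q w w + η (v + w) +
              t • (θ q w * (θ (q + t • w) (v + w) - θ q v))‖ := norm_mul_le _ _
          _ ≤ B * (M * ‖w‖ ^ 2 + M * ‖w‖ ^ 2 + (M * ‖w‖) * (2 * (M * ‖w‖))) := by
            gcongr
            · exact hB t ht
            · refine (norm_add₃_le).trans ?_
              gcongr
              · exact (hnt _).trans hDw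
              · refine (hnt _).trans ((norm_mul_le _ _).trans ?_)
                gcongr
          _ = _ := by ring
      have := norm_sub_le_of_approx_linear_ode hMpos
        (fun t ht => (hAM (v + w) hw t ht).trans (by nlinarith)) hz hZ hdef (by simp [hz0, hy0])
      simp only [one_smul, hu'] at this
      calc _ = ‖Y (v + w) 1 - y 1 * (1 + θ u w)‖ := by rw [mul_add, mul_one, sub_sub]
        _ ≤ _ := this
        _ = _ := by ring
    rw [hasFDerivAt_iff_isLittleO_nhds_zero]
    refine Asymptotics.IsBigO.trans_isLittleO (g := fun w : V => ‖w‖ ^ 2) ?_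
      (Asymptotics.isLittleO_norm_pow_id one_lt_two)
    refine Asymptotics.IsBigO.of_bound (B * (2 * M + 2 * M ^ 2) * (Real.exp M / M)) ?_
    filter_upwards [hquad] with w hw
    have e : u + w - p = v + w := by rw [hv]; abel
    rw [e, Real.norm_of_nonneg (by positivity)]
    exact hw
  have hY1 : Y (p - p) 1 = 1 := by
    have h00 : (0 : V) ∈ ball (0 : V) r := mem_ball_self hrpos
    obtain ⟨h0, h1⟩ := hY 0 h00
    have := norm_sub_le_of_approx_linear_ode (z := fun _ => 1) (z' := fun _ => 0) (ε := 0)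
      hMpos (fun t ht => (hAM 0 h00 t ht).trans (by nlinarith)) h1
      (fun t _ => hasDerivWithinAt_const _ _ _) (by simp) h0
    simp only [zero_mul, norm_le_zero_iff, sub_eq_zero] at this
    rw [sub_self, this]
  have hunit : ∀ᶠ u in 𝓝 p, IsUnit (Y (u - p) 1) := by
    refine (hpar p (mem_ball_self hrpos)).continuousAt.eventually_mem (s := {x | IsUnit x}) ?_
    exact Units.isOpen.mem_nhds (by rw [mem_ofPred_eq, hY1]; exact isUnit_one)
  obtain ⟨r₁, hr₁, hb₁⟩ := Metric.eventually_nhds_iff_ball.1 hunit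
  refine ⟨min r r₁, lt_min hrpos hr₁, (ball_subset_ball (min_le_left _ _)).trans hΩr, _,
    hpar.mono (ball_subset_ball (min_le_left _ _)), fun u hu =>
    hb₁ u (ball_subset_ball (min_le_right _ _) hu)⟩

end Local

/-! ### Global frames over simply connected domains -/

section Global

open Topology Metric

/-- The covering space argument. A family of `G`-valued functions on sets `B i` that cover a simply
connected, locally path connected space, any two of which differ by a locally constant left factor
on the overlap, can be glued, after left multiplication by constants, to a function defined
everywhere. The family defines a fibre bundle with discrete fibre `G`, which is a covering space
and hence has a section. -/
theorem exists_glue_of_locallyConstant {X G : Type*} [TopologicalSpace X] [SimplyConnectedSpace X]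
    [LocallyPathConnectedSpace X] [Group G] (B : X → Set X) (hBo : ∀ i, IsOpen (B i))
    (hBm : ∀ x, x ∈ B x) (U : X → X → G)
    (hU : ∀ i j, ∀ x ∈ B i ∩ B j, ∀ y ∈ B i ∩ B j, U i x * (U j x)⁻¹ = U i y * (U j y)⁻¹) :
    ∃ F : X → G, ∀ x, ∃ c : G, ∀ᶠ y in 𝓝 x, F y = c * U x y := by
  let _ : TopologicalSpace G := ⊥
  have : DiscreteTopology G := ⟨rfl⟩
  let Z : FiberBundleCore X X G :=
    { baseSet := B
      isOpen_baseSet := hBo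
      indexAt := fun x => x
      mem_baseSet_at := hBm
      coordChange := fun i j x g => g * (U i x * (U j x)⁻¹)
      coordChange_self := fun i x _ v => by simp
      continuousOn_coordChange := fun i j => by
        rintro ⟨x, g⟩ ⟨hx, -⟩
        have h1 : Continuous fun q : X × G => q.2 * (U i x * (U j x)⁻¹) :=
          (continuous_of_discreteTopology (f := fun g : G => g * (U i x * (U j x)⁻¹))).comp
            continuous_snd
        refine (h1.continuousOn.congr ?_) (x, g) ⟨hx, mem_univ _⟩
        rintro ⟨y, k⟩ ⟨hy, -⟩
        simp only [hU i j y hy x hx]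
      coordChange_comp := fun i j k x _ v => by group }
  obtain ⟨x₀⟩ := (inferInstance : Nonempty X)
  have cov : IsCoveringMap (Bundle.TotalSpace.proj : Bundle.TotalSpace G Z.Fiber → X) :=
    FiberBundle.isCoveringMap
  obtain ⟨s, ⟨-, hs⟩, -⟩ := cov.existsUnique_continuousMap_lifts (ContinuousMap.id X) x₀
    (⟨x₀, (1 : G)⟩ : Bundle.TotalSpace G Z.Fiber) rfl
  have hs' : ∀ x, (s x).proj = x := fun x => congrFun hs x
  refine ⟨fun x => (show G from (s x).snd) * U (s x).proj x, fun x => ?_⟩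
  have hcont : ContinuousAt (fun y => ((Z.localTriv x) (s y)).2) x := by
    have h1 : ContinuousAt (Z.localTriv x) (s x) := by
      refine (Z.localTriv x).continuousAt ?_
      rw [FiberBundleCore.mem_localTriv_source, hs' x]
      exact hBm x
    exact continuous_snd.continuousAt.comp (h1.comp s.continuous.continuousAt)
  have hev := hcont.eventually_mem (isOpen_discrete {((Z.localTriv x) (s x)).2} |>.mem_nhds rfl)
  refine ⟨(show G from ((Z.localTriv x) (s x)).2), ?_⟩
  filter_upwards [hev, (hBo x).mem_nhds (hBm x)] with y hy hyB
  rw [mem_singleton_iff, FiberBundleCore.localTriv_apply] at hy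
  have hy' : (show G from (s y).snd) * (U (s y).proj (s y).proj * (U x (s y).proj)⁻¹) =
    (show G from ((Z.localTriv x) (s x)).2) := hy
  rw [← hy', hs' y]
  have hG : ∀ a b c : G, a * b = a * (b * c⁻¹) * c := fun a b c => by group
  exact hG _ _ _

variable {V : Type*} [NormedAddCommGroup V] [NormedSpace ℝ V]
  {𝔸 : Type*} [NormedRing 𝔸] [NormedAlgebra ℝ 𝔸] [CompleteSpace 𝔸]

/-- A flat connection over a simply connected open set has a global parallel frame. -/
theorem exists_parallel_of_simplyConnected {Ω : Set V} (hΩ : IsOpen Ω)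
    (hsc : SimplyConnectedSpace Ω) {θ : V → V →L[ℝ] 𝔸} (hθ : ContDiffOn ℝ 2 θ Ω)
    (hflat : IsFlatOn Ω θ) {p : V} (hp : p ∈ Ω) :
    ∃ F : V → 𝔸, IsParallelOn Ω θ F ∧ F p = 1 ∧ ∀ u ∈ Ω, IsUnit (F u) := by
  have : LocallyPathConnectedSpace Ω := hΩ.locallyPathConnectedSpace
  choose r hr hrΩ F hF hFu using fun x : Ω => exists_parallel_near hΩ hθ hflat x.2
  classical
  let U : Ω → Ω → 𝔸ˣ := fun i x => if h : IsUnit (F i x) then h.unit else 1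
  have hUF : ∀ i : Ω, ∀ x : Ω, (x : V) ∈ ball (i : V) (r i) → (U i x : 𝔸) = F i x := by
    intro i x hx
    simp only [U, dif_pos (hFu i x hx)]
    rfl
  obtain ⟨G, hG⟩ := exists_glue_of_locallyConstant
    (fun i : Ω => {x : Ω | (x : V) ∈ ball (i : V) (r i)})
    (fun i => isOpen_ball.preimage continuous_subtype_val) (fun x => mem_ball_self (hr x)) U
    (by
      rintro i j x ⟨hxi, hxj⟩ y ⟨hyi, hyj⟩
      -- on the convex overlap both `F i` and a left multiple of `F j` are parallel
      set W : Set V := ball (i : V) (r i) ∩ ball (j : V) (r j) with hW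
      have hWΩ : W ⊆ Ω := fun z hz => hrΩ i hz.1
      have hc : IsPreconnected W :=
        ((convex_ball _ _).inter (convex_ball _ _)).isPreconnected
      have h := IsParallelOn.eqOn (isOpen_ball.inter isOpen_ball) hc
        (hθ.continuousOn.mono hWΩ) ((hF i).mono inter_subset_left)
        (((hF j).mono inter_subset_right).const_mul (U i x * ((U j x)⁻¹ : 𝔸ˣ) : 𝔸))
        (p := (x : V)) ⟨hxi, hxj⟩ (by
          rw [← hUF i x hxi, ← hUF j x hxj]; simp)
      have h2 := h (x := (y : V)) ⟨hyi, hyj⟩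
      beta_reduce at h2
      rw [← hUF i y hyi, ← hUF j y hyj] at h2
      rw [eq_mul_inv_iff_mul_eq, ← Units.val_inj]
      simpa using h2.symm)
  -- normalized at `p`; the value outside of `Ω` is irrelevant
  let H : V → 𝔸 := fun u => if h : u ∈ Ω then ((G ⟨p, hp⟩)⁻¹ * G ⟨u, h⟩ : 𝔸ˣ) else 0
  refine ⟨H, fun u hu => ?_, ?_, fun u hu => ?_⟩
  · obtain ⟨c, hc⟩ := hG ⟨u, hu⟩
    have hc' : H =ᶠ[𝓝 u] fun y => (((G ⟨p, hp⟩)⁻¹ * c : 𝔸ˣ) : 𝔸) * F ⟨u, hu⟩ y := by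
      rw [nhds_subtype_eq_comap, Filter.eventually_comap] at hc
      filter_upwards [hc, hΩ.mem_nhds hu, isOpen_ball.mem_nhds (mem_ball_self (hr ⟨u, hu⟩))]
        with y hy hyΩ hyb
      simp only [H, dif_pos hyΩ, hy ⟨y, hyΩ⟩ rfl]
      rw [← hUF ⟨u, hu⟩ ⟨y, hyΩ⟩ hyb]
      simp [mul_assoc]
    have h1 := (((hF ⟨u, hu⟩).const_mul (((G ⟨p, hp⟩)⁻¹ * c : 𝔸ˣ) : 𝔸)) u
      (mem_ball_self (hr ⟨u, hu⟩)))
    beta_reduce at h1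
    rw [← hc'.eq_of_nhds] at h1
    exact h1.congr_of_eventuallyEq hc'
  · simp [H, hp]
  · simp only [H, dif_pos hu]
    exact Units.isUnit _

end Global

/-! ### Partial derivatives -/

section Pd

variable {n : ℕ} {V : Type*} [NormedAddCommGroup V] [NormedSpace ℝ V] {u : Params n}

theorem pd_congr {f g : Params n → V} (h : f =ᶠ[nhds u] g) (i : Fin n) : pd i f u = pd i g u := by
  rw [pd, pd, h.fderiv_eq]

theorem pd_congr_of_eqOn {Ω : Set (Params n)} (hΩ : IsOpen Ω) {f g : Params n → V}
    (h : EqOn f g Ω) (hu : u ∈ Ω) (i : Fin n) : pd i f u = pd i g u :=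
  pd_congr (h.eventuallyEq_of_mem (hΩ.mem_nhds hu)) i

theorem pd_add {f g : Params n → V} (hf : DifferentiableAt ℝ f u) (hg : DifferentiableAt ℝ g u)
    (i : Fin n) : pd i (fun v => f v + g v) u = pd i f u + pd i g u := by
  simp [pd, fderiv_fun_add hf hg]

theorem pd_sub {f g : Params n → V} (hf : DifferentiableAt ℝ f u) (hg : DifferentiableAt ℝ g u)
    (i : Fin n) : pd i (fun v => f v - g v) u = pd i f u - pd i g u := by
  simp [pd, fderiv_fun_sub hf hg]

theorem pd_neg {f : Params n → V} (i : Fin n) : pd i (fun v => -f v) u = -pd i f u := by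
  simp [pd, fderiv_fun_neg]

theorem pd_const (c : V) (i : Fin n) : pd i (fun _ : Params n => c) u = 0 := by
  simp [pd]

theorem pd_sum {ι : Type*} (s : Finset ι) {f : ι → Params n → V}
    (hf : ∀ k ∈ s, DifferentiableAt ℝ (f k) u) (i : Fin n) :
    pd i (fun v => ∑ k ∈ s, f k v) u = ∑ k ∈ s, pd i (f k) u := by
  simp [pd, fderiv_fun_sum hf]

theorem pd_mul {R : Type*} [NormedRing R] [NormedAlgebra ℝ R] {f g : Params n → R}
    (hf : DifferentiableAt ℝ f u) (hg : DifferentiableAt ℝ g u) (i : Fin n) :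
    pd i (fun v => f v * g v) u = pd i f u * g u + f u * pd i g u := by
  simp [pd, fderiv_fun_mul' hf hg, add_comm]

theorem pd_clm_comp {W : Type*} [NormedAddCommGroup W] [NormedSpace ℝ W] (L : V →L[ℝ] W)
    {f : Params n → V} (hf : DifferentiableAt ℝ f u) (i : Fin n) :
    pd i (fun v => L (f v)) u = L (pd i f u) := by
  have := (L.hasFDerivAt.comp u hf.hasFDerivAt).fderiv
  simp only [pd]
  change fderiv ℝ (L ∘ f) u _ = _
  rw [this]
  rfl

theorem fderiv_eq_sum_pd (f : Params n → V) (u v : Params n) :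
    fderiv ℝ f u v = ∑ i, v i • pd i f u := by
  conv_lhs => rw [pi_eq_sum_univ' v]
  rw [map_sum]
  refine Finset.sum_congr rfl fun i _ => ?_
  rw [map_smul, pd]

theorem contDiffOn_pd {Ω : Set (Params n)} (hΩ : IsOpen Ω) {f : Params n → V}
    (hf : ContDiffOn ℝ ∞ f Ω) (i : Fin n) : ContDiffOn ℝ ∞ (pd i f) Ω :=
  (hf.fderiv_of_isOpen hΩ (by simp)).clm_apply contDiffOn_const

theorem _root_.ContDiffOn.differentiableAt_of_isOpen {Ω : Set (Params n)} (hΩ : IsOpen Ω)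
    {f : Params n → V} (hf : ContDiffOn ℝ ∞ f Ω) (hu : u ∈ Ω) : DifferentiableAt ℝ f u :=
  (hf.contDiffAt (hΩ.mem_nhds hu)).differentiableAt (by simp)

theorem fderiv_fderiv_single {Ω : Set (Params n)} (hΩ : IsOpen Ω) {f : Params n → V}
    (hf : ContDiffOn ℝ ∞ f Ω) (hu : u ∈ Ω) (i j : Fin n) :
    fderiv ℝ (fderiv ℝ f) u (Pi.single i 1) (Pi.single j 1) = pd i (pd j f) u := by
  have hd : DifferentiableAt ℝ (fderiv ℝ f) u :=
    (hf.fderiv_of_isOpen (m := ∞) hΩ (by simp)).differentiableAt_of_isOpen hΩ hu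
  have h2 := hd.hasFDerivAt.clm_apply (hasFDerivAt_const (Pi.single j (1 : ℝ) : Params n) u)
  rw [pd]
  change _ = fderiv ℝ (fun v => fderiv ℝ f v (Pi.single j 1)) u _
  rw [h2.fderiv]
  simp

theorem pd_comm {Ω : Set (Params n)} (hΩ : IsOpen Ω) {f : Params n → V}
    (hf : ContDiffOn ℝ ∞ f Ω) (hu : u ∈ Ω) (i j : Fin n) :
    pd i (pd j f) u = pd j (pd i f) u := by
  rw [← fderiv_fderiv_single hΩ hf hu, ← fderiv_fderiv_single hΩ hf hu]
  exact ((hf.contDiffAt (hΩ.mem_nhds hu)).isSymmSndFDerivAt (by simp [ENat.LEInfty.out])).eq _ _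

end Pd

section PdMat

variable {n : ℕ} {m : Type*} {R : Type*} [NormedRing R] [NormedAlgebra ℝ R] {u : Params n}

theorem pdMat_congr_of_eqOn {Ω : Set (Params n)} (hΩ : IsOpen Ω) {A B : Params n → Matrix m m R}
    (h : EqOn A B Ω) (hu : u ∈ Ω) (i : Fin n) : pdMat i A u = pdMat i B u := by
  ext a b
  exact pd_congr_of_eqOn hΩ (fun v hv => by simp only [h hv]) hu i

theorem pdMat_mul [Fintype m] {A B : Params n → Matrix m m R}
    (hA : ∀ a b, DifferentiableAt ℝ (fun v => A v a b) u)
    (hB : ∀ a b, DifferentiableAt ℝ (fun v => B v a b) u) (i : Fin n) :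
    pdMat i (fun v => A v * B v) u = pdMat i A u * B u + A u * pdMat i B u := by
  ext a b
  simp only [pdMat, Matrix.mul_apply, Matrix.of_apply, Matrix.add_apply]
  rw [pd_sum (f := fun k v => A v a k * B v k b) _ (fun k _ => (hA a k).mul (hB k b)),
    ← Finset.sum_add_distrib]
  exact Finset.sum_congr rfl fun k _ => pd_mul (hA a k) (hB k b) i

theorem pdMat_add {A B : Params n → Matrix m m R}
    (hA : ∀ a b, DifferentiableAt ℝ (fun v => A v a b) u)
    (hB : ∀ a b, DifferentiableAt ℝ (fun v => B v a b) u) (i : Fin n) :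
    pdMat i (fun v => A v + B v) u = pdMat i A u + pdMat i B u := by
  ext a b
  exact pd_add (hA a b) (hB a b) i

theorem pdMat_sub {A B : Params n → Matrix m m R}
    (hA : ∀ a b, DifferentiableAt ℝ (fun v => A v a b) u)
    (hB : ∀ a b, DifferentiableAt ℝ (fun v => B v a b) u) (i : Fin n) :
    pdMat i (fun v => A v - B v) u = pdMat i A u - pdMat i B u := by
  ext a b
  exact pd_sub (hA a b) (hB a b) i

theorem pdMat_const (C : Matrix m m R) (i : Fin n) : pdMat i (fun _ => C) u = 0 := by
  ext a b
  exact pd_const _ i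

theorem IsFlatConnection.congr [Fintype m] [DecidableEq m] {Ω : Set (Params n)} (hΩ : IsOpen Ω)
    {θ θ' : Fin n → Params n → Matrix m m R} (h : ∀ i, ∀ u ∈ Ω, θ i u = θ' i u)
    (hθ : IsFlatConnection Ω θ) : IsFlatConnection Ω θ' := by
  intro u hu i j
  have := hθ u hu i j
  rwa [pdMat_congr_of_eqOn hΩ (h j) hu, pdMat_congr_of_eqOn hΩ (h i) hu, h i u hu,
    h j u hu] at this

end PdMat

/-! ### Frames of matrix valued connections -/

section Frames

variable {n : ℕ} {m : Type*} [Fintype m] [DecidableEq m]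

/-- The complex `m × m` matrices as a Banach algebra, with the operator norm on `ℓ²`. -/
def MatAlg (m : Type*) [Fintype m] : Type _ := EuclideanSpace ℂ m →L[ℂ] EuclideanSpace ℂ m

instance : NormedRing (MatAlg m) :=
  inferInstanceAs (NormedRing (EuclideanSpace ℂ m →L[ℂ] EuclideanSpace ℂ m))

instance : NormedAlgebra ℂ (MatAlg m) :=
  inferInstanceAs (NormedAlgebra ℂ (EuclideanSpace ℂ m →L[ℂ] EuclideanSpace ℂ m))

/-- A matrix as an element of the Banach algebra of matrices. -/
def toAlg : Matrix m m ℂ ≃ₐ[ℂ] MatAlg m := (Matrix.toEuclideanCLM (n := m) (𝕜 := ℂ)).toAlgEquiv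

instance : FiniteDimensional ℂ (MatAlg m) :=
  (toAlg (m := m)).toLinearEquiv.finiteDimensional

instance : CompleteSpace (MatAlg m) := FiniteDimensional.complete ℂ (MatAlg m)

/-- A matrix entry as a continuous linear functional. -/
def matEntry (a b : m) : MatAlg m →L[ℂ] ℂ :=
  LinearMap.toContinuousLinearMap
    ((Matrix.entryLinearMap ℂ ℂ a b).comp (toAlg (m := m)).symm.toLinearMap)

theorem matEntry_apply (a b : m) (A : MatAlg m) : matEntry a b A = toAlg.symm A a b := rfl

/-- The inclusion of `ℂ` into the matrices as the `(a, b)` entry. -/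
def matSingle (a b : m) : ℂ →L[ℂ] MatAlg m :=
  LinearMap.toContinuousLinearMap
    ((toAlg (m := m)).toLinearMap.comp (Matrix.singleLinearMap ℂ a b))

theorem sum_matSingle (A : Matrix m m ℂ) : ∑ a, ∑ b, matSingle a b (A a b) = toAlg A := by
  conv_rhs => rw [Matrix.matrix_eq_sum_single A]
  simp only [map_sum]
  rfl

theorem contDiffOn_toAlg {k : WithTop ℕ∞} {Ω : Set (Params n)} {A : Params n → Matrix m m ℂ}
    (h : ∀ a b, ContDiffOn ℝ k (fun u => A u a b) Ω) :
    ContDiffOn ℝ k (fun u => toAlg (A u)) Ω := by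
  simp only [← sum_matSingle]
  exact ContDiffOn.sum fun a _ => ContDiffOn.sum fun b _ =>
    ((matSingle a b).restrictScalars ℝ).contDiff.comp_contDiffOn (h a b)

theorem differentiableAt_toAlg {A : Params n → Matrix m m ℂ} {u : Params n}
    (h : ∀ a b, DifferentiableAt ℝ (fun u => A u a b) u) :
    DifferentiableAt ℝ (fun u => toAlg (A u)) u := by
  simp only [← sum_matSingle]
  exact DifferentiableAt.fun_sum fun a _ => DifferentiableAt.fun_sum fun b _ =>
    ((matSingle a b).restrictScalars ℝ).differentiableAt.comp u (h a b)

theorem toAlg_pdMat {A : Params n → Matrix m m ℂ} {u : Params n}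
    (h : DifferentiableAt ℝ (fun u => toAlg (A u)) u) (i : Fin n) :
    toAlg (pdMat i A u) = pd i (fun u => toAlg (A u)) u := by
  apply toAlg.symm.injective
  ext a b
  rw [← matEntry_apply, ← matEntry_apply]
  have := pd_clm_comp ((matEntry a b).restrictScalars ℝ) h i
  simp only [ContinuousLinearMap.coe_restrictScalars', matEntry_apply, AlgEquiv.symm_apply_apply]
    at this ⊢
  exact this.symm ▸ rfl

/-- The one-form `∑ θᵢ duᵢ` as a function with values in linear maps. -/
def toForm (θ : Fin n → Params n → Matrix m m ℂ) (u : Params n) :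
    Params n →L[ℝ] MatAlg m :=
  ∑ i, (ContinuousLinearMap.proj (R := ℝ) (φ := fun _ : Fin n => ℝ) i).smulRight (toAlg (θ i u))

theorem toForm_apply (θ : Fin n → Params n → Matrix m m ℂ) (u v : Params n) :
    toForm θ u v = ∑ i, v i • toAlg (θ i u) := by
  simp [toForm]

theorem toForm_single (θ : Fin n → Params n → Matrix m m ℂ) (u : Params n) (i : Fin n) :
    toForm θ u (Pi.single i 1) = toAlg (θ i u) := by
  rw [toForm_apply, Finset.sum_eq_single i]
  · simp
  · intro j _ hj; simp [hj]
  · simp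

theorem contDiffOn_toForm {Ω : Set (Params n)} {θ : Fin n → Params n → Matrix m m ℂ}
    (h : ∀ i a b, ContDiffOn ℝ ∞ (fun u => θ i u a b) Ω) : ContDiffOn ℝ ∞ (toForm θ) Ω := by
  unfold toForm
  refine ContDiffOn.sum fun i _ => ?_
  exact (ContinuousLinearMap.smulRightL ℝ (Params n) (MatAlg m)
    (ContinuousLinearMap.proj i)).contDiff.comp_contDiffOn (contDiffOn_toAlg (h i))

theorem isFlatOn_toForm {Ω : Set (Params n)} (hΩ : IsOpen Ω)
    {θ : Fin n → Params n → Matrix m m ℂ}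
    (h : ∀ i a b, ContDiffOn ℝ ∞ (fun u => θ i u a b) Ω) (hflat : IsFlatConnection Ω θ) :
    IsFlatOn Ω (toForm θ) := by
  intro u hu v w
  have hd : ∀ i, DifferentiableAt ℝ (fun u => toAlg (θ i u)) u := fun i =>
    (contDiffOn_toAlg (h i)).differentiableAt_of_isOpen hΩ hu
  have hD : ∀ v w, fderiv ℝ (toForm θ) u v w =
      ∑ i, ∑ j, (v i * w j) • toAlg (pdMat i (θ j) u) := by
    intro v w
    have h1 : HasFDerivAt (fun x => toForm θ x w) ((fderiv ℝ (toForm θ) u).flip w) u := by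
      have := (((contDiffOn_toForm h).differentiableAt_of_isOpen hΩ hu).hasFDerivAt).clm_apply
        (hasFDerivAt_const w u)
      convert! this using 1
      ext; simp
    have h2 : HasFDerivAt (fun x => toForm θ x w)
        (∑ j, w j • fderiv ℝ (fun u => toAlg (θ j u)) u) u := by
      simp only [toForm_apply]
      exact HasFDerivAt.fun_sum fun j _ => (hd j).hasFDerivAt.const_smul (w j)
    have h3 := congrArg (fun L => L v) (h1.unique h2)
    simp only [ContinuousLinearMap.flip_apply, _root_.sum_apply, _root_.smul_apply] at h3
    rw [h3, Finset.sum_comm]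
    refine Finset.sum_congr rfl fun j _ => ?_
    rw [fderiv_eq_sum_pd, Finset.smul_sum]
    refine Finset.sum_congr rfl fun i _ => ?_
    rw [toAlg_pdMat (hd j), smul_smul, mul_comm]
  have e2 : fderiv ℝ (toForm θ) u w v = ∑ i, ∑ j, (v i * w j) • toAlg (pdMat j (θ i) u) := by
    rw [hD, Finset.sum_comm]
    exact Finset.sum_congr rfl fun i _ => Finset.sum_congr rfl fun j _ => by rw [mul_comm]
  have e3 : toForm θ u v * toForm θ u w =
      ∑ i, ∑ j, (v i * w j) • (toAlg (θ i u) * toAlg (θ j u)) := by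
    simp only [toForm_apply, Finset.sum_mul_sum, smul_mul_smul_comm]
  have e4 : toForm θ u w * toForm θ u v =
      ∑ i, ∑ j, (v i * w j) • (toAlg (θ j u) * toAlg (θ i u)) := by
    simp only [toForm_apply, Finset.sum_mul_sum, smul_mul_smul_comm]
    rw [Finset.sum_comm]
    exact Finset.sum_congr rfl fun i _ => Finset.sum_congr rfl fun j _ => by rw [mul_comm]
  rw [hD, e2, e3, e4]
  simp only [← Finset.sum_sub_distrib, ← Finset.sum_add_distrib, ← smul_sub, ← smul_add]
  refine Finset.sum_eq_zero fun i _ => Finset.sum_eq_zero fun j _ => ?_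
  have := congrArg toAlg (hflat u hu i j)
  rw [Ring.lie_def, map_add, map_sub, map_sub, map_mul, map_mul, map_zero] at this
  rw [this, smul_zero]

theorem isParallelOn_toForm {Ω : Set (Params n)} (hΩ : IsOpen Ω)
    {θ : Fin n → Params n → Matrix m m ℂ} {F : Params n → Matrix m m ℂ}
    (hd : ∀ a b, DifferentiableOn ℝ (fun u => F u a b) Ω)
    (hF : ∀ u ∈ Ω, ∀ i, pdMat i F u = F u * θ i u) :
    IsParallelOn Ω (toForm θ) fun u => toAlg (F u) := by
  intro u hu
  have hdu : DifferentiableAt ℝ (fun u => toAlg (F u)) u :=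
    differentiableAt_toAlg fun a b => (hd a b).differentiableAt (hΩ.mem_nhds hu)
  convert! hdu.hasFDerivAt using 1
  ext1 v
  rw [fderiv_eq_sum_pd]
  simp only [_root_.smul_apply, toForm_apply, smul_eq_mul, Finset.mul_sum, mul_smul_comm]
  exact Finset.sum_congr rfl fun i _ => by rw [← toAlg_pdMat hdu, hF u hu, map_mul]

theorem IsFrame.pdMat_eq {Ω : Set (Params n)} {θ : Fin n → Params n → Matrix m m ℂ}
    {F : Params n → Matrix m m ℂ} (hF : IsFrame Ω θ F) {u : Params n} (hu : u ∈ Ω) (i : Fin n) :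
    pdMat i F u = F u * θ i u := by
  rw [← hF.eqn u hu i, ← mul_assoc, Matrix.mul_nonsing_inv _
    ((Matrix.isUnit_iff_isUnit_det _).1 (hF.invertible u hu)), one_mul]

theorem IsFrame.isParallelOn {Ω : Set (Params n)} (hΩ : IsOpen Ω)
    {θ : Fin n → Params n → Matrix m m ℂ} {F : Params n → Matrix m m ℂ} (hF : IsFrame Ω θ F) :
    IsParallelOn Ω (toForm θ) fun u => toAlg (F u) :=
  isParallelOn_toForm hΩ hF.differentiable fun _ hu i => hF.pdMat_eq hu i

/-- A solution of `dG = G θ` with `G(0) = I` coincides with the frame. -/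
theorem IsFrame.eqOn_of_pdMat_eq {Ω : Set (Params n)} (hΩ : IsOpen Ω) (hc : IsPreconnected Ω)
    (h0 : (0 : Params n) ∈ Ω) {θ : Fin n → Params n → Matrix m m ℂ}
    (hθ : ∀ i a b, ContDiffOn ℝ ∞ (fun u => θ i u a b) Ω) {F G : Params n → Matrix m m ℂ}
    (hF : IsFrame Ω θ F) (hd : ∀ a b, DifferentiableOn ℝ (fun u => G u a b) Ω)
    (hG : ∀ u ∈ Ω, ∀ i, pdMat i G u = G u * θ i u) (hG0 : G 0 = 1) : EqOn G F Ω :=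
  fun _ hu => toAlg.injective <|
    (isParallelOn_toForm hΩ hd hG).eqOn hΩ hc (contDiffOn_toForm hθ).continuousOn
      (hF.isParallelOn hΩ) h0 (by rw [hG0, hF.initial]) hu

theorem IsParallelOn.contDiffOn {V 𝔸 : Type*} [NormedAddCommGroup V] [NormedSpace ℝ V]
    [NormedRing 𝔸] [NormedAlgebra ℝ 𝔸] {Ω : Set V} (hΩ : IsOpen Ω) {θ : V → V →L[ℝ] 𝔸}
    (hθ : ContDiffOn ℝ ∞ θ Ω) {F : V → 𝔸} (hF : IsParallelOn Ω θ F) : ContDiffOn ℝ ∞ F Ω := by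
  rw [contDiffOn_infty]
  intro k
  have hd : DifferentiableOn ℝ F Ω := fun u hu =>
    (hF u hu).differentiableAt.differentiableWithinAt
  induction k with
  | zero => exact contDiffOn_zero.2 hd.continuousOn
  | succ k ih =>
    rw [Nat.cast_succ, contDiffOn_succ_iff_fderiv_of_isOpen hΩ]
    refine ⟨hd, by simp, ?_⟩
    have h1 : ContDiffOn ℝ k (fun u => (ContinuousLinearMap.mul ℝ 𝔸 (F u)).comp (θ u)) Ω :=
      ((ContinuousLinearMap.mul ℝ 𝔸).contDiff.comp_contDiffOn ih).clm_comp
        (hθ.of_le (by exact_mod_cast le_top))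
    refine h1.congr fun u hu => ?_
    rw [(hF u hu).fderiv]
    ext v
    simp

/-- Existence of the frame of a flat connection over a simply connected domain. -/
theorem exists_isFrame {Ω : Set (Params n)} (hΩ : IsOpen Ω) (hsc : SimplyConnectedSpace Ω)
    (h0 : (0 : Params n) ∈ Ω) {θ : Fin n → Params n → Matrix m m ℂ}
    (hθ : ∀ i a b, ContDiffOn ℝ ∞ (fun u => θ i u a b) Ω) (hflat : IsFlatConnection Ω θ) :
    ∃ F, IsFrame Ω θ F ∧ ∀ a b, ContDiffOn ℝ ∞ (fun u => F u a b) Ω := by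
  obtain ⟨F, hF, hF0, hFu⟩ := exists_parallel_of_simplyConnected hΩ hsc
    ((contDiffOn_toForm hθ).of_le (by simp [ENat.LEInfty.out])) (isFlatOn_toForm hΩ hθ hflat) h0
  have hs : ContDiffOn ℝ ∞ F Ω := hF.contDiffOn hΩ (contDiffOn_toForm hθ)
  set G : Params n → Matrix m m ℂ := fun u => toAlg.symm (F u) with hG
  have hFG : F = fun u => toAlg (G u) := by ext1 u; simp [hG]
  have hs' : ∀ a b, ContDiffOn ℝ ∞ (fun u => G u a b) Ω := fun a b =>
    ((matEntry a b).restrictScalars ℝ).contDiff.comp_contDiffOn hs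
  have hu' : ∀ u ∈ Ω, IsUnit (G u) := fun u hu => (hFu u hu).map toAlg.symm
  refine ⟨G, ⟨fun a b => (hs' a b).differentiableOn (by simp), hu', fun u hu i => ?_,
    by simp [hG, hF0]⟩, hs'⟩
  have h1 : pdMat i G u = G u * θ i u := by
    apply toAlg.injective
    rw [hFG] at hF
    rw [toAlg_pdMat (hF u hu).differentiableAt, pd, (hF u hu).fderiv, map_mul]
    simp only [_root_.smul_apply, toForm_single, smul_eq_mul]
  rw [h1, ← mul_assoc, Matrix.nonsing_inv_mul _ ((Matrix.isUnit_iff_isUnit_det _).1 (hu' u hu)),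
    one_mul]

end Frames

/-! ### Holomorphic dependence on the parameter -/

section Holomorphy

open Topology

theorem norm_complex_smul_clm_le {V E : Type*} [NormedAddCommGroup V] [NormedSpace ℝ V]
    [NormedAddCommGroup E] [NormedSpace ℂ E] (c : ℂ) (f : V →L[ℝ] E) : ‖c • f‖ ≤ ‖c‖ * ‖f‖ := by
  refine ContinuousLinearMap.opNorm_le_bound _ (by positivity) fun v => ?_
  rw [_root_.smul_apply, norm_smul, mul_assoc]
  gcongr
  exact f.le_opNorm v

theorem fromBlocks_sub {k l R : Type*} [AddGroup R] (A A' : Matrix k k R) (B B' : Matrix k l R)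
    (C C' : Matrix l k R) (D D' : Matrix l l R) :
    Matrix.fromBlocks A B C D - Matrix.fromBlocks A' B' C' D' =
      Matrix.fromBlocks (A - A') (B - B') (C - C') (D - D') := by
  ext (a | a) (b | b) <;> rfl

/-- Suppose `dF_μ = F_μ θ_μ` with `θ_μ = α + μ B` and that all `F_μ` agree at one point `p`. If
`dG = G θ_λ + F_λ B` and `G(p) = 0`, then `G` is the derivative of `F_μ` in `μ` at `λ`: the error
`R = F_μ - F_λ - (μ - λ) G` solves `dR = R θ_μ + (μ - λ)² G B`. -/
theorem hasDerivAt_of_isParallelOn {V 𝔸 : Type*} [NormedAddCommGroup V] [NormedSpace ℝ V]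
    [NormedRing 𝔸] [NormedAlgebra ℂ 𝔸] {Ω : Set V} (hΩ : IsOpen Ω) (hc : IsPreconnected Ω)
    {α B : V → V →L[ℝ] 𝔸} (hα : ContinuousOn α Ω) (hB : ContinuousOn B Ω) {F : ℂ → V → 𝔸}
    (hF : ∀ μ, IsParallelOn Ω (fun u => α u + μ • B u) (F μ)) {p : V} (hp : p ∈ Ω)
    (hFp : ∀ μ ν, F μ p = F ν p) {lam : ℂ} {G : V → 𝔸}
    (hG : ∀ u ∈ Ω, HasFDerivAt G (G u • (α u + lam • B u) + F lam u • B u) u) (hGp : G p = 0)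
    {u : V} (hu : u ∈ Ω) : HasDerivAt (fun μ => F μ u) (G u) lam := by
  have hGc : ContinuousOn G Ω := fun x hx => (hG x hx).continuousAt.continuousWithinAt
  obtain ⟨C, hC⟩ := exists_norm_le_of_fderiv_bound (ι := Metric.ball lam 1) hΩ hc
    (R := fun μ x => F μ x - F lam x - (μ - lam : ℂ) • G x)
    (R' := fun μ x => (F μ x - F lam x - (μ - lam : ℂ) • G x) • (α x + (μ : ℂ) • B x)
      + (μ - lam : ℂ) ^ 2 • (G x • B x))
    (ρ := fun μ => ‖(μ - lam : ℂ)‖ ^ 2)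
    (fun μ x hx => by
      have h := ((hF μ x hx).sub (hF lam x hx)).sub ((hG x hx).const_smul (μ - lam : ℂ))
      convert! h using 1
      ext v
      simp only [_root_.add_apply, _root_.smul_apply, _root_.sub_apply, smul_eq_mul, sub_mul,
        mul_add, mul_smul_comm, smul_mul_assoc]
      module)
    (fun μ => by positivity)
    (fun x hx => by
      refine ⟨(‖α x‖ + 1) + (‖lam‖ + 1) * (‖B x‖ + 1) + (‖G x‖ + 1) * (‖B x‖ + 1), ?_⟩
      filter_upwards [(hα.continuousAt (hΩ.mem_nhds hx)).norm.eventually_lt_const (lt_add_one _),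
        (hB.continuousAt (hΩ.mem_nhds hx)).norm.eventually_lt_const (lt_add_one _),
        (hGc.continuousAt (hΩ.mem_nhds hx)).norm.eventually_lt_const (lt_add_one _)]
        with y h1 h2 h3 μ
      set R := F μ y - F lam y - (μ - lam : ℂ) • G y
      have hμ : ‖(μ : ℂ)‖ ≤ ‖lam‖ + 1 := by
        have h4 := norm_le_norm_add_norm_sub lam (μ : ℂ)
        have h5 := mem_ball_iff_norm.1 μ.2
        rw [norm_sub_rev] at h4
        linarith
      calc _ ≤ ‖R • (α y + (μ : ℂ) • B y)‖ + ‖(μ - lam : ℂ) ^ 2 • (G y • B y)‖ :=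
            norm_add_le _ _
        _ ≤ ‖R‖ * ((‖α x‖ + 1) + (‖lam‖ + 1) * (‖B x‖ + 1)) +
            ‖(μ - lam : ℂ)‖ ^ 2 * ((‖G x‖ + 1) * (‖B x‖ + 1)) := by
          gcongr
          · refine (norm_smul_clm_le _ _).trans ?_
            gcongr
            refine (norm_add_le _ _).trans ?_
            gcongr
            refine (norm_complex_smul_clm_le _ _).trans ?_
            gcongr
          · refine (norm_complex_smul_clm_le _ _).trans ?_
            rw [norm_pow]
            gcongr
            refine (norm_smul_clm_le _ _).trans ?_
            gcongr
        _ ≤ _ := by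
          have t1 := norm_nonneg R
          have t2 : 0 ≤ ‖(μ - lam : ℂ)‖ ^ 2 := by positivity
          have t3 : 0 ≤ (‖α x‖ + 1) + (‖lam‖ + 1) * (‖B x‖ + 1) := by positivity
          have t4 : 0 ≤ (‖G x‖ + 1) * (‖B x‖ + 1) := by positivity
          nlinarith [mul_nonneg t1 t4, mul_nonneg t2 t3]) hp
    (fun μ => by simp [hGp, hFp μ lam]) hu
  rw [hasDerivAt_iff_isLittleO]
  refine Asymptotics.IsBigO.trans_isLittleO (g := fun μ : ℂ => ‖μ - lam‖ ^ 2) ?_ ?_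
  · refine Asymptotics.IsBigO.of_bound C ?_
    filter_upwards [Metric.ball_mem_nhds lam one_pos] with μ hμ
    rw [Real.norm_of_nonneg (by positivity)]
    exact hC ⟨μ, hμ⟩
  · have h1 := Asymptotics.isLittleO_norm_pow_id (E' := ℂ) one_lt_two
    have h2 : Filter.Tendsto (fun μ : ℂ => μ - lam) (𝓝 lam) (𝓝 0) := by
      have : Continuous fun μ : ℂ => μ - lam := by fun_prop
      simpa using this.tendsto lam
    exact h1.comp_tendsto h2

variable {n : ℕ} {m : Type*} [Fintype m] [DecidableEq m]

theorem pdMat_fromBlocks {k l : Type*} {R : Type*} [NormedRing R] [NormedAlgebra ℝ R]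
    (A : Params n → Matrix k k R) (B : Params n → Matrix k l R) (C : Params n → Matrix l k R)
    (D : Params n → Matrix l l R) (i : Fin n) (u : Params n) :
    pdMat i (fun v => Matrix.fromBlocks (A v) (B v) (C v) (D v)) u =
      Matrix.fromBlocks (pdMat i A u) (Matrix.of fun a b => pd i (fun v => B v a b) u)
        (Matrix.of fun a b => pd i (fun v => C v a b) u) (pdMat i D u) := by
  ext (a | a) (b | b) <;> rfl

/-- If `α + μ B` is flat for all `μ`, so is the block connection `(α + μ B, B; 0, α + μ B)`,
whose parallel frames consist of a frame of `α + μ B` and its derivative in `μ`. -/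
theorem isFlatConnection_fromBlocks {Ω : Set (Params n)} (hΩ : IsOpen Ω)
    {α B : Fin n → Params n → Matrix m m ℂ}
    (hα : ∀ i a b, ContDiffOn ℝ ∞ (fun u => α i u a b) Ω)
    (hB : ∀ i a b, ContDiffOn ℝ ∞ (fun u => B i u a b) Ω)
    (hflat : ∀ μ : ℂ, IsFlatConnection Ω fun i u => α i u + μ • B i u) (lam : ℂ) :
    IsFlatConnection Ω fun i u => Matrix.fromBlocks (α i u + lam • B i u) (B i u) 0
      (α i u + lam • B i u) := by
  intro u hu i j
  have hd : ∀ (μ : ℂ) (i j : Fin n), pdMat i (fun u => α j u + μ • B j u) u =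
      pdMat i (α j) u + μ • pdMat i (B j) u := by
    intro μ i j
    have hBd : ∀ a b, DifferentiableAt ℝ (fun u => B j u a b) u := fun a b =>
      (hB j a b).differentiableAt_of_isOpen hΩ hu
    rw [pdMat_add (fun a b => (hα j a b).differentiableAt_of_isOpen hΩ hu)
      (B := fun v => μ • B j v) (fun a b => (hBd a b).const_smul μ)]
    congr 1
    ext a b
    exact pd_clm_comp ((ContinuousLinearMap.lsmul ℝ ℂ) μ : ℂ →L[ℝ] ℂ) (hBd a b) i
  have h0 := hflat lam u hu i j
  have h1 := hflat (lam + 1) u hu i j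
  have h2 := hflat (lam - 1) u hu i j
  -- the central difference of the curvature, a quadratic polynomial in `μ`, is its derivative
  have h12 : pdMat i (B j) u - pdMat j (B i) u +
      ((α i u + lam • B i u) * B j u + B i u * (α j u + lam • B j u)) -
      ((α j u + lam • B j u) * B i u + B j u * (α i u + lam • B i u)) = 0 := by
    have h3 := congrArg₂ (fun x y => (2⁻¹ : ℂ) • (x - y)) h1 h2
    simp only [hd, Ring.lie_def, sub_self, smul_zero] at h3
    rw [← h3]
    simp only [mul_add, add_mul, smul_mul_assoc, mul_smul_comm]
    module
  change pdMat i (fun u => Matrix.fromBlocks _ _ _ _) u -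
    pdMat j (fun u => Matrix.fromBlocks _ _ _ _) u + _ = 0
  rw [pdMat_fromBlocks, pdMat_fromBlocks, Ring.lie_def, Matrix.fromBlocks_multiply,
    Matrix.fromBlocks_multiply, fromBlocks_sub, fromBlocks_sub,
    Matrix.fromBlocks_add]
  rw [Ring.lie_def] at h0
  simp only [Matrix.zero_apply, pd_const, zero_mul, mul_zero, add_zero, zero_add]
  rw [h0]
  have e : (Matrix.of fun a b => pd i (fun v => B j v a b) u : Matrix m m ℂ) =
      pdMat i (B j) u := rfl
  have e' : (Matrix.of fun a b => pd j (fun v => B i v a b) u : Matrix m m ℂ) =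
      pdMat j (B i) u := rfl
  rw [e, e']
  have h12' : pdMat i (B j) u - pdMat j (B i) u +
      ((α i u + lam • B i u) * B j u + B i u * (α j u + lam • B j u) -
      ((α j u + lam • B j u) * B i u + B j u * (α i u + lam • B i u))) = 0 := by
    rw [← h12]; abel
  rw [h12']
  ext (a | a) (b | b) <;> simp

/-- The frames of a family of flat connections that is affine in a complex parameter depend
holomorphically on the parameter. -/
theorem differentiable_frame {Ω : Set (Params n)} (hΩ : IsOpen Ω)
    (hsc : SimplyConnectedSpace Ω) (h0 : (0 : Params n) ∈ Ω)
    {α B : Fin n → Params n → Matrix m m ℂ}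
    (hα : ∀ i a b, ContDiffOn ℝ ∞ (fun u => α i u a b) Ω)
    (hB : ∀ i a b, ContDiffOn ℝ ∞ (fun u => B i u a b) Ω)
    (hflat : ∀ μ : ℂ, IsFlatConnection Ω fun i u => α i u + μ • B i u)
    {F : ℂ → Params n → Matrix m m ℂ}
    (hF : ∀ μ, IsFrame Ω (fun i u => α i u + μ • B i u) (F μ)) {u : Params n} (hu : u ∈ Ω)
    (a b : m) : Differentiable ℂ fun μ => F μ u a b := by
  intro lam
  have hc : IsPreconnected Ω := isPreconnected_iff_preconnectedSpace.2 inferInstance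
  have hαB : ∀ (μ : ℂ) i a b, ContDiffOn ℝ ∞ (fun u => (α i u + μ • B i u) a b) Ω :=
    fun μ i a b => (hα i a b).add ((hB i a b).const_smul μ)
  have hsum : ∀ μ : ℂ, toForm (fun i u => α i u + μ • B i u) =
      fun u => toForm α u + μ • toForm B u := by
    intro μ
    ext u v
    simp only [toForm_apply, _root_.add_apply, _root_.smul_apply, map_add, map_smul, smul_add,
      Finset.sum_add_distrib, Finset.smul_sum]
    congr 1
    exact Finset.sum_congr rfl fun i _ => smul_comm _ _ _
  -- the diagonal block of `H` is `F_λ`, the upper right block is the derivative of `F_μ` at `λ`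
  obtain ⟨H, hH, hHs⟩ := exists_isFrame hΩ hsc h0
    (θ := fun i u => Matrix.fromBlocks (α i u + lam • B i u) (B i u) 0 (α i u + lam • B i u))
    (by
      rintro i (a | a) (b | b)
      · exact hαB lam i a b
      · exact hB i a b
      · exact contDiffOn_const
      · exact hαB lam i a b)
    (isFlatConnection_fromBlocks hΩ hα hB hflat lam)
  have hHeq : ∀ u ∈ Ω, ∀ i, pdMat i H u = H u * _ := fun u hu i => hH.pdMat_eq hu i
  have hblk : ∀ (u : Params n), H u = Matrix.fromBlocks (H u).toBlocks₁₁ (H u).toBlocks₁₂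
      (H u).toBlocks₂₁ (H u).toBlocks₂₂ := fun u => (Matrix.fromBlocks_toBlocks _).symm
  have h11 : ∀ u ∈ Ω, ∀ i, pdMat i (fun u => (H u).toBlocks₁₁) u =
      (H u).toBlocks₁₁ * (α i u + lam • B i u) := by
    intro u hu i
    have := hHeq u hu i
    rw [hblk u, Matrix.fromBlocks_multiply] at this
    have := congrArg Matrix.toBlocks₁₁ this
    rw [Matrix.toBlocks_fromBlocks₁₁, mul_zero, add_zero] at this
    exact this
  have h12 : ∀ u ∈ Ω, ∀ i, pdMat i (fun u => (H u).toBlocks₁₂) u =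
      (H u).toBlocks₁₁ * B i u + (H u).toBlocks₁₂ * (α i u + lam • B i u) := by
    intro u hu i
    have := hHeq u hu i
    rw [hblk u, Matrix.fromBlocks_multiply] at this
    have := congrArg Matrix.toBlocks₁₂ this
    rw [Matrix.toBlocks_fromBlocks₁₂] at this
    exact this
  have hE : EqOn (fun u => (H u).toBlocks₁₁) (F lam) Ω :=
    (hF lam).eqOn_of_pdMat_eq hΩ hc h0 (hαB lam)
      (fun a b => (hHs (.inl a) (.inl b)).differentiableOn (by simp)) h11 (by
        ext a b; simp [hH.initial, Matrix.toBlocks₁₁, Matrix.one_apply])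
  set G : Params n → MatAlg m := fun u => toAlg (H u).toBlocks₁₂ with hG
  have hGd : ∀ u ∈ Ω, HasFDerivAt G
      (G u • (toForm α u + lam • toForm B u) + toAlg (F lam u) • toForm B u) u := by
    intro u hu
    have hd : DifferentiableAt ℝ G u := differentiableAt_toAlg fun a b =>
      (hHs (.inl a) (.inr b)).differentiableAt_of_isOpen hΩ hu
    convert! hd.hasFDerivAt using 1
    ext1 v
    have e := congrFun (hsum lam) u
    beta_reduce at e
    rw [fderiv_eq_sum_pd, ← e]
    simp only [_root_.add_apply, _root_.smul_apply, toForm_apply, smul_eq_mul, Finset.mul_sum,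
      mul_smul_comm, ← Finset.sum_add_distrib, ← smul_add]
    refine Finset.sum_congr rfl fun i _ => ?_
    rw [← toAlg_pdMat hd, h12 u hu, show (H u).toBlocks₁₁ = F lam u from hE hu]
    simp only [hG, map_add, map_mul]
    rw [add_comm]
  have key := hasDerivAt_of_isParallelOn hΩ hc (contDiffOn_toForm hα).continuousOn
    (contDiffOn_toForm hB).continuousOn (F := fun μ u => toAlg (F μ u))
    (fun μ => by
      have := (hF μ).isParallelOn hΩ
      rwa [hsum μ] at this) h0 (fun μ ν => by rw [(hF μ).initial, (hF ν).initial]) hGd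
    (by
      rw [hG]; simp only [hH.initial]
      have : (1 : Matrix (m ⊕ m) (m ⊕ m) ℂ).toBlocks₁₂ = 0 := by
        ext a b; simp [Matrix.toBlocks₁₂]
      rw [this, map_zero]) hu
  have h3 := ((matEntry a b).hasFDerivAt.comp_hasDerivAt lam key).differentiableAt
  convert! h3 using 1
  ext μ
  simp [matEntry_apply]

end Holomorphy

/-! ### Curvature of diagonal metrics -/

section Metric

variable {n : ℕ} {Ω : Set (Params n)} {u : Params n}

theorem eDiag_mul_apply {R : Type*} [Semiring R] (i : Fin n) (A : Matrix (Fin n) (Fin n) R)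
    (a b : Fin n) : (eDiag R i * A) a b = if a = i then A i b else 0 := by
  split_ifs with h
  · subst h; simp [eDiag]
  · simp [eDiag, h]

theorem mul_eDiag_apply {R : Type*} [Semiring R] (i : Fin n) (A : Matrix (Fin n) (Fin n) R)
    (a b : Fin n) : (A * eDiag R i) a b = if b = i then A a i else 0 := by
  split_ifs with h
  · subst h; simp [eDiag]
  · simp [eDiag, h]

theorem eDiag_mulVec_apply {R : Type*} [Semiring R] (i : Fin n) (x : Fin n → R) (a : Fin n) :
    (eDiag R i *ᵥ x) a = if a = i then x i else 0 := by
  simp [eDiag, Matrix.mulVec, dotProduct, Matrix.single_apply, ite_and, eq_comm]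

/-- Gauge transformations act on the curvature by conjugation: if `D Γᵢ = ηᵢ D + ∂ᵢD`, the
curvatures `R` of `Γ` and `S` of `η` satisfy `D R = S D`. -/
theorem curvature_gauge (hΩ : IsOpen Ω) {D : Params n → Matrix (Fin n) (Fin n) ℝ}
    {Γ η : Fin n → Params n → Matrix (Fin n) (Fin n) ℝ}
    (hD : ∀ a b, ContDiffOn ℝ ∞ (fun v => D v a b) Ω)
    (hΓ : ∀ i a b, ContDiffOn ℝ ∞ (fun v => Γ i v a b) Ω)
    (hη : ∀ i a b, ContDiffOn ℝ ∞ (fun v => η i v a b) Ω)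
    (h : ∀ i, ∀ v ∈ Ω, D v * Γ i v = η i v * D v + pdMat i D v) (hu : u ∈ Ω) (i j : Fin n) :
    D u * (pdMat i (Γ j) u - pdMat j (Γ i) u + ⁅Γ i u, Γ j u⁆) =
      (pdMat i (η j) u - pdMat j (η i) u + ⁅η i u, η j u⁆) * D u := by
  have dD := fun a b => (hD a b).differentiableAt_of_isOpen hΩ hu
  have dΓ := fun i a b => (hΓ i a b).differentiableAt_of_isOpen hΩ hu
  have dη := fun i a b => (hη i a b).differentiableAt_of_isOpen hΩ hu
  have dDD : ∀ i a b, DifferentiableAt ℝ (fun v => pdMat i D v a b) u := fun i a b =>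
    (contDiffOn_pd hΩ (hD a b) i).differentiableAt_of_isOpen hΩ hu
  have key : ∀ i j, pdMat i D u * Γ j u + D u * pdMat i (Γ j) u =
      pdMat i (η j) u * D u + η j u * pdMat i D u + pdMat i (pdMat j D) u := by
    intro i j
    have := pdMat_congr_of_eqOn hΩ (fun v hv => h j v hv) hu i
    rw [pdMat_mul dD (dΓ j), pdMat_add (A := fun v => η j v * D v) (fun a b => by
      simp only [Matrix.mul_apply]
      exact DifferentiableAt.fun_sum fun k _ => (dη j a k).mul (dD k b)) (dDD j),
      pdMat_mul (dη j) dD] at this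
    exact this
  have hsymm : pdMat i (pdMat j D) u = pdMat j (pdMat i D) u := by
    ext a b
    exact pd_comm hΩ (hD a b) hu i j
  have k1 := key i j
  have k2 := key j i
  have g1 := h i u hu
  have g2 := h j u hu
  have k1' : D u * pdMat i (Γ j) u = pdMat i (η j) u * D u + η j u * pdMat i D u +
      pdMat i (pdMat j D) u - pdMat i D u * Γ j u := by rw [← k1]; abel
  have k2' : D u * pdMat j (Γ i) u = pdMat j (η i) u * D u + η i u * pdMat j D u +
      pdMat j (pdMat i D) u - pdMat j D u * Γ i u := by rw [← k2]; abel
  have m1 : D u * (Γ i u * Γ j u) = η i u * (η j u * D u + pdMat j D u) + pdMat i D u * Γ j u := by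
    rw [← mul_assoc, g1, add_mul, mul_assoc, g2]
  have m2 : D u * (Γ j u * Γ i u) = η j u * (η i u * D u + pdMat i D u) + pdMat j D u * Γ i u := by
    rw [← mul_assoc, g2, add_mul, mul_assoc, g1]
  rw [Ring.lie_def, Ring.lie_def, mul_add, mul_sub, mul_sub, k1', k2', m1, m2, hsymm]
  noncomm_ring

theorem christoffel_congr (hΩ : IsOpen Ω) {g g' : Params n → Matrix (Fin n) (Fin n) ℝ}
    (h : EqOn g g' Ω) (hu : u ∈ Ω) (k i j : Fin n) :
    christoffel g k i j u = christoffel g' k i j u := by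
  have e : ∀ a b c, pd a (fun v => g v b c) u = pd a (fun v => g' v b c) u := fun a b c =>
    pd_congr_of_eqOn hΩ (fun v hv => by simp only [h hv]) hu a
  simp only [christoffel, e, h hu]

theorem IsFlatMetric.congr (hΩ : IsOpen Ω) {g g' : Params n → Matrix (Fin n) (Fin n) ℝ}
    (h : EqOn g g' Ω) (hg : IsFlatMetric Ω g) : IsFlatMetric Ω g' := by
  intro u hu l k i j
  have hc : ∀ k i j, EqOn (christoffel g k i j) (christoffel g' k i j) Ω := fun k i j v hv =>
    christoffel_congr hΩ h hv k i j
  have := hg u hu l k i j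
  rw [riemann, pd_congr_of_eqOn hΩ (hc l j k) hu, pd_congr_of_eqOn hΩ (hc l i k) hu] at this
  simp only [hc _ _ _ hu] at this
  exact this

theorem contDiffOn_rotationCoeff (hΩ : IsOpen Ω) {h : Params n → Fin n → ℝ}
    (hh : ∀ i, ContDiffOn ℝ ∞ (fun u => h u i) Ω) (h0 : ∀ u ∈ Ω, ∀ i, h u i ≠ 0) (i j : Fin n) :
    ContDiffOn ℝ ∞ (fun u => rotationCoeff h u i j) Ω := by
  by_cases hij : i = j
  · simp only [rotationCoeff, Matrix.of_apply, if_pos hij]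
    exact contDiffOn_const
  · simp only [rotationCoeff, Matrix.of_apply, if_neg hij]
    exact (contDiffOn_pd hΩ (hh i) j).div (hh j) fun u hu => h0 u hu j

theorem pd_eq_rotationCoeff_mul {h : Params n → Fin n → ℝ} (h0 : ∀ i, h u i ≠ 0) {i j : Fin n}
    (hij : i ≠ j) : pd j (fun v => h v i) u = rotationCoeff h u i j * h u j := by
  simp [rotationCoeff, hij, h0 j]

/-- The Christoffel symbols of `∑ hᵢ² duᵢ²`, read as the matrices `Γᵢ = (Γˡᵢₖ)`, arise from the
connection `eᵢᵢ β - βᵗ eᵢᵢ` of the orthonormal frame `∂ₖ / hₖ` by the change of frame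
`diag(h₁, …, hₙ)`. -/
theorem christoffel_diagonal {h : Params n → Fin n → ℝ}
    (hd : ∀ i, DifferentiableAt ℝ (fun u => h u i) u) (h0 : ∀ i, h u i ≠ 0) (l i k : Fin n) :
    christoffel (fun v => Matrix.diagonal fun i => h v i ^ 2) l i k u =
      (h u l)⁻¹ * ((eDiag ℝ i * rotationCoeff h u - (rotationCoeff h u)ᵀ * eDiag ℝ i) l k * h u k
        + pd i (fun v => Matrix.diagonal (h v) l k) u) := by
  have hinv : (Matrix.diagonal fun i => h u i ^ 2)⁻¹ = Matrix.diagonal fun i => (h u i ^ 2)⁻¹ := by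
    apply Matrix.inv_eq_left_inv
    rw [Matrix.diagonal_mul_diagonal, ← Matrix.diagonal_one]
    congr 1
    ext i
    exact inv_mul_cancel₀ (pow_ne_zero 2 (h0 i))
  have hpd : ∀ a b c, pd a (fun v => Matrix.diagonal (fun i => h v i ^ 2) b c) u =
      if b = c then 2 * h u b * pd a (fun v => h v b) u else 0 := by
    intro a b c
    by_cases hbc : b = c
    · subst hbc
      simp only [Matrix.diagonal_apply_eq, if_true, pow_two]
      rw [pd_mul (hd b) (hd b)]
      ring
    · simp only [Matrix.diagonal_apply_ne _ hbc, if_neg hbc]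
      exact pd_const 0 a
  have hpd' : pd i (fun v => Matrix.diagonal (h v) l k) u =
      if l = k then pd i (fun v => h v l) u else 0 := by
    by_cases hlk : l = k
    · subst hlk; simp
    · simp only [Matrix.diagonal_apply_ne _ hlk, if_neg hlk]
      exact pd_const 0 i
  rw [christoffel, hinv, hpd', Finset.sum_eq_single l]
  · simp only [hpd, Matrix.diagonal_apply_eq, Matrix.sub_apply, eDiag_mul_apply,
      mul_eDiag_apply, Matrix.transpose_apply, rotationCoeff, Matrix.of_apply]
    have hl := h0 l
    have hk := h0 k
    have hi := h0 i
    -- the cases are `Γˡₗₗ`, `Γˡₗₖ`, `Γˡᵢₗ`, `Γˡᵢᵢ` and `Γˡᵢₖ = 0` for distinct indices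
    by_cases hli : l = i
    · subst hli
      by_cases hlk : l = k
      · subst hlk
        simp only [if_true]
        field_simp
        ring
      · have hkl : k ≠ l := Ne.symm hlk
        simp only [if_true, if_neg hlk, if_neg hkl]
        field_simp
        ring
    · have hil : i ≠ l := Ne.symm hli
      by_cases hlk : l = k
      · subst hlk
        simp only [if_true, if_neg hli, if_neg hil]
        field_simp
        ring
      · have hkl : k ≠ l := Ne.symm hlk
        by_cases hik : i = k
        · subst hik
          simp only [if_true, if_neg hli, if_neg hil]
          field_simp
          ring
        · have hki : k ≠ i := Ne.symm hik
          simp only [if_neg hli, if_neg hil, if_neg hik, if_neg hki, if_neg hlk, if_neg hkl]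
          ring
  · intro b _ hb
    rw [Matrix.diagonal_apply_ne _ (Ne.symm hb), zero_mul]
  · simp

theorem contDiffOn_diagonal {h : Params n → Fin n → ℝ}
    (hh : ∀ i, ContDiffOn ℝ ∞ (fun u => h u i) Ω) (a b : Fin n) :
    ContDiffOn ℝ ∞ (fun v => Matrix.diagonal (h v) a b) Ω := by
  by_cases hab : a = b
  · subst hab; simpa using hh a
  · simp only [Matrix.diagonal_apply_ne _ hab]; exact contDiffOn_const

/-- For symmetric rotation coefficients, the diagonal metric `∑ hᵢ² duᵢ²` is flat if and only if
the connection `[δ, β]` is. -/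
theorem isFlatMetric_diagonal_iff (hΩ : IsOpen Ω) {h : Params n → Fin n → ℝ}
    (hh : ∀ i, ContDiffOn ℝ ∞ (fun u => h u i) Ω) (h0 : ∀ u ∈ Ω, ∀ i, h u i ≠ 0)
    (hsymm : ∀ u ∈ Ω, (rotationCoeff h u)ᵀ = rotationCoeff h u) :
    IsFlatMetric Ω (fun v => Matrix.diagonal fun i => h v i ^ 2) ↔
      IsFlatConnection Ω (deltaBeta (rotationCoeff h)) := by
  set g : Params n → Matrix (Fin n) (Fin n) ℝ := fun v => Matrix.diagonal fun i => h v i ^ 2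
  set Γ : Fin n → Params n → Matrix (Fin n) (Fin n) ℝ :=
    fun i v => Matrix.of fun l k => christoffel g l i k v with hΓdef
  have hβ := contDiffOn_rotationCoeff hΩ hh h0
  have hη : ∀ i a b, ContDiffOn ℝ ∞ (fun v => deltaBeta (rotationCoeff h) i v a b) Ω := by
    intro i a b
    simp only [deltaBeta, Ring.lie_def, Matrix.sub_apply, eDiag_mul_apply, mul_eDiag_apply]
    refine ContDiffOn.sub ?_ ?_
    · split_ifs
      · exact hβ i b
      · exact contDiffOn_const
    · split_ifs
      · exact hβ a i
      · exact contDiffOn_const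
  have hchr : ∀ v ∈ Ω, ∀ l i k, christoffel g l i k v =
      (h v l)⁻¹ * (deltaBeta (rotationCoeff h) i v l k * h v k +
        pd i (fun v => Matrix.diagonal (h v) l k) v) := by
    intro v hv l i k
    rw [christoffel_diagonal (fun i => (hh i).differentiableAt_of_isOpen hΩ hv) (h0 v hv),
      hsymm v hv]
    rfl
  have hΓ : ∀ i a b, ContDiffOn ℝ ∞ (fun v => Γ i v a b) Ω := by
    intro i a b
    have : ContDiffOn ℝ ∞ (fun v => (h v a)⁻¹ * (deltaBeta (rotationCoeff h) i v a b * h v b +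
        pd i (fun v => Matrix.diagonal (h v) a b) v)) Ω :=
      ((hh a).inv fun v hv => h0 v hv a).mul
        (((hη i a b).mul (hh b)).add (contDiffOn_pd hΩ (contDiffOn_diagonal hh a b) i))
    exact this.congr fun v hv => hchr v hv a i b
  have hgauge : ∀ i, ∀ v ∈ Ω, Matrix.diagonal (h v) * Γ i v =
      deltaBeta (rotationCoeff h) i v * Matrix.diagonal (h v) +
        pdMat i (fun v => Matrix.diagonal (h v)) v := by
    intro i v hv
    ext l k
    rw [Matrix.diagonal_mul, Matrix.add_apply, Matrix.mul_diagonal]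
    simp only [hΓdef, Matrix.of_apply, hchr v hv, pdMat]
    rw [mul_inv_cancel_left₀ (h0 v hv l)]
  have hriem : ∀ v, ∀ l k i j, riemann g l k i j v =
      (pdMat i (Γ j) v - pdMat j (Γ i) v + ⁅Γ i v, Γ j v⁆) l k := by
    intro v l k i j
    rw [riemann, Ring.lie_def]
    simp only [Matrix.add_apply, Matrix.sub_apply, Matrix.mul_apply, Finset.sum_sub_distrib]
    rfl
  have hcurv : ∀ v ∈ Ω, ∀ i j, _ := fun v hv i j =>
    curvature_gauge hΩ (contDiffOn_diagonal hh) hΓ hη hgauge hv i j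
  have hunit : ∀ v ∈ Ω, IsUnit (Matrix.diagonal (h v)) := fun v hv => by
    rw [Matrix.isUnit_diagonal, Pi.isUnit_iff]
    exact fun i => (h0 v hv i).isUnit
  constructor
  · intro hg v hv i j
    have h1 : pdMat i (Γ j) v - pdMat j (Γ i) v + ⁅Γ i v, Γ j v⁆ = 0 := by
      ext l k
      rw [← hriem, hg v hv]; rfl
    have h2 := hcurv v hv i j
    rw [h1, mul_zero] at h2
    exact ((hunit v hv).mul_left_eq_zero).1 h2.symm
  · intro hη v hv l k i j
    have h2 := hcurv v hv i j
    rw [hη v hv i j, zero_mul] at h2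
    rw [hriem, ((hunit v hv).mul_right_eq_zero).1 h2]
    rfl

end Metric

/-! ### The system and its Lax pair -/

section Lax

variable {n : ℕ} {Ω : Set (Params n)} {u : Params n}

theorem block3_mul {R : Type*} [CommRing R] (A B C D A' B' C' D' : Matrix (Fin n) (Fin n) R)
    (x y x' y' : Fin n → R) :
    block3 A B C D x y * block3 A' B' C' D' x' y' =
      block3 (A * A' + B * C') (A * B' + B * D') (C * A' + D * C') (C * B' + D * D')
        (A *ᵥ x' + B *ᵥ y') (C *ᵥ x' + D *ᵥ y') := by
  ext (p | p | p) (q | q | q) <;>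
    simp [block3, Matrix.mul_apply, Fintype.sum_sum_type, Matrix.mulVec, dotProduct]

theorem block3_add {R : Type*} [CommRing R] (A B C D A' B' C' D' : Matrix (Fin n) (Fin n) R)
    (x y x' y' : Fin n → R) :
    block3 A B C D x y + block3 A' B' C' D' x' y' =
      block3 (A + A') (B + B') (C + C') (D + D') (x + x') (y + y') := by
  ext (p | p | p) (q | q | q) <;> simp [block3]

theorem block3_neg {R : Type*} [CommRing R] (A B C D : Matrix (Fin n) (Fin n) R)
    (x y : Fin n → R) :
    -block3 A B C D x y = block3 (-A) (-B) (-C) (-D) (-x) (-y) := by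
  ext (p | p | p) (q | q | q) <;> simp [block3]

theorem block3_eq_zero_iff {R : Type*} [CommRing R] {A B C D : Matrix (Fin n) (Fin n) R}
    {x y : Fin n → R} :
    block3 A B C D x y = 0 ↔ A = 0 ∧ B = 0 ∧ C = 0 ∧ D = 0 ∧ x = 0 ∧ y = 0 := by
  constructor
  · intro h
    refine ⟨?_, ?_, ?_, ?_, ?_, ?_⟩
    · ext i j; exact congrFun₂ h (.inl i) (.inl j)
    · ext i j; exact congrFun₂ h (.inl i) (.inr (.inl j))
    · ext i j; exact congrFun₂ h (.inr (.inl i)) (.inl j)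
    · ext i j; exact congrFun₂ h (.inr (.inl i)) (.inr (.inl j))
    · ext i; exact congrFun₂ h (.inl i) (.inr (.inr ()))
    · ext i; exact congrFun₂ h (.inr (.inl i)) (.inr (.inr ()))
  · rintro ⟨rfl, rfl, rfl, rfl, rfl, rfl⟩
    ext (p | p | p) (q | q | q) <;> simp [block3]

theorem aGen_eq_block3 (j : Fin n) :
    aGen j = block3 0 (-eDiag ℝ j) (eDiag ℝ j) 0 0 0 := by
  ext (p | p | p) (q | q | q) <;> simp [block3, aGen, eDiag, Matrix.single_apply]

theorem lie_aGen_block3 (j : Fin n) (B : Matrix (Fin n) (Fin n) ℝ) (y : Fin n → ℝ) :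
    ⁅aGen j, block3 0 B (-B) 0 0 (-y)⁆ =
      block3 ⁅eDiag ℝ j, B⁆ 0 0 ⁅eDiag ℝ j, B⁆ (eDiag ℝ j *ᵥ y) 0 := by
  rw [aGen_eq_block3, Ring.lie_def, Ring.lie_def, block3_mul, block3_mul, sub_eq_add_neg,
    block3_neg, block3_add]
  congr 1 <;> simp [sub_eq_add_neg, Matrix.neg_mulVec, Matrix.mulVec_neg]

theorem lie_aGen_aGen (i j : Fin n) : ⁅(aGen i : Matrix (Idx n) (Idx n) ℝ), aGen j⁆ = 0 := by
  have hc : eDiag ℝ i * eDiag ℝ j = eDiag ℝ j * eDiag ℝ i := by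
    by_cases h : i = j
    · rw [h]
    · simp [eDiag, Matrix.single_mul_single_of_ne, h, Ne.symm h]
  rw [aGen_eq_block3, aGen_eq_block3, Ring.lie_def, block3_mul, block3_mul, sub_eq_add_neg,
    block3_neg, block3_add, block3_eq_zero_iff]
  simp [hc]

/-- The curvature of the connection `[δ, β]`. -/
def curvBeta (β : Params n → Matrix (Fin n) (Fin n) ℝ) (i j : Fin n) (u : Params n) :
    Matrix (Fin n) (Fin n) ℝ :=
  ⁅eDiag ℝ j, pdMat i β u⁆ - ⁅eDiag ℝ i, pdMat j β u⁆ + ⁅⁅eDiag ℝ i, β u⁆, ⁅eDiag ℝ j, β u⁆⁆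

/-- The covariant exterior derivative of the vector valued one-form `δ h`. -/
def torsionBeta (β : Params n → Matrix (Fin n) (Fin n) ℝ) (h : Params n → Fin n → ℝ)
    (i j : Fin n) (u : Params n) : Fin n → ℝ :=
  eDiag ℝ j *ᵥ (fun k => pd i (fun v => h v k) u) - eDiag ℝ i *ᵥ (fun k => pd j (fun v => h v k) u)
    + ⁅eDiag ℝ i, β u⁆ *ᵥ (eDiag ℝ j *ᵥ h u) - ⁅eDiag ℝ j, β u⁆ *ᵥ (eDiag ℝ i *ᵥ h u)

theorem pdMat_qField (β : Params n → Matrix (Fin n) (Fin n) ℝ) (h : Params n → Fin n → ℝ)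
    (i : Fin n) : pdMat i (qField β h) u =
      block3 0 (pdMat i β u) (-pdMat i β u) 0 0 (-fun k => pd i (fun v => h v k) u) := by
  ext (p | p | p) (q | q | q) <;>
    simp [block3, qField, pdMat, pd_const, pd_neg]

/-- The left-hand side of the system contains, in block form, the curvature of `[δ, β]` and the
covariant derivative of `δ h`. -/
theorem system_eq_block3 (β : Params n → Matrix (Fin n) (Fin n) ℝ) (h : Params n → Fin n → ℝ)
    (i j : Fin n) :
    -⁅aGen i, pdMat j (qField β h) u⁆ + ⁅aGen j, pdMat i (qField β h) u⁆ +
        ⁅⁅aGen i, qField β h u⁆, ⁅aGen j, qField β h u⁆⁆ =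
      block3 (curvBeta β i j u) 0 0 (curvBeta β i j u) (torsionBeta β h i j u) 0 := by
  rw [pdMat_qField, pdMat_qField, lie_aGen_block3, lie_aGen_block3]
  have e : ∀ k, ⁅aGen k, qField β h u⁆ = _ := fun k => lie_aGen_block3 k (β u) (h u)
  rw [e i, e j, Ring.lie_def (block3 _ _ _ _ _ _), block3_mul, block3_mul, block3_neg, block3_add,
    sub_eq_add_neg, block3_neg, block3_add, block3_add]
  congr 1
  · simp only [curvBeta, Ring.lie_def (⁅_, _⁆ : Matrix (Fin n) (Fin n) ℝ), mul_zero, add_zero]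
    abel
  · simp
  · simp
  · simp only [curvBeta, Ring.lie_def (⁅_, _⁆ : Matrix (Fin n) (Fin n) ℝ), mul_zero, zero_add]
    abel
  · simp only [torsionBeta, Matrix.zero_mulVec, add_zero]
    abel
  · simp

theorem curvBeta_self (β : Params n → Matrix (Fin n) (Fin n) ℝ) (i : Fin n) :
    curvBeta β i i u = 0 := by
  simp [curvBeta, Ring.lie_def]

theorem torsionBeta_self (β : Params n → Matrix (Fin n) (Fin n) ℝ) (h : Params n → Fin n → ℝ)
    (i : Fin n) : torsionBeta β h i i u = 0 := by
  simp [torsionBeta]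

/-- `δ h` is covariantly closed if and only if `(hᵢ)_{uⱼ} = βᵢⱼ hⱼ` for `i ≠ j`. -/
theorem torsionBeta_eq_zero_iff (β : Params n → Matrix (Fin n) (Fin n) ℝ)
    (h : Params n → Fin n → ℝ) {i j : Fin n} (hij : i ≠ j) :
    torsionBeta β h i j u = 0 ↔ pd j (fun v => h v i) u = β u i j * h u j ∧
      pd i (fun v => h v j) u = β u j i * h u i := by
  have hm := eDiag_mulVec_apply (n := n) (R := ℝ)
  have hzero : ∀ (i j : Fin n) (x : Fin n → ℝ), i ≠ j → eDiag ℝ i *ᵥ (eDiag ℝ j *ᵥ x) = 0 := by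
    intro i j x hij
    ext a
    rw [hm, hm, if_neg hij]; simp
  have hb : ∀ i j : Fin n, i ≠ j → ⁅eDiag ℝ i, β u⁆ *ᵥ (eDiag ℝ j *ᵥ h u) =
      fun a => if a = i then β u i j * h u j else 0 := by
    intro i j hij
    rw [Ring.lie_def, Matrix.sub_mulVec, ← Matrix.mulVec_mulVec, ← Matrix.mulVec_mulVec,
      hzero i j _ hij, Matrix.mulVec_zero, sub_zero]
    ext a
    rw [hm]
    congr 1
    change β u i ⬝ᵥ (eDiag ℝ j *ᵥ h u) = _
    simp [dotProduct, hm]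
  rw [torsionBeta, hb i j hij, hb j i hij.symm]
  constructor
  · intro h0
    have hi := congrFun h0 i
    have hj := congrFun h0 j
    simp only [Pi.add_apply, Pi.sub_apply, hm, if_true, if_neg hij, if_neg hij.symm,
      Pi.zero_apply] at hi hj
    constructor <;> linarith
  · rintro ⟨h1, h2⟩
    ext a
    simp only [Pi.add_apply, Pi.sub_apply, hm, h1, h2, Pi.zero_apply]
    split_ifs <;> ring

theorem T_mul_mul_T_apply (M : Matrix (Idx n) (Idx n) ℝ) (p q : Idx n) :
    (T n * M * T n) p q = Sum.elim (fun _ => 1) (Sum.elim (fun _ => -1) (fun _ => 1)) p * M p q *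
      Sum.elim (fun _ => 1) (Sum.elim (fun _ => -1) (fun _ => 1)) q := by
  rw [T, Matrix.mul_diagonal, Matrix.diagonal_mul]

theorem qField_mem_cartanP_iff (β : Params n → Matrix (Fin n) (Fin n) ℝ)
    (h : Params n → Fin n → ℝ) : qField β h u ∈ cartanP n ↔ (β u)ᵀ = β u := by
  constructor
  · rintro ⟨⟨b, c, x, y, -, hc, hM⟩, -⟩
    have : β u = -c := by
      ext i j
      exact congrFun₂ hM (.inl i) (.inr (.inl j))
    rw [this, Matrix.transpose_neg, hc]
  · intro hs
    refine ⟨⟨0, -β u, 0, -h u, by simp, by rw [Matrix.transpose_neg, hs], by rw [neg_neg]; rfl⟩, ?_⟩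
    ext (p | p | p) (q | q | q) <;> rw [T_mul_mul_T_apply] <;> simp [qField, block3]

theorem contDiffOn_qField {β : Params n → Matrix (Fin n) (Fin n) ℝ}
    {h : Params n → Fin n → ℝ} (hβ : ∀ i j, ContDiffOn ℝ ∞ (fun u => β u i j) Ω)
    (hh : ∀ i, ContDiffOn ℝ ∞ (fun u => h u i) Ω) (a b : Idx n) :
    ContDiffOn ℝ ∞ (fun u => qField β h u a b) Ω := by
  rcases a with a | a | a <;> rcases b with b | b | b <;>
    simp only [qField, block3, Matrix.of_apply, Matrix.zero_apply, Matrix.neg_apply, Pi.neg_apply,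
      Pi.zero_apply] <;>
    first
      | exact contDiffOn_const
      | exact hβ _ _
      | exact (hβ _ _).neg
      | exact (hh _).neg

/-- The structure equations: the system for `q` splits into the flatness of `[δ, β]` and the
equation that `δ h` is covariantly closed. -/
theorem isUKSystemSolution_iff {β : Params n → Matrix (Fin n) (Fin n) ℝ}
    {h : Params n → Fin n → ℝ} (hβ : ∀ i j, ContDiffOn ℝ ∞ (fun u => β u i j) Ω)
    (hs : ∀ u ∈ Ω, (β u)ᵀ = β u) (hd : ∀ u ∈ Ω, ∀ i, β u i i = 0)
    (hh : ∀ i, ContDiffOn ℝ ∞ (fun u => h u i) Ω) :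
    IsUKSystemSolution Ω (qField β h) ↔
      ∀ u ∈ Ω, ∀ i j, curvBeta β i j u = 0 ∧ torsionBeta β h i j u = 0 := by
  constructor
  · intro H u hu i j
    by_cases hij : i = j
    · subst hij
      exact ⟨curvBeta_self β i, torsionBeta_self β h i⟩
    · have := H.eqn u hu i j hij
      rw [system_eq_block3, block3_eq_zero_iff] at this
      exact ⟨this.1, this.2.2.2.2.1⟩
  · intro H
    refine ⟨contDiffOn_qField hβ hh, fun u hu => (qField_mem_cartanP_iff β h).2 (hs u hu),
      fun u hu j => hd u hu j, fun u hu i j _ => ?_⟩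
    rw [system_eq_block3, (H u hu i j).1, (H u hu i j).2, block3_eq_zero_iff]
    simp

theorem pdMat_lie_const {m R : Type*} [Fintype m] [DecidableEq m] [NormedRing R]
    [NormedAlgebra ℝ R] {A : Params n → Matrix m m R}
    (hA : ∀ a b, DifferentiableAt ℝ (fun v => A v a b) u) (C : Matrix m m R) (i : Fin n) :
    pdMat i (fun v => ⁅C, A v⁆) u = ⁅C, pdMat i A u⁆ := by
  have hC : ∀ a b, DifferentiableAt ℝ (fun _ : Params n => C a b) u := fun a b =>
    differentiableAt_const _
  have h1 := pdMat_mul (A := fun _ => C) hC hA i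
  have h2 := pdMat_mul (B := fun _ => C) hA hC i
  simp only [Ring.lie_def]
  rw [pdMat_sub (A := fun v => C * A v) (B := fun v => A v * C) (fun a b => by
      simp only [Matrix.mul_apply]
      exact DifferentiableAt.fun_sum fun k _ => (hC a k).mul (hA k b)) (fun a b => by
      simp only [Matrix.mul_apply]
      exact DifferentiableAt.fun_sum fun k _ => (hA a k).mul (hC k b)), h1, h2, pdMat_const]
  simp

theorem pdMat_map_ofReal {m : Type*} {A : Params n → Matrix m m ℝ}
    (hA : ∀ a b, DifferentiableAt ℝ (fun v => A v a b) u) (i : Fin n) :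
    pdMat i (fun v => (A v).map Complex.ofReal) u = (pdMat i A u).map Complex.ofReal := by
  ext a b
  exact pd_clm_comp Complex.ofRealCLM (hA a b) i

theorem isFlatConnection_deltaBeta_iff (hΩ : IsOpen Ω) {β : Params n → Matrix (Fin n) (Fin n) ℝ}
    (hβ : ∀ i j, ContDiffOn ℝ ∞ (fun u => β u i j) Ω) :
    IsFlatConnection Ω (deltaBeta β) ↔ ∀ u ∈ Ω, ∀ i j, curvBeta β i j u = 0 := by
  refine forall₂_congr fun u hu => forall₂_congr fun i j => ?_
  have hd := fun a b => (hβ a b).differentiableAt_of_isOpen hΩ hu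
  change pdMat i (fun v => ⁅eDiag ℝ j, β v⁆) u - pdMat j (fun v => ⁅eDiag ℝ i, β v⁆) u + _ = 0 ↔ _
  rw [pdMat_lie_const hd, pdMat_lie_const hd]
  rfl

theorem lie_map_ofReal {m : Type*} [Fintype m] [DecidableEq m] (A B : Matrix m m ℝ) :
    ⁅A.map Complex.ofReal, B.map Complex.ofReal⁆ = (⁅A, B⁆ : Matrix m m ℝ).map Complex.ofReal :=
  have h : Complex.ofRealHom.mapMatrix (A * B - B * A) =
      Complex.ofRealHom.mapMatrix A * Complex.ofRealHom.mapMatrix B -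
        Complex.ofRealHom.mapMatrix B * Complex.ofRealHom.mapMatrix A := by
    rw [map_sub, map_mul, map_mul]
  h.symm

/-- The quadratic part of the curvature of a Lax connection `λ A + [A, Q]` does not depend on the
spectral parameter: the terms of first and second order in `λ` vanish by the Jacobi identity and
`[Aᵢ, Aⱼ] = 0`. -/
theorem curvature_spectral {m : Type*} [Fintype m] [DecidableEq m]
    {A : Fin n → Matrix m m ℂ} (Q : Matrix m m ℂ) (lam : ℂ) {i j : Fin n}
    (hA : ⁅A i, A j⁆ = 0) :
    ⁅lam • A i + ⁅A i, Q⁆, lam • A j + ⁅A j, Q⁆⁆ = ⁅⁅A i, Q⁆, ⁅A j, Q⁆⁆ := by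
  have hc : A i * A j = A j * A i := by
    rwa [Ring.lie_def, sub_eq_zero] at hA
  have h1 : ⁅A i, ⁅A j, Q⁆⁆ + ⁅⁅A i, Q⁆, A j⁆ = 0 := by
    have e1 : A i * (A j * Q) = A j * (A i * Q) := by rw [← mul_assoc, hc, mul_assoc]
    have e2 : Q * A i * A j = Q * A j * A i := by rw [mul_assoc, hc, mul_assoc]
    simp only [Ring.lie_def, mul_sub, sub_mul]
    rw [e1, e2]
    noncomm_ring
  calc _ = (lam * lam) • ⁅A i, A j⁆ + lam • (⁅A i, ⁅A j, Q⁆⁆ + ⁅⁅A i, Q⁆, A j⁆) +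
        ⁅⁅A i, Q⁆, ⁅A j, Q⁆⁆ := by
        generalize ⁅A i, Q⁆ = X
        generalize ⁅A j, Q⁆ = Y
        simp only [Ring.lie_def, add_mul, mul_add, smul_mul_assoc, mul_smul_comm]
        module
    _ = _ := by rw [hA, h1]; simp

/-- Flatness of the Lax connection for one value of `λ` is already equivalent to the system. -/
theorem isFlatConnection_laxUK_iff (hΩ : IsOpen Ω) {β : Params n → Matrix (Fin n) (Fin n) ℝ}
    {h : Params n → Fin n → ℝ} (hβ : ∀ i j, ContDiffOn ℝ ∞ (fun u => β u i j) Ω)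
    (hh : ∀ i, ContDiffOn ℝ ∞ (fun u => h u i) Ω) (lam : ℂ) :
    IsFlatConnection Ω (laxUK (qField β h) lam) ↔
      ∀ u ∈ Ω, ∀ i j, curvBeta β i j u = 0 ∧ torsionBeta β h i j u = 0 := by
  refine forall₂_congr fun u hu => forall₂_congr fun i j => ?_
  have hq := fun a b => (contDiffOn_qField hβ hh a b).differentiableAt_of_isOpen hΩ hu
  have hqc : ∀ a b, DifferentiableAt ℝ (fun v => (qField β h v).map Complex.ofReal a b) u :=
    fun a b => Complex.ofRealCLM.differentiableAt.comp u (hq a b)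
  have hlax : ∀ j, laxUK (qField β h) lam j = fun v => lam • (aGen j).map Complex.ofReal +
      ⁅(aGen j).map Complex.ofReal, (qField β h v).map Complex.ofReal⁆ := fun j => by
    ext1 v
    rw [laxUK, lie_map_ofReal]
  have hpd : ∀ i j, pdMat i (laxUK (qField β h) lam j) u =
      (⁅aGen j, pdMat i (qField β h) u⁆ : Matrix (Idx n) (Idx n) ℝ).map Complex.ofReal := by
    intro i j
    rw [hlax, pdMat_add (A := fun _ => lam • (aGen j).map Complex.ofReal)
      (fun a b => differentiableAt_const _) (fun a b => by
        simp only [Ring.lie_def, Matrix.sub_apply, Matrix.mul_apply]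
        exact (DifferentiableAt.fun_sum fun k _ => (hqc k b).const_mul _).sub
          (DifferentiableAt.fun_sum fun k _ => (hqc a k).mul_const _)),
      pdMat_const, zero_add, pdMat_lie_const hqc, pdMat_map_ofReal hq, lie_map_ofReal]
  have hcomm : ⁅(aGen i : Matrix (Idx n) (Idx n) ℝ).map Complex.ofReal,
      (aGen j).map Complex.ofReal⁆ = 0 := by
    rw [lie_map_ofReal, lie_aGen_aGen]
    ext a b
    simp
  rw [hpd, hpd, hlax i, hlax j, curvature_spectral
    (A := fun i => (aGen i : Matrix (Idx n) (Idx n) ℝ).map Complex.ofReal) _ lam hcomm]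
  simp only [lie_map_ofReal]
  have e : ∀ X Y Z : Matrix (Idx n) (Idx n) ℝ, X.map Complex.ofReal - Y.map Complex.ofReal +
      Z.map Complex.ofReal = 0 ↔ -Y + X + Z = 0 := by
    intro X Y Z
    rw [← Matrix.ext_iff, ← Matrix.ext_iff]
    refine forall₂_congr fun a b => ?_
    simp only [Matrix.add_apply, Matrix.sub_apply, Matrix.map_apply, Matrix.neg_apply,
      Matrix.zero_apply]
    norm_cast
    rw [sub_eq_neg_add]
  rw [e, system_eq_block3, block3_eq_zero_iff]
  simp

/-- Flatness of `θ_λ` for one value of `λ` is equivalent to the structure equations: the linear part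
contributes the curvature of `[δ, β]`, the translation part the covariant derivative of `δ h`. -/
theorem isFlatConnection_thetaForm_iff (hΩ : IsOpen Ω)
    {β : Params n → Matrix (Fin n) (Fin n) ℝ}
    {h : Params n → Fin n → ℝ} (hβ : ∀ i j, ContDiffOn ℝ ∞ (fun u => β u i j) Ω)
    (hh : ∀ i, ContDiffOn ℝ ∞ (fun u => h u i) Ω) (lam : ℂ) :
    IsFlatConnection Ω (thetaForm β h lam) ↔
      ∀ u ∈ Ω, ∀ i j, curvBeta β i j u = 0 ∧ torsionBeta β h i j u = 0 := by
  refine forall₂_congr fun u hu => forall₂_congr fun i j => ?_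
  have hd := fun a b => (hβ a b).differentiableAt_of_isOpen hΩ hu
  have hhd := fun a => (hh a).differentiableAt_of_isOpen hΩ hu
  have hdc : ∀ a b, DifferentiableAt ℝ (fun v => (β v).map Complex.ofReal a b) u :=
    fun a b => Complex.ofRealCLM.differentiableAt.comp u (hd a b)
  have he : ∀ j : Fin n, (eDiag ℝ j).map Complex.ofReal = eDiag ℂ j := fun j => by
    ext a b
    simp [eDiag, Matrix.single_apply, apply_ite]
  have hw : ∀ j, wForm β lam j = fun v => (Complex.I * lam) • eDiag ℂ j +
      ⁅eDiag ℂ j, (β v).map Complex.ofReal⁆ := fun j => by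
    ext1 v
    rw [wForm, deltaBeta, ← lie_map_ofReal, he]
  have hpw : ∀ i j, pdMat i (wForm β lam j) u =
      (⁅eDiag ℝ j, pdMat i β u⁆ : Matrix (Fin n) (Fin n) ℝ).map Complex.ofReal := by
    intro i j
    rw [hw, pdMat_add (A := fun _ => (Complex.I * lam) • eDiag ℂ j)
      (fun a b => differentiableAt_const _) (fun a b => by
        simp only [Ring.lie_def, Matrix.sub_apply, Matrix.mul_apply]
        exact (DifferentiableAt.fun_sum fun k _ => (hdc k b).const_mul _).sub
          (DifferentiableAt.fun_sum fun k _ => (hdc a k).mul_const _)),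
      pdMat_const, zero_add, pdMat_lie_const hdc, pdMat_map_ofReal hd, ← he, lie_map_ofReal]
  have hpθ : ∀ i j, pdMat i (thetaForm β h lam j) u =
      Matrix.fromBlocks (pdMat i (wForm β lam j) u)
        (Matrix.of fun k _ => ((eDiag ℝ j *ᵥ fun k => pd i (fun v => h v k) u) k : ℂ)) 0 0 := by
    intro i j
    change pdMat i (fun v => Matrix.fromBlocks (wForm β lam j v)
      (Matrix.of fun k _ => ((eDiag ℝ j *ᵥ h v) k : ℂ)) 0 0) u = _
    rw [pdMat_fromBlocks]
    congr 1
    · ext k l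
      simp only [Matrix.of_apply]
      have hdm : DifferentiableAt ℝ (fun v => (eDiag ℝ j *ᵥ h v) k) u := by
        simp only [Matrix.mulVec, dotProduct]
        exact DifferentiableAt.fun_sum fun m _ => (hhd m).const_mul _
      have h1 := pd_clm_comp Complex.ofRealCLM hdm i
      simp only [Complex.ofRealCLM_apply] at h1
      rw [h1]
      congr 1
      simp only [Matrix.mulVec, dotProduct]
      rw [pd_sum _ fun m _ => (hhd m).const_mul _]
      refine Finset.sum_congr rfl fun m _ => ?_
      rw [pd_mul (differentiableAt_const _) (hhd m), pd_const, zero_mul, zero_add]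
    · ext k l; exact pd_const _ _
    · ext k l; exact pd_const _ _
  have hcol : ∀ (M : Matrix (Fin n) (Fin n) ℝ) (x : Fin n → ℝ),
      M.map Complex.ofReal * (Matrix.of fun k (_ : Unit) => (x k : ℂ)) =
        Matrix.of fun k _ => ((M *ᵥ x) k : ℂ) := by
    intro M x
    ext k l
    simp [Matrix.mul_apply, Matrix.mulVec, dotProduct]
  have hee : eDiag ℝ i * eDiag ℝ j = eDiag ℝ j * eDiag ℝ i := by
    by_cases h : i = j
    · rw [h]
    · simp [eDiag, Matrix.single_mul_single_of_ne, h, Ne.symm h]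
  have hee' : ⁅eDiag ℂ i, eDiag ℂ j⁆ = 0 := by
    rw [← he, ← he, lie_map_ofReal, Ring.lie_def, hee, sub_self]
    ext a b
    simp
  have hwc : ∀ i j, wForm β lam i u * (Matrix.of fun k (_ : Unit) => ((eDiag ℝ j *ᵥ h u) k : ℂ)) =
      (Complex.I * lam) • (Matrix.of fun k _ => (((eDiag ℝ i * eDiag ℝ j) *ᵥ h u) k : ℂ)) +
        Matrix.of fun k _ => ((⁅eDiag ℝ i, β u⁆ *ᵥ (eDiag ℝ j *ᵥ h u)) k : ℂ) := by
    intro i j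
    rw [wForm, deltaBeta, Matrix.add_mul, hcol, Matrix.smul_mul, ← he, hcol, Matrix.mulVec_mulVec]
  have h11 : pdMat i (wForm β lam j) u - pdMat j (wForm β lam i) u +
      ⁅wForm β lam i u, wForm β lam j u⁆ = (curvBeta β i j u).map Complex.ofReal := by
    rw [hpw, hpw, hw i, hw j, curvature_spectral (A := eDiag ℂ) _ _ hee', ← he, ← he,
      lie_map_ofReal, lie_map_ofReal, lie_map_ofReal]
    ext a b
    simp [curvBeta]
  have htot : pdMat i (thetaForm β h lam j) u - pdMat j (thetaForm β h lam i) u +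
      ⁅thetaForm β h lam i u, thetaForm β h lam j u⁆ =
      Matrix.fromBlocks ((curvBeta β i j u).map Complex.ofReal)
        (Matrix.of fun k _ => (torsionBeta β h i j u k : ℂ)) 0 0 := by
    rw [hpθ, hpθ, thetaForm, thetaForm, Ring.lie_def, Matrix.fromBlocks_multiply,
      Matrix.fromBlocks_multiply, fromBlocks_sub, fromBlocks_sub, Matrix.fromBlocks_add]
    rw [hwc, hwc, hee, ← h11]
    congr 1
    · simp [Ring.lie_def (wForm β lam i u)]
    · ext k l
      simp [torsionBeta]
      ring
    · simp
    · simp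
  rw [htot]
  constructor
  · intro h0
    constructor
    · ext a b
      simpa using congrFun₂ h0 (.inl a) (.inl b)
    · ext a
      simpa using congrFun₂ h0 (.inl a) (.inr ())
  · rintro ⟨h1, h2⟩
    rw [h1, h2]
    ext (a | a) (b | b) <;> simp

theorem isUKSystemSolution_iff_isFlatConnection_deltaBeta (hΩ : IsOpen Ω)
    {β : Params n → Matrix (Fin n) (Fin n) ℝ}
    {h : Params n → Fin n → ℝ} (hβ : ∀ i j, ContDiffOn ℝ ∞ (fun u => β u i j) Ω)
    (hs : ∀ u ∈ Ω, (β u)ᵀ = β u) (hd : ∀ u ∈ Ω, ∀ i, β u i i = 0)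
    (hh : ∀ i, ContDiffOn ℝ ∞ (fun u => h u i) Ω) :
    IsUKSystemSolution Ω (qField β h) ↔ IsFlatConnection Ω (deltaBeta β) ∧
      ∀ u ∈ Ω, ∀ i j, i ≠ j → pd j (fun v => h v i) u = β u i j * h u j := by
  rw [isUKSystemSolution_iff hβ hs hd hh, isFlatConnection_deltaBeta_iff hΩ hβ]
  constructor
  · intro H
    exact ⟨fun u hu i j => (H u hu i j).1, fun u hu i j hij =>
      ((torsionBeta_eq_zero_iff β h hij).1 (H u hu i j).2).1⟩
  · rintro ⟨H1, H2⟩ u hu i j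
    refine ⟨H1 u hu i j, ?_⟩
    by_cases hij : i = j
    · subst hij; exact torsionBeta_self β h i
    · exact (torsionBeta_eq_zero_iff β h hij).2 ⟨H2 u hu i j hij, H2 u hu j i (Ne.symm hij)⟩

theorem realify_thetaForm (β : Params n → Matrix (Fin n) (Fin n) ℝ) (h : Params n → Fin n → ℝ)
    (lam : ℝ) (j : Fin n) (u : Params n) :
    (realify (thetaForm β h (lam : ℂ) j u)).map Complex.ofReal
      = laxUK (qField β h) (lam : ℂ) j u := by
  have e1 : ⁅aGen j, qField β h u⁆ = _ := lie_aGen_block3 j (β u) (h u)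
  have e2 : ∀ a b, (eDiag ℂ j a b).re = eDiag ℝ j a b ∧ (eDiag ℂ j a b).im = 0 := fun a b => by
    simp only [eDiag, Matrix.single_apply]
    split_ifs <;> simp
  rw [laxUK, e1, aGen_eq_block3]
  ext (p | p | p) (q | q | q) <;>
    simp [realify, block3, thetaForm, wForm, deltaBeta, e2]

end Lax

/-! ### Immersions with orthogonal coordinate vectors -/

section Immersion

variable {n : ℕ} {Ω : Set (Params n)} {u : Params n} {f : Params n → Cn n}
  {g : Params n → Fin n → ℝ}

theorem pd_inner {a b : Params n → Cn n} (ha : DifferentiableAt ℝ a u)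
    (hb : DifferentiableAt ℝ b u) (i : Fin n) :
    pd i (fun v => inner ℂ (a v) (b v)) u =
      inner ℂ (pd i a u) (b u) + inner ℂ (a u) (pd i b u) := by
  rw [pd, fderiv_inner_apply ℂ ha hb, add_comm]
  rfl

theorem inner_real_smul_left (c : ℝ) (Z W : Cn n) : inner ℂ (c • Z) W = c * inner ℂ Z W := by
  rw [← Complex.coe_smul, inner_smul_left, Complex.conj_ofReal]

theorem inner_real_smul_right (c : ℝ) (Z W : Cn n) : inner ℂ Z (c • W) = c * inner ℂ Z W := by
  rw [← Complex.coe_smul, inner_smul_right]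

theorem innerR_sum_right {ι : Type*} (s : Finset ι) (Z : Cn n) (W : ι → Cn n) :
    innerR Z (∑ k ∈ s, W k) = ∑ k ∈ s, innerR Z (W k) := by
  simp [innerR]

theorem innerR_smul_right (c : ℝ) (Z W : Cn n) : innerR Z (c • W) = c * innerR Z W := by
  rw [innerR, inner_real_smul_right, Complex.re_ofReal_mul, innerR]

theorem innerR_self_eq_zero {Z : Cn n} : innerR Z Z = 0 ↔ Z = 0 := by
  rw [innerR, ← inner_self_eq_zero (𝕜 := ℂ) (x := Z)]
  exact ⟨fun h => Complex.ext h (inner_self_im (𝕜 := ℂ) Z), fun h => by rw [h]; rfl⟩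

theorem innerR_J_right (Z W : Cn n) : innerR Z (J W) = -omega Z W := by
  simp [innerR, omega, J]

theorem innerR_J_J (Z W : Cn n) : innerR (J Z) (J W) = innerR Z W := by
  simp [innerR, J]

/-- The Hermitian products of the tangent vectors of an immersion with first fundamental form
`∑ gᵢ duᵢ²` whose tangent spaces are Lagrangian. -/
theorem inner_pd_of_hasFirstFF (hff : HasFirstFF Ω f g)
    (hL : ∀ u ∈ Ω, ∀ v w, omega (fderiv ℝ f u v) (fderiv ℝ f u w) = 0) (hu : u ∈ Ω) (i j : Fin n) :
    inner ℂ (pd i f u) (pd j f u) = if i = j then (g u i : ℂ) else 0 := by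
  have h1 := hff u hu (Pi.single i 1) (Pi.single j 1)
  have h2 := hL u hu (Pi.single i 1) (Pi.single j 1)
  rw [firstFF, innerR] at h1
  apply Complex.ext
  · rw [pd, pd, h1]
    by_cases hij : i = j
    · subst hij
      rw [Finset.sum_eq_single i] <;> simp +contextual
    · rw [if_neg hij, Finset.sum_eq_zero]
      · rfl
      · intro k _
        by_cases hk : k = i
        · subst hk; simp [hij]
        · simp [Pi.single_apply, hk]
  · rw [omega] at h2
    rw [pd, pd, h2]
    split_ifs <;> simp

theorem inner_fderiv_eq_sum
    (ho : ∀ i j, inner ℂ (pd i f u) (pd j f u) = if i = j then (g u i : ℂ) else 0)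
    (v w : Params n) :
    inner ℂ (fderiv ℝ f u v) (fderiv ℝ f u w) = ((∑ i, g u i * v i * w i : ℝ) : ℂ) := by
  rw [fderiv_eq_sum_pd f u v, fderiv_eq_sum_pd f u w, sum_inner]
  push_cast
  refine Finset.sum_congr rfl fun i _ => ?_
  rw [inner_sum, Finset.sum_eq_single i]
  · rw [inner_real_smul_left, inner_real_smul_right, ho, if_pos rfl]
    ring
  · intro j _ hj
    rw [inner_real_smul_left, inner_real_smul_right, ho, if_neg (Ne.symm hj)]
    simp
  · simp

theorem hasFirstFF_of_inner_pd
    (ho : ∀ u ∈ Ω, ∀ i j, inner ℂ (pd i f u) (pd j f u) = if i = j then (g u i : ℂ) else 0) :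
    HasFirstFF Ω f g := fun u hu v w => by
  rw [firstFF, innerR, inner_fderiv_eq_sum (ho u hu), Complex.ofReal_re]

theorem firstFF_matrix_eq_diagonal (hff : HasFirstFF Ω f g) (hu : u ∈ Ω) :
    (Matrix.of fun i j => firstFF f u (Pi.single i 1) (Pi.single j 1)) =
      Matrix.diagonal (g u) := by
  ext i j
  rw [Matrix.of_apply, hff u hu]
  by_cases hij : i = j
  · subst hij
    rw [Finset.sum_eq_single i] <;> simp +contextual
  · rw [Matrix.diagonal_apply_ne _ hij, Finset.sum_eq_zero]
    intro k _
    by_cases hk : k = i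
    · subst hk; simp [hij]
    · simp [Pi.single_apply, hk]

theorem isFlatLagrangianImmersion_of_inner_pd (hΩ : IsOpen Ω) (hf : ContDiffOn ℝ ∞ f Ω)
    (ho : ∀ u ∈ Ω, ∀ i j, inner ℂ (pd i f u) (pd j f u) = if i = j then (g u i : ℂ) else 0)
    (hpos : ∀ u ∈ Ω, ∀ i, 0 < g u i)
    (hflat : IsFlatMetric Ω fun u => Matrix.diagonal (g u)) :
    IsFlatLagrangianImmersion Ω f where
  smooth := hf
  immersion u hu := by
    refine (injective_iff_map_eq_zero _).2 fun v hv => ?_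
    have h1 := inner_fderiv_eq_sum (ho u hu) v v
    rw [hv, inner_zero_left] at h1
    have h2 : ∑ i, g u i * v i * v i = 0 := by exact_mod_cast h1.symm
    have h3 := (Finset.sum_eq_zero_iff_of_nonneg fun i _ => by
      rw [mul_assoc]; exact mul_nonneg (hpos u hu i).le (mul_self_nonneg _)).1 h2
    ext i
    have := h3 i (Finset.mem_univ i)
    simpa [(hpos u hu i).ne'] using this
  lagrangian u hu v w := by
    rw [omega, inner_fderiv_eq_sum (ho u hu), Complex.ofReal_im]
  flat := hflat.congr hΩ fun u hu =>
    (firstFF_matrix_eq_diagonal (hasFirstFF_of_inner_pd ho) hu).symm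

theorem fderiv_fderiv_eq_sum (hΩ : IsOpen Ω) (hf : ContDiffOn ℝ ∞ f Ω) (hu : u ∈ Ω)
    (v w : Params n) :
    fderiv ℝ (fderiv ℝ f) u v w = ∑ i, ∑ j, (v i * w j) • pd i (pd j f) u := by
  rw [fderiv_eq_sum_pd (fderiv ℝ f) u v, _root_.sum_apply]
  refine Finset.sum_congr rfl fun i _ => ?_
  conv_lhs => rw [pi_eq_sum_univ' w]
  rw [map_sum]
  refine Finset.sum_congr rfl fun j _ => ?_
  rw [map_smul, _root_.smul_apply, smul_smul, mul_comm, pd, fderiv_fderiv_single hΩ hf hu]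

/-- The second fundamental form of a Lagrangian immersion can be read off from the second partial
derivatives. -/
theorem hasSecondFF_of_pd_pd (hΩ : IsOpen Ω) (hf : ContDiffOn ℝ ∞ f Ω)
    (hL : ∀ u ∈ Ω, ∀ v w, omega (fderiv ℝ f u v) (fderiv ℝ f u w) = 0) {c : ℝ}
    (h2 : ∀ u ∈ Ω, ∀ i j, ∃ t, pd i (pd j f) u =
      fderiv ℝ f u t + if i = j then c • J (pd i f u) else 0) :
    HasSecondFF Ω f c := by
  intro u hu v w
  refine ⟨fun v' => ?_, ?_⟩
  · rw [innerR_smul_right, innerR_sum_right, Finset.sum_eq_zero, mul_zero]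
    intro i _
    rw [innerR_smul_right, innerR_J_right, pd, hL u hu, neg_zero, mul_zero]
  · choose t ht using h2 u hu
    refine ⟨∑ i, ∑ j, (v i * w j) • t i j, ?_⟩
    rw [fderiv_fderiv_eq_sum hΩ hf hu, map_sum, Finset.smul_sum, ← Finset.sum_add_distrib]
    refine Finset.sum_congr rfl fun i _ => ?_
    rw [map_sum]
    have : c • (v i * w i) • J (pd i f u) =
        ∑ j, (v i * w j) • (if i = j then c • J (pd i f u) else 0) := by
      rw [Finset.sum_eq_single i]
      · rw [if_pos rfl, smul_comm]
      · intro j _ hj; rw [if_neg (Ne.symm hj), smul_zero]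
      · simp
    rw [this, ← Finset.sum_add_distrib]
    refine Finset.sum_congr rfl fun j _ => ?_
    rw [ht, smul_add, map_smul]

theorem IsSecondFF.unique {v w : Params n} {N N' : Cn n} (hN : IsSecondFF f u v w N)
    (hN' : IsSecondFF f u v w N') : N = N' := by
  obtain ⟨h1, t, ht⟩ := hN
  obtain ⟨h1', t', ht'⟩ := hN'
  have h3 : N - N' = fderiv ℝ f u (t' - t) := by
    rw [map_sub, sub_eq_sub_iff_add_eq_add, add_comm, ← ht, ht', add_comm]
  have h4 := (normalSpace f u).sub_mem h1 h1' (t' - t)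
  rw [← h3, innerR_self_eq_zero] at h4
  exact sub_eq_zero.1 h4

/-- The endomorphism of the coordinate space which is diagonal with respect to the coordinate
vectors. -/
def diagOp (n : ℕ) : (Fin n → ℝ) →ₗ[ℝ] Params n →ₗ[ℝ] Params n :=
  LinearMap.mul ℝ (Fin n → ℝ)

theorem diagOp_apply (c : Fin n → ℝ) (v : Params n) (i : Fin n) : diagOp n c v i = c i * v i := rfl

theorem diagOp_injective : Function.Injective (diagOp n) := fun c c' h => by
  ext i
  have := congrFun (LinearMap.congr_fun h 1) i
  simpa [diagOp_apply] using this

/-- The shape operators are the endomorphisms diagonal in the coordinates: the shape operator in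
the normal direction `∑ cᵢ J (∂f/∂uᵢ)` is `diag(c₁, …, cₙ)`. -/
theorem hasNondegenerateNormalBundle (hff : HasFirstFF Ω f g) (hpos : ∀ u ∈ Ω, ∀ i, 0 < g u i)
    (hL : ∀ u ∈ Ω, ∀ v w, omega (fderiv ℝ f u v) (fderiv ℝ f u w) = 0)
    (hs : HasSecondFF Ω f 1) : HasNondegenerateNormalBundle Ω f := by
  intro u hu
  have ho := fun i j => inner_pd_of_hasFirstFF hff hL hu i j
  have hset : {S : Params n →ₗ[ℝ] Params n | ∃ ν ∈ normalSpace f u, IsShapeOperator f u ν S} =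
      (LinearMap.range (diagOp n) : Set (Params n →ₗ[ℝ] Params n)) := by
    ext S
    constructor
    · rintro ⟨ν, -, hS⟩
      refine ⟨fun i => innerR (J (pd i f u)) ν / g u i, ?_⟩
      refine LinearMap.pi_ext' fun a => LinearMap.ext_ring ?_
      ext b
      have h1 := hS _ _ _ (hs u hu (Pi.single a 1) (Pi.single b 1))
      rw [hff u hu, Finset.sum_eq_single b (fun k _ hk => by simp [hk]) (by simp)] at h1
      simp only [LinearMap.comp_apply, LinearMap.single_apply, diagOp_apply]
      by_cases hab : a = b
      · subst hab
        rw [Finset.sum_eq_single a (fun k _ hk => by simp [hk]) (by simp)] at h1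
        simp only [Pi.single_eq_same, mul_one, one_smul] at h1 ⊢
        rw [← h1]
        field_simp [(hpos u hu a).ne']
      · rw [Finset.sum_eq_zero fun k _ => by
          by_cases hk : k = a
          · subst hk; simp [hab]
          · simp [Pi.single_apply, hk]] at h1
        simp only [Pi.single_eq_same, mul_one, smul_zero] at h1
        have h2 : g u b * S (Pi.single a 1) b = 0 := by rw [h1]; simp [innerR]
        rw [Pi.single_eq_of_ne (Ne.symm hab), mul_zero]
        exact ((mul_eq_zero.1 h2).resolve_left (hpos u hu b).ne').symm
    · rintro ⟨c, rfl⟩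
      refine ⟨∑ i, c i • J (pd i f u), ?_, ?_⟩
      · refine Submodule.sum_mem _ fun i _ => Submodule.smul_mem _ _ fun v => ?_
        rw [innerR_J_right, pd, hL u hu, neg_zero]
      · intro v w N hN
        rw [hN.unique (hs u hu v w), hff u hu, innerR_sum_right]
        refine Finset.sum_congr rfl fun i _ => ?_
        rw [innerR_smul_right, one_smul, diagOp_apply]
        have : innerR (∑ k, (v k * w k) • J (pd k f u)) (J (pd i f u)) = v i * w i * g u i := by
          rw [innerR, sum_inner, Complex.re_sum, Finset.sum_eq_single i]
          · rw [inner_real_smul_left, Complex.re_ofReal_mul]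
            change _ * innerR _ _ = _
            rw [innerR_J_J, innerR, ho, if_pos rfl, Complex.ofReal_re]
          · intro k _ hk
            rw [inner_real_smul_left, Complex.re_ofReal_mul]
            change _ * innerR _ _ = _
            rw [innerR_J_J, innerR, ho, if_neg hk, Complex.zero_re, mul_zero]
          · simp
        rw [this]
        ring
  rw [hset, Submodule.span_eq, LinearMap.finrank_range_of_inj diagOp_injective]
  simp

end Immersion

/-! ### The frames of the associated family -/

section Family

variable {n : ℕ} {Ω : Set (Params n)} {u : Params n}
  {β : Params n → Matrix (Fin n) (Fin n) ℝ} {h : Params n → Fin n → ℝ}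

theorem wForm_apply (lam : ℂ) (j k i : Fin n) :
    wForm β lam j u k i = (if k = j ∧ i = j then Complex.I * lam else 0) +
      ((if k = j then (β u j i : ℂ) else 0) - if i = j then (β u k j : ℂ) else 0) := by
  simp only [wForm, deltaBeta, Ring.lie_def, Matrix.add_apply, Matrix.smul_apply, Matrix.map_apply,
    Matrix.sub_apply, eDiag_mul_apply, mul_eDiag_apply, smul_eq_mul]
  congr 1
  · by_cases hk : k = j <;> by_cases hi : i = j <;>
      simp [eDiag, Matrix.single_apply, hk, hi, eq_comm]
    all_goals grind
  · split_ifs <;> simp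

theorem contDiffOn_wForm (hβ : ∀ i j, ContDiffOn ℝ ∞ (fun u => β u i j) Ω) (lam : ℂ)
    (j a b : Fin n) : ContDiffOn ℝ ∞ (fun u => wForm β lam j u a b) Ω := by
  have hc : ∀ a b, ContDiffOn ℝ ∞ (fun u => (β u a b : ℂ)) Ω := fun a b =>
    Complex.ofRealCLM.contDiff.comp_contDiffOn (hβ a b)
  simp only [wForm_apply]
  refine contDiffOn_const.add (ContDiffOn.sub ?_ ?_)
  · split_ifs
    exacts [hc _ _, contDiffOn_const]
  · split_ifs
    exacts [hc _ _, contDiffOn_const]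

theorem contDiffOn_thetaForm (hβ : ∀ i j, ContDiffOn ℝ ∞ (fun u => β u i j) Ω)
    (hh : ∀ i, ContDiffOn ℝ ∞ (fun u => h u i) Ω) (lam : ℂ) (j : Fin n) (a b : Fin n ⊕ Unit) :
    ContDiffOn ℝ ∞ (fun u => thetaForm β h lam j u a b) Ω := by
  rcases a with a | a <;> rcases b with b | b <;>
    simp only [thetaForm, Matrix.fromBlocks_apply₁₁, Matrix.fromBlocks_apply₁₂,
      Matrix.fromBlocks_apply₂₁, Matrix.fromBlocks_apply₂₂, Matrix.zero_apply, Matrix.of_apply,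
      eDiag_mulVec_apply]
  · exact contDiffOn_wForm hβ lam j a b
  · by_cases haj : a = j
    · simp only [if_pos haj]
      exact Complex.ofRealCLM.contDiff.comp_contDiffOn (hh j)
    · simp only [if_neg haj]
      exact contDiffOn_const
  · exact contDiffOn_const
  · exact contDiffOn_const

/-- The last row of a solution of `dF = F θ_λ` is constant. -/
theorem IsFrame.eq_blockFrame (hΩ : IsOpen Ω) (hc : IsPreconnected Ω) (h0 : (0 : Params n) ∈ Ω)
    (hβ : ∀ i j, ContDiffOn ℝ ∞ (fun u => β u i j) Ω)
    (hh : ∀ i, ContDiffOn ℝ ∞ (fun u => h u i) Ω) {lam : ℂ}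
    {F : Params n → Matrix (Fin n ⊕ Unit) (Fin n ⊕ Unit) ℂ}
    (hF : IsFrame Ω (thetaForm β h lam) F) (hu : u ∈ Ω) :
    F u = blockFrame (F u).toBlocks₁₁ (WithLp.toLp 2 fun k => F u (.inl k) (.inr ())) := by
  refine (hF.eqOn_of_pdMat_eq hΩ hc h0 (contDiffOn_thetaForm hβ hh lam)
    (G := fun u => blockFrame (F u).toBlocks₁₁ (WithLp.toLp 2 fun k => F u (.inl k) (.inr ())))
    ?_ ?_ ?_ hu).symm
  · rintro (a | a) (b | b)
    · exact hF.differentiable _ _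
    · exact hF.differentiable _ _
    · exact differentiableOn_const _
    · exact differentiableOn_const _
  · intro v hv i
    ext (a | a) b
    · refine Eq.trans ?_ ((congrFun₂ (hF.pdMat_eq hv i) (.inl a) b).trans ?_)
      · rcases b with b | b <;> rfl
      · simp only [Matrix.mul_apply]
        refine Finset.sum_congr rfl fun k _ => ?_
        rcases k with k | k <;> rfl
    · have h1 : pdMat i (fun u => blockFrame (F u).toBlocks₁₁
          (WithLp.toLp 2 fun k => F u (.inl k) (.inr ()))) v (.inr a) b = 0 := by
        rcases b with b | b <;> exact pd_const _ i
      rw [h1, Matrix.mul_apply, Fintype.sum_sum_type]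
      rcases b with b | b <;> simp [blockFrame, thetaForm]
  · rw [hF.initial]
    ext (a | a) (b | b) <;> simp [blockFrame, Matrix.one_apply, Matrix.toBlocks₁₁]

variable {E : Params n → Matrix (Fin n) (Fin n) ℂ} {X : Params n → Cn n} {lam : ℂ}

theorem IsFrame.pdMat_rotation (hF : IsFrame Ω (thetaForm β h lam) fun u => blockFrame (E u) (X u))
    (hu : u ∈ Ω) (i : Fin n) : pdMat i E u = E u * wForm β lam i u := by
  ext a b
  refine (congrFun₂ (hF.pdMat_eq hu i) (.inl a) (.inl b)).trans ?_
  rw [Matrix.mul_apply, Fintype.sum_sum_type]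
  simp [blockFrame, thetaForm, Matrix.mul_apply]

/-- The linear part `E` of the frame is a frame of `w_λ`. -/
theorem IsFrame.rotation (hF : IsFrame Ω (thetaForm β h lam) fun u => blockFrame (E u) (X u)) :
    IsFrame Ω (wForm β lam) E := by
  have hinv : ∀ u ∈ Ω, IsUnit (E u).det := fun u hu => by
    have := (Matrix.isUnit_iff_isUnit_det _).1 (hF.invertible u hu)
    rwa [blockFrame, Matrix.det_fromBlocks_zero₂₁, Matrix.det_one, mul_one] at this
  refine ⟨fun a b => hF.differentiable (.inl a) (.inl b),
    fun u hu => (Matrix.isUnit_iff_isUnit_det _).2 (hinv u hu), fun u hu i => ?_, ?_⟩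
  · rw [hF.pdMat_rotation hu, ← mul_assoc, Matrix.nonsing_inv_mul _ (hinv u hu), one_mul]
  · ext a b
    have := congrFun₂ hF.initial (.inl a) (.inl b)
    simpa [blockFrame, Matrix.one_apply] using this

theorem differentiableAt_of_apply {X : Params n → Cn n}
    (hX : ∀ k, DifferentiableAt ℝ (fun u => X u k) u) : DifferentiableAt ℝ X u :=
  (differentiableAt_piLp 2).2 hX

theorem pd_apply {X : Params n → Cn n} (hX : DifferentiableAt ℝ X u) (i k : Fin n) :
    pd i X u k = pd i (fun v => X v k) u :=
  (pd_clm_comp ((EuclideanSpace.proj k : Cn n →L[ℂ] ℂ).restrictScalars ℝ) hX i).symm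

/-- The `i`-th column of a matrix. -/
def colVec (A : Matrix (Fin n) (Fin n) ℂ) (i : Fin n) : Cn n := WithLp.toLp 2 fun k => A k i

theorem colVec_apply (A : Matrix (Fin n) (Fin n) ℂ) (i k : Fin n) : colVec A i k = A k i := rfl

theorem inner_colVec (A : Matrix (Fin n) (Fin n) ℂ) (i j : Fin n) :
    inner ℂ (colVec A i) (colVec A j) = (Aᴴ * A) i j := by
  simp [PiLp.inner_apply, colVec, Matrix.mul_apply, mul_comm]

/-- The coordinate vectors of `X` are the columns of `E` scaled by `h`. -/
theorem IsFrame.pd_translation (hΩ : IsOpen Ω)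
    (hF : IsFrame Ω (thetaForm β h lam) fun u => blockFrame (E u) (X u))
    (hu : u ∈ Ω) (i : Fin n) : pd i X u = h u i • colVec (E u) i := by
  have hd : DifferentiableAt ℝ X u := differentiableAt_of_apply fun k =>
    (hF.differentiable (.inl k) (.inr ())).differentiableAt (hΩ.mem_nhds hu)
  ext k
  rw [pd_apply hd]
  refine (congrFun₂ (hF.pdMat_eq hu i) (.inl k) (.inr ())).trans ?_
  rw [Matrix.mul_apply, Fintype.sum_sum_type]
  simp only [blockFrame, thetaForm, Matrix.fromBlocks_apply₁₁, Matrix.fromBlocks_apply₁₂,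
    Matrix.fromBlocks_apply₂₂, Matrix.zero_apply, Matrix.of_apply, eDiag_mulVec_apply, mul_zero,
    Finset.sum_const_zero, add_zero]
  rw [Finset.sum_eq_single i (fun b _ hb => by simp [hb]) (by simp)]
  simp [colVec, mul_comm]

/-- The structure equations of the columns `cⱼ` of `E`: `∂ᵢcⱼ = βᵢⱼ cᵢ` for `i ≠ j`, and
`∂ᵢcᵢ = iλ cᵢ - ∑ₖ βₖᵢ cₖ` up to the diagonal terms of `β`, which cancel. -/
theorem IsFrame.pd_colVec (hΩ : IsOpen Ω) (hE : IsFrame Ω (wForm β lam) E) (hu : u ∈ Ω)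
    (i j : Fin n) : pd i (fun v => colVec (E v) j) u =
      ∑ k, (β u i j * (if k = i then 1 else 0) - (if j = i then β u k i else 0)) • colVec (E u) k +
        if i = j then (Complex.I * lam) • colVec (E u) i else 0 := by
  have hd : DifferentiableAt ℝ (fun v => colVec (E v) j) u := differentiableAt_of_apply fun k =>
    (hE.differentiable k j).differentiableAt (hΩ.mem_nhds hu)
  ext a
  rw [pd_apply hd]
  refine (congrFun₂ (hE.pdMat_eq hu i) a j).trans ?_
  rw [Matrix.mul_apply, PiLp.add_apply, WithLp.ofLp_sum, Finset.sum_apply]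
  have h2 : (if i = j then (Complex.I * lam) • colVec (E u) i else 0 : Cn n) a =
      ∑ k, E u a k * if k = i ∧ j = i then Complex.I * lam else 0 := by
    by_cases hij : i = j
    · subst hij
      rw [if_pos rfl, Finset.sum_eq_single i (fun b _ hb => by simp [hb]) (by simp)]
      simp [colVec, mul_comm]
    · simp [hij, Ne.symm hij]
  rw [h2, ← Finset.sum_add_distrib]
  refine Finset.sum_congr rfl fun k _ => ?_
  rw [wForm_apply, PiLp.smul_apply, colVec_apply, Complex.real_smul]
  split_ifs <;> push_cast <;> grind

/-- For real `λ` and symmetric `β` the one-form `w_λ` is skew-Hermitian, so that `E` is unitary. -/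
theorem IsFrame.conjTranspose_mul_self (hΩ : IsOpen Ω) (hc : IsPreconnected Ω)
    (h0 : (0 : Params n) ∈ Ω) (hs : ∀ u ∈ Ω, (β u)ᵀ = β u) {lam : ℝ}
    (hE : IsFrame Ω (wForm β lam) E) (hu : u ∈ Ω) : (E u)ᴴ * E u = 1 := by
  have hF : IsFrame Ω (fun _ _ => 0) (fun _ : Params n => (1 : Matrix (Fin n) (Fin n) ℂ)) :=
    ⟨fun _ _ => differentiableOn_const _, fun _ _ => isUnit_one, fun u _ i => by
      rw [pdMat_const, mul_zero], rfl⟩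
  have hd : ∀ u ∈ Ω, ∀ a b, DifferentiableAt ℝ (fun v => E v a b) u := fun u hu a b =>
    (hE.differentiable a b).differentiableAt (hΩ.mem_nhds hu)
  have hd' : ∀ u ∈ Ω, ∀ a b, DifferentiableAt ℝ (fun v => (E v)ᴴ a b) u := fun u hu a b =>
    (Complex.conjCLE : ℂ →L[ℝ] ℂ).differentiableAt.comp u (hd u hu b a)
  have hw : ∀ u ∈ Ω, ∀ i, wForm β lam i u + (wForm β lam i u)ᴴ = 0 := by
    intro u hu i
    ext a b
    have hab : ∀ a b, β u a b = β u b a := fun a b => congrFun₂ (hs u hu) b a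
    rw [Matrix.add_apply, Matrix.conjTranspose_apply, wForm_apply, wForm_apply, hab i b, hab a i]
    by_cases ha : a = i <;> by_cases hb : b = i <;> simp [ha, hb]
  have key := hF.eqOn_of_pdMat_eq hΩ hc h0 (fun _ _ _ => contDiffOn_const)
    (G := fun u => E u * (E u)ᴴ) (fun a b u hu => by
      simp only [Matrix.mul_apply]
      exact (DifferentiableAt.fun_sum fun k _ =>
        (hd u hu a k).mul (hd' u hu k b)).differentiableWithinAt)
    (fun u hu i => by
      have h1 : pdMat i (fun v => (E v)ᴴ) u = (pdMat i E u)ᴴ := by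
        ext a b
        exact pd_clm_comp (Complex.conjCLE : ℂ →L[ℝ] ℂ) (hd u hu b a) i
      rw [pdMat_mul (hd u hu) (hd' u hu), h1, hE.pdMat_eq hu, Matrix.conjTranspose_mul, mul_assoc,
        ← mul_add, ← add_mul, hw u hu, zero_mul, mul_zero]
      exact (mul_zero _).symm)
    (by simp [hE.initial])
  exact mul_eq_one_comm.1 (key hu)

theorem IsFrame.inner_pd_translation (hΩ : IsOpen Ω) (hc : IsPreconnected Ω)
    (h0 : (0 : Params n) ∈ Ω) (hs : ∀ u ∈ Ω, (β u)ᵀ = β u) {lam : ℝ}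
    (hF : IsFrame Ω (thetaForm β h lam) fun u => blockFrame (E u) (X u)) (hu : u ∈ Ω)
    (i j : Fin n) :
    inner ℂ (pd i X u) (pd j X u) = if i = j then ((h u i ^ 2 : ℝ) : ℂ) else 0 := by
  rw [hF.pd_translation hΩ hu, hF.pd_translation hΩ hu, inner_real_smul_left,
    inner_real_smul_right, inner_colVec, hF.rotation.conjTranspose_mul_self hΩ hc h0 hs hu,
    Matrix.one_apply]
  split_ifs with hij
  · subst hij; push_cast; ring
  · simp

theorem contDiffOn_translation
    (hF : ∀ a b, ContDiffOn ℝ ∞ (fun u => blockFrame (E u) (X u) a b) Ω) : ContDiffOn ℝ ∞ X Ω :=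
  (contDiffOn_piLp 2).2 fun k => hF (.inl k) (.inr ())

/-- For real `λ` the translation part of the frame is a flat Lagrangian immersion. -/
theorem IsFrame.immersion (hΩ : IsOpen Ω) (hc : IsPreconnected Ω)
    (h0 : (0 : Params n) ∈ Ω) (hs : ∀ u ∈ Ω, (β u)ᵀ = β u)
    (hh : ∀ i, ContDiffOn ℝ ∞ (fun u => h u i) Ω) (hne : ∀ u ∈ Ω, ∀ i, h u i ≠ 0)
    (hflat : IsFlatMetric Ω fun u => Matrix.diagonal fun i => h u i ^ 2) {lam : ℝ}
    (hF : IsFrame Ω (thetaForm β h lam) fun u => blockFrame (E u) (X u))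
    (hX : ContDiffOn ℝ ∞ X Ω) :
    IsFlatLagrangianImmersion Ω X ∧ HasFirstFF Ω X (fun u i => h u i ^ 2) ∧
      HasSecondFF Ω X lam := by
  have ho := fun u (hu : u ∈ Ω) => hF.inner_pd_translation hΩ hc h0 hs hu
  have hpos : ∀ u ∈ Ω, ∀ i, 0 < h u i ^ 2 := fun u hu i => by have := hne u hu i; positivity
  have himm := isFlatLagrangianImmersion_of_inner_pd hΩ hX ho hpos hflat
  refine ⟨himm, hasFirstFF_of_inner_pd ho, hasSecondFF_of_pd_pd hΩ hX himm.lagrangian ?_⟩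
  intro u hu i j
  have hcol : DifferentiableAt ℝ (fun v => colVec (E v) j) u := differentiableAt_of_apply fun k =>
    (hF.rotation.differentiable k j).differentiableAt (hΩ.mem_nhds hu)
  have h1 : pd i (pd j X) u =
      pd i (fun v => h v j) u • colVec (E u) j + h u j • pd i (fun v => colVec (E v) j) u := by
    rw [pd_congr_of_eqOn hΩ (fun v hv => hF.pd_translation hΩ hv j) hu, pd,
      fderiv_fun_smul ((hh j).differentiableAt_of_isOpen hΩ hu) hcol]
    simp [pd, add_comm]
  -- real combinations of the columns of `E` are tangent vectors, as `hₖ ≠ 0`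
  have htan : ∀ a : Fin n → ℝ, ∃ t, ∑ k, a k • colVec (E u) k = fderiv ℝ X u t := fun a => by
    refine ⟨fun k => a k / h u k, ?_⟩
    rw [fderiv_eq_sum_pd]
    refine Finset.sum_congr rfl fun k _ => ?_
    rw [hF.pd_translation hΩ hu, smul_smul, div_mul_cancel₀ _ (hne u hu k)]
  obtain ⟨t, ht⟩ := htan fun k => pd i (fun v => h v j) u * (if k = j then 1 else 0) +
    h u j * (β u i j * (if k = i then 1 else 0) - (if j = i then β u k i else 0))
  refine ⟨t, ?_⟩
  rw [h1, hF.rotation.pd_colVec hΩ hu, ← ht, smul_add, Finset.smul_sum, ← add_assoc]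
  congr 1
  · simp only [add_smul, Finset.sum_add_distrib, mul_smul]
    congr 1
    rw [Finset.sum_eq_single j (fun k _ hk => by simp [hk]) (by simp)]
    simp
  · split_ifs with hij
    · subst hij
      rw [hF.pd_translation hΩ hu, J, ← Complex.coe_smul, ← Complex.coe_smul, ← Complex.coe_smul,
        smul_smul, smul_smul, smul_smul]
      congr 1
      ring
    · simp

end Family

/-! ### The associated family and its Egoroff net -/

section Associated

variable {n : ℕ} {Ω : Set (Params n)} {u : Params n}
  {β : Params n → Matrix (Fin n) (Fin n) ℝ} {h : Params n → Fin n → ℝ}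

theorem pd_sq {g : Params n → ℝ} (hg : DifferentiableAt ℝ g u) (i : Fin n) :
    pd i (fun v => g v ^ 2) u = 2 * g u * pd i g u := by
  simp only [pow_two]
  rw [pd_mul hg hg]
  ring

/-- The rotation coefficients are symmetric if the one-form `∑ hᵢ² duᵢ` is closed, that is, if
the metric has an Egoroff potential. -/
theorem transpose_rotationCoeff (hd : ∀ i, DifferentiableAt ℝ (fun v => h v i) u)
    (hne : ∀ i, h u i ≠ 0)
    (hp : ∀ i k, i ≠ k → pd k (fun v => h v i ^ 2) u = pd i (fun v => h v k ^ 2) u) :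
    (rotationCoeff h u)ᵀ = rotationCoeff h u := by
  ext i k
  by_cases hik : i = k
  · subst hik; rfl
  · have h1 := hp i k hik
    rw [pd_sq (hd i), pd_sq (hd k)] at h1
    simp only [Matrix.transpose_apply, rotationCoeff, Matrix.of_apply, if_neg hik,
      if_neg (Ne.symm hik)]
    rw [div_eq_div_iff (hne i) (hne k)]
    linarith

theorem rotationCoeff_apply_self (h : Params n → Fin n → ℝ) (u : Params n) (i : Fin n) :
    rotationCoeff h u i i = 0 := by
  simp [rotationCoeff]

theorem IsFrame.congr {m : Type*} [Fintype m] [DecidableEq m] (hΩ : IsOpen Ω)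
    (h0 : (0 : Params n) ∈ Ω) {θ : Fin n → Params n → Matrix m m ℂ} {F G : Params n → Matrix m m ℂ}
    (hF : IsFrame Ω θ F) (hG : EqOn G F Ω) : IsFrame Ω θ G where
  differentiable a b := (hF.differentiable a b).congr fun u hu => by rw [hG hu]
  invertible u hu := by rw [hG hu]; exact hF.invertible u hu
  eqn u hu i := by rw [pdMat_congr_of_eqOn hΩ hG hu, hG hu, hF.eqn u hu i]
  initial := by rw [hG h0, hF.initial]

theorem exists_isFrame_blockFrame (hΩ : IsOpen Ω) (hsc : SimplyConnectedSpace Ω)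
    (h0 : (0 : Params n) ∈ Ω) (hβ : ∀ i j, ContDiffOn ℝ ∞ (fun u => β u i j) Ω)
    (hh : ∀ i, ContDiffOn ℝ ∞ (fun u => h u i) Ω) (lam : ℂ)
    (hflat : IsFlatConnection Ω (thetaForm β h lam)) :
    ∃ (E : Params n → Matrix (Fin n) (Fin n) ℂ) (X : Params n → Cn n),
      IsFrame Ω (thetaForm β h lam) (fun u => blockFrame (E u) (X u)) ∧
        ∀ a b, ContDiffOn ℝ ∞ (fun u => blockFrame (E u) (X u) a b) Ω := by
  have hc : IsPreconnected Ω := isPreconnected_iff_preconnectedSpace.2 inferInstance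
  obtain ⟨F, hF, hFs⟩ := exists_isFrame hΩ hsc h0 (contDiffOn_thetaForm hβ hh lam) hflat
  have hFb := fun u (hu : u ∈ Ω) => hF.eq_blockFrame hΩ hc h0 hβ hh hu
  exact ⟨fun u => (F u).toBlocks₁₁, fun u => WithLp.toLp 2 fun k => F u (.inl k) (.inr ()),
    hF.congr hΩ h0 fun u hu => (hFb u hu).symm,
    fun a b => (hFs a b).congr fun u hu => by rw [← hFb u hu]⟩

theorem thetaForm_eq_add_smul (lam : ℂ) (i : Fin n) (u : Params n) :
    thetaForm β h lam i u =
      thetaForm β h 0 i u + lam • Matrix.fromBlocks (Complex.I • eDiag ℂ i) 0 0 0 := by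
  ext (a | a) (b | b) <;> simp [thetaForm, wForm]
  ring

/-- The frames of the associated family are entire in the spectral parameter. -/
theorem differentiable_blockFrame (hΩ : IsOpen Ω) (hsc : SimplyConnectedSpace Ω)
    (h0 : (0 : Params n) ∈ Ω) (hβ : ∀ i j, ContDiffOn ℝ ∞ (fun u => β u i j) Ω)
    (hh : ∀ i, ContDiffOn ℝ ∞ (fun u => h u i) Ω)
    (hflat : ∀ lam : ℂ, IsFlatConnection Ω (thetaForm β h lam))
    {F : ℂ → Params n → Matrix (Fin n ⊕ Unit) (Fin n ⊕ Unit) ℂ}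
    (hF : ∀ lam, IsFrame Ω (thetaForm β h lam) (F lam)) (hu : u ∈ Ω) (a b : Fin n ⊕ Unit) :
    Differentiable ℂ fun lam => F lam u a b := by
  have hθ : ∀ lam, thetaForm β h lam = fun i u =>
      thetaForm β h 0 i u + lam • Matrix.fromBlocks (Complex.I • eDiag ℂ i) 0 0 0 :=
    fun lam => funext₂ (thetaForm_eq_add_smul lam)
  refine differentiable_frame hΩ hsc h0 (α := thetaForm β h 0)
    (B := fun i _ => Matrix.fromBlocks (Complex.I • eDiag ℂ i) 0 0 0)
    (contDiffOn_thetaForm hβ hh 0) (fun _ _ _ => contDiffOn_const) (fun μ => ?_) (fun μ => ?_)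
    hu a b
  · rw [← hθ]; exact hflat μ
  · rw [← hθ]; exact hF μ

/-- At `λ = 0` the connection is real, and so is its frame. -/
theorem IsFrame.translation_real (hΩ : IsOpen Ω) (hc : IsPreconnected Ω)
    (h0 : (0 : Params n) ∈ Ω) (hβ : ∀ i j, ContDiffOn ℝ ∞ (fun u => β u i j) Ω)
    (hh : ∀ i, ContDiffOn ℝ ∞ (fun u => h u i) Ω)
    {E : Params n → Matrix (Fin n) (Fin n) ℂ} {X : Params n → Cn n}
    (hF : IsFrame Ω (thetaForm β h 0) fun u => blockFrame (E u) (X u)) (hu : u ∈ Ω) (k : Fin n) :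
    X u k = ((X u k).re : ℂ) := by
  have hd : ∀ u ∈ Ω, ∀ a b, DifferentiableAt ℝ (fun v => blockFrame (E v) (X v) a b) u :=
    fun u hu a b => (hF.differentiable a b).differentiableAt (hΩ.mem_nhds hu)
  have hθ : ∀ u i, (thetaForm β h 0 i u).map (starRingEnd ℂ) = thetaForm β h 0 i u := by
    intro u i
    ext (a | a) (b | b)
    · simp only [thetaForm, Matrix.map_apply, Matrix.fromBlocks_apply₁₁, wForm_apply]
      split_ifs <;> simp
    · exact Complex.conj_ofReal _
    · exact map_zero (starRingEnd ℂ)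
    · exact map_zero (starRingEnd ℂ)
  have key := hF.eqOn_of_pdMat_eq hΩ hc h0 (contDiffOn_thetaForm hβ hh 0)
    (G := fun u => (blockFrame (E u) (X u)).map (starRingEnd ℂ))
    (fun a b u hu => ((Complex.conjCLE : ℂ →L[ℝ] ℂ).differentiableAt.comp u
      (hd u hu a b)).differentiableWithinAt)
    (fun u hu i => by
      have h1 : pdMat i (fun v => (blockFrame (E v) (X v)).map (starRingEnd ℂ)) u =
          (pdMat i (fun v => blockFrame (E v) (X v)) u).map (starRingEnd ℂ) := by
        ext a b
        exact pd_clm_comp (Complex.conjCLE : ℂ →L[ℝ] ℂ) (hd u hu a b) i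
      rw [h1, hF.pdMat_eq hu, Matrix.map_mul, hθ])
    (by rw [hF.initial, Matrix.map_one _ (map_zero _) (map_one _)])
  exact (Complex.conj_eq_iff_re.1 (congrFun₂ (key hu) (.inl k) (.inr ()))).symm

/-- The inverse function theorem, for smooth maps between open subsets of normed spaces. -/
theorem isLocalDiffeomorphOn_of_injective_fderiv {V W : Type*} [NormedAddCommGroup V]
    [NormedSpace ℝ V] [NormedAddCommGroup W] [NormedSpace ℝ W] [FiniteDimensional ℝ V]
    [FiniteDimensional ℝ W] (hdim : Module.finrank ℝ V = Module.finrank ℝ W) {Ω : Set V}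
    (hΩ : IsOpen Ω) {x : V → W} (hx : ContDiffOn ℝ ∞ x Ω)
    (hinj : ∀ u ∈ Ω, Function.Injective (fderiv ℝ x u)) :
    IsLocalDiffeomorphOn 𝓘(ℝ, V) 𝓘(ℝ, W) ∞ x Ω := by
  have : CompleteSpace V := FiniteDimensional.complete ℝ V
  have hequiv : ∀ u ∈ Ω, ∃ e : V ≃L[ℝ] W, HasFDerivAt x (e : V →L[ℝ] W) u := by
    intro u hu
    refine ⟨(LinearEquiv.ofInjectiveOfFinrankEq (fderiv ℝ x u).toLinearMap (hinj u hu)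
      hdim).toContinuousLinearEquiv, ?_⟩
    convert! ((hx.contDiffAt (hΩ.mem_nhds hu)).differentiableAt (by simp)).hasFDerivAt using 1
  rintro ⟨u, hu⟩
  obtain ⟨e, he⟩ := hequiv u hu
  have hxu := hx.contDiffAt (hΩ.mem_nhds hu)
  set Φ := (hxu.toOpenPartialHomeomorph x he (by simp)).restrOpen Ω hΩ with hΦ
  have hsrc : Φ.source ⊆ Ω := by
    rw [hΦ, OpenPartialHomeomorph.restrOpen_source]
    exact inter_subset_right
  have hΦx : ∀ v, Φ v = x v := fun _ => rfl
  refine ⟨⟨Φ.toPartialEquiv, Φ.open_source, Φ.open_target, ?_, ?_⟩, ?_, fun v _ => (hΦx v).symm⟩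
  · rw [contMDiffOn_iff_contDiffOn]
    exact hx.mono hsrc
  · rw [contMDiffOn_iff_contDiffOn]
    intro y hy
    have hy' : Φ.symm y ∈ Ω := hsrc (Φ.map_target hy)
    obtain ⟨e', he'⟩ := hequiv _ hy'
    exact (Φ.contDiffAt_symm hy he' (hx.contDiffAt (hΩ.mem_nhds hy'))).contDiffWithinAt
  · change u ∈ Φ.source
    rw [hΦ, OpenPartialHomeomorph.restrOpen_source]
    exact ⟨hxu.mem_toOpenPartialHomeomorph_source he (by simp), hu⟩

/-- An immersion with real values and orthogonal coordinate vectors of lengths `(φ_{uᵢ})^{1/2}`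
is an Egoroff net. -/
theorem isEgoroffNet_of_real (hΩ : IsOpen Ω) {f : Params n → Cn n} (hf : ContDiffOn ℝ ∞ f Ω)
    (hinj : ∀ u ∈ Ω, Function.Injective (fderiv ℝ f u)) {φ : Params n → ℝ}
    (hφ : ContDiffOn ℝ ∞ φ Ω)
    (ho : ∀ u ∈ Ω, ∀ i j, inner ℂ (pd i f u) (pd j f u) = if i = j then ((pd i φ u : ℝ) : ℂ) else 0)
    (hreal : ∀ u ∈ Ω, ∀ k, f u k = ((f u k).re : ℂ)) :
    IsEgoroffNet Ω fun u => WithLp.toLp 2 fun k => (f u k).re := by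
  set x : Params n → EuclideanSpace ℝ (Fin n) := fun u => WithLp.toLp 2 fun k => (f u k).re
  have hfk : ∀ k, ContDiffOn ℝ ∞ (fun u => f u k) Ω := fun k => (contDiffOn_piLp 2).1 hf k
  have hx : ContDiffOn ℝ ∞ x Ω := (contDiffOn_piLp 2).2 fun k =>
    Complex.reCLM.contDiff.comp_contDiffOn (hfk k)
  have hpd : ∀ u ∈ Ω, ∀ i k, pd i f u k = (pd i x u k : ℂ) := by
    intro u hu i k
    have hxk : DifferentiableAt ℝ (fun v => (f v k).re) u :=
      Complex.reCLM.differentiableAt.comp u ((hfk k).differentiableAt_of_isOpen hΩ hu)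
    have h1 : pd i x u k = pd i (fun v => (f v k).re) u :=
      (pd_clm_comp (EuclideanSpace.proj k : EuclideanSpace ℝ (Fin n) →L[ℝ] ℝ)
        (hx.differentiableAt_of_isOpen hΩ hu) i).symm
    rw [pd_apply (hf.differentiableAt_of_isOpen hΩ hu), h1,
      pd_congr_of_eqOn hΩ (fun v hv => hreal v hv k) hu]
    exact pd_clm_comp Complex.ofRealCLM hxk i
  have hin : ∀ u ∈ Ω, ∀ i j, (inner ℝ (pd i x u) (pd j x u) : ℂ) =
      if i = j then ((pd i φ u : ℝ) : ℂ) else 0 := by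
    intro u hu i j
    rw [← ho u hu, PiLp.inner_apply, PiLp.inner_apply, Complex.ofReal_sum]
    refine Finset.sum_congr rfl fun k _ => ?_
    rw [hpd u hu, hpd u hu]
    simp
  refine ⟨isLocalDiffeomorphOn_of_injective_fderiv (by simp) hΩ hx fun u hu => ?_,
    fun u hu i j hij => ?_, φ, hφ, fun u hu i => ?_⟩
  · refine (injective_iff_map_eq_zero _).2 fun v hv => ?_
    refine (injective_iff_map_eq_zero _).1 (hinj u hu) v ?_
    ext k
    have h1 := congrArg (fun y : EuclideanSpace ℝ (Fin n) => (y k : ℂ)) hv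
    simp only [fderiv_eq_sum_pd x, WithLp.ofLp_sum, Finset.sum_apply, PiLp.smul_apply] at h1
    rw [fderiv_eq_sum_pd, WithLp.ofLp_sum, Finset.sum_apply]
    simp only [PiLp.smul_apply, hpd u hu]
    simpa using h1
  · have := hin u hu i j
    rw [if_neg hij] at this
    exact_mod_cast this
  · have := hin u hu i i
    rw [if_pos rfl] at this
    rw [← real_inner_self_eq_norm_sq]
    exact_mod_cast this.symm

end Associated

/-! ### Flat Lagrangian immersions solve the system -/

section Converse

variable {n : ℕ} {Ω : Set (Params n)} {u : Params n} {h : Params n → Fin n → ℝ}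
  {f : Params n → Cn n}

/-- For a Lagrangian immersion with fundamental forms `∑ gᵢ duᵢ²` and `∑ duᵢ² ⊗ J (∂f/∂uᵢ)`, the
one-form `∑ gᵢ duᵢ` is closed. Differentiating `Im ⟪fᵢ, fᵢₖ⟫ = 0` and `Im ⟪fᵢ, fₖₖ⟫ = 0` gives
`Im ⟪fᵢᵢ, fₖₖ⟫ = 0`, which compares the tangential components of `fᵢᵢ` and `fₖₖ`. -/
theorem pd_comm_of_hasSecondFF (hΩ : IsOpen Ω) (hf : ContDiffOn ℝ ∞ f Ω)
    {g : Params n → Fin n → ℝ}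
    (ho : ∀ u ∈ Ω, ∀ i j, inner ℂ (pd i f u) (pd j f u) = if i = j then (g u i : ℂ) else 0)
    (hs : HasSecondFF Ω f 1) (hu : u ∈ Ω) {i k : Fin n} (hik : i ≠ k) :
    pd k (fun v => g v i) u = pd i (fun v => g v k) u := by
  have h1 : ∀ i, ContDiffOn ℝ ∞ (pd i f) Ω := fun i => contDiffOn_pd hΩ hf i
  have h2 : ∀ i j, ContDiffOn ℝ ∞ (pd i (pd j f)) Ω := fun i j => contDiffOn_pd hΩ (h1 j) i
  have hd1 : ∀ i, ∀ u ∈ Ω, DifferentiableAt ℝ (pd i f) u := fun i u hu =>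
    (h1 i).differentiableAt_of_isOpen hΩ hu
  have hd2 : ∀ i j, ∀ u ∈ Ω, DifferentiableAt ℝ (pd i (pd j f)) u := fun i j u hu =>
    (h2 i j).differentiableAt_of_isOpen hΩ hu
  have hdec : ∀ u ∈ Ω, ∀ i j, ∃ t : Params n, pd i (pd j f) u =
      ∑ l, t l • pd l f u + if i = j then J (pd i f u) else 0 := by
    intro u hu i j
    obtain ⟨-, t, ht⟩ := hs u hu (Pi.single i 1) (Pi.single j 1)
    refine ⟨t, ?_⟩
    rw [← fderiv_fderiv_single hΩ hf hu, ht, fderiv_eq_sum_pd f u t, one_smul]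
    congr 1
    split_ifs with hij
    · subst hij
      rw [Finset.sum_eq_single i (fun l _ hl => by simp [hl]) (by simp)]
      simp
    · refine Finset.sum_eq_zero fun l _ => ?_
      by_cases hl : l = i
      · subst hl; simp [hij]
      · simp [hl]
  have htan : ∀ u ∈ Ω, ∀ (t : Params n) k,
      inner ℂ (pd k f u) (∑ l, t l • pd l f u) = ((t k * g u k : ℝ) : ℂ) := by
    intro u hu t k
    rw [inner_sum, Finset.sum_eq_single k]
    · rw [inner_real_smul_right, ho u hu, if_pos rfl]; push_cast; rfl
    · intro l _ hl
      rw [inner_real_smul_right, ho u hu, if_neg (Ne.symm hl), mul_zero]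
    · simp
  have htan' : ∀ u ∈ Ω, ∀ (t : Params n) k,
      inner ℂ (∑ l, t l • pd l f u) (pd k f u) = ((t k * g u k : ℝ) : ℂ) := by
    intro u hu t k
    rw [← inner_conj_symm, htan u hu, Complex.conj_ofReal]
  have him : ∀ {a b : Params n → Cn n}, (∀ v ∈ Ω, (inner ℂ (a v) (b v)).im = 0) →
      DifferentiableAt ℝ a u → DifferentiableAt ℝ b u → ∀ m,
      (inner ℂ (pd m a u) (b u)).im + (inner ℂ (a u) (pd m b u)).im = 0 := by
    intro a b hab ha hb m
    rw [← Complex.add_im, ← pd_inner ha hb]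
    have h3 := pd_clm_comp Complex.imCLM (ha.inner ℂ hb) m
    simp only [Complex.imCLM_apply] at h3
    rw [pd_congr_of_eqOn hΩ (g := fun _ => (0 : ℝ)) (fun v hv => hab v hv) hu, pd_const] at h3
    exact h3.symm
  have hre : ∀ {a b : Params n → Cn n} {r : Params n → ℝ},
      (∀ v ∈ Ω, (inner ℂ (a v) (b v)).re = r v) →
      DifferentiableAt ℝ a u → DifferentiableAt ℝ b u → ∀ m,
      (inner ℂ (pd m a u) (b u)).re + (inner ℂ (a u) (pd m b u)).re = pd m r u := by
    intro a b r hab ha hb m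
    rw [← Complex.add_re, ← pd_inner ha hb, ← pd_congr_of_eqOn hΩ (fun v hv => hab v hv) hu]
    exact (pd_clm_comp Complex.reCLM (ha.inner ℂ hb) m).symm
  -- `fᵢₖ` is tangent, so its products with tangent vectors are real
  have hA : ∀ v ∈ Ω, (inner ℂ (pd i f v) (pd k (pd i f) v)).im = 0 := by
    intro v hv
    obtain ⟨t, ht⟩ := hdec v hv k i
    rw [ht, if_neg (Ne.symm hik), add_zero, htan v hv, Complex.ofReal_im]
  have hB : ∀ v ∈ Ω, (inner ℂ (pd i f v) (pd k (pd k f) v)).im = 0 := by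
    intro v hv
    obtain ⟨t, ht⟩ := hdec v hv k k
    rw [ht, if_pos rfl, inner_add_right, htan v hv, J, inner_smul_right, ho v hv, if_neg hik,
      mul_zero, add_zero, Complex.ofReal_im]
  have hA' := him hA (hd1 i u hu) (hd2 k i u hu) k
  have hB' := him hB (hd1 i u hu) (hd2 k k u hu) i
  have hself : (inner ℂ (pd k (pd i f) u) (pd k (pd i f) u)).im = 0 :=
    inner_self_im (𝕜 := ℂ) _
  have hcomm : pd i (pd k (pd k f)) u = pd k (pd k (pd i f)) u := by
    rw [pd_comm hΩ (h1 k) hu]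
    exact pd_congr_of_eqOn hΩ (fun v hv => pd_comm hΩ hf hv i k) hu k
  have hC : (inner ℂ (pd i (pd i f) u) (pd k (pd k f) u)).im = 0 := by
    rw [hcomm] at hB'
    linarith
  obtain ⟨s, hs⟩ := hdec u hu i i
  obtain ⟨r, hr⟩ := hdec u hu k k
  rw [if_pos rfl] at hs hr
  have hss : (inner ℂ (∑ l, s l • pd l f u) (∑ l, r l • pd l f u)).im = 0 := by
    rw [sum_inner, Complex.im_sum]
    refine Finset.sum_eq_zero fun l _ => ?_
    rw [inner_real_smul_left, htan u hu, ← Complex.ofReal_mul, Complex.ofReal_im]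
  have hsr : s k * g u k = r i * g u i := by
    rw [hs, hr, inner_add_left, inner_add_right, inner_add_right, Complex.add_im, Complex.add_im,
      Complex.add_im, hss] at hC
    simp only [J, inner_smul_left, inner_smul_right, htan u hu, htan' u hu, ho u hu,
      if_neg hik] at hC
    simp at hC
    linarith
  -- the tangential components of `fᵢᵢ` and `fₖₖ` in terms of the first fundamental form
  have hcomp : ∀ i k : Fin n, i ≠ k → ∀ s : Params n,
      pd i (pd i f) u = ∑ l, s l • pd l f u + J (pd i f u) →
      pd k (fun v => g v i) u = -2 * (s k * g u k) := by
    intro i k hik s hs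
    have e1 := hre (r := fun _ => 0) (fun v hv => by rw [ho v hv, if_neg (Ne.symm hik)]; rfl)
      (hd1 k u hu) (hd1 i u hu) i
    have e2 := hre (r := fun v => g v i) (fun v hv => by rw [ho v hv, if_pos rfl]; rfl)
      (hd1 i u hu) (hd1 i u hu) k
    have e3 : (inner ℂ (pd i f u) (pd k (pd i f) u)).re =
        (inner ℂ (pd k (pd i f) u) (pd i f u)).re := by
      rw [← inner_conj_symm, Complex.conj_re]
    rw [pd_const, hs, inner_add_right, htan u hu, J, inner_smul_right, ho u hu,
      if_neg (Ne.symm hik), mul_zero, add_zero, Complex.ofReal_re, pd_comm hΩ hf hu i k] at e1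
    rw [e3] at e2
    linarith
  rw [hcomp i k hik s hs, hcomp k i (Ne.symm hik) r hr, hsr]

/-- `β`, `h` solve the system if there is a flat Lagrangian immersion with the corresponding
fundamental forms. -/
theorem isUKSystemSolution_of_immersion (hΩ : IsOpen Ω) {β : Params n → Matrix (Fin n) (Fin n) ℝ}
    (hh : ∀ i, ContDiffOn ℝ ∞ (fun u => h u i) Ω) (hne : ∀ u ∈ Ω, ∀ i, h u i ≠ 0)
    (hβ : ∀ u ∈ Ω, β u = rotationCoeff h u) (hf : IsFlatLagrangianImmersion Ω f)
    (hff : HasFirstFF Ω f fun u i => h u i ^ 2) (hs : HasSecondFF Ω f 1) :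
    IsUKSystemSolution Ω (qField β h) := by
  have hsymm : ∀ u ∈ Ω, (rotationCoeff h u)ᵀ = rotationCoeff h u := fun u hu =>
    transpose_rotationCoeff (fun i => (hh i).differentiableAt_of_isOpen hΩ hu) (hne u hu)
      fun i k hik => pd_comm_of_hasSecondFF hΩ hf.smooth (g := fun u i => h u i ^ 2)
        (fun u hu i j => inner_pd_of_hasFirstFF hff hf.lagrangian hu i j) hs hu hik
  have hflat : IsFlatMetric Ω fun u => Matrix.diagonal fun i => h u i ^ 2 :=
    hf.flat.congr hΩ fun u hu => firstFF_matrix_eq_diagonal hff hu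
  have hdB := (isFlatMetric_diagonal_iff hΩ hh hne hsymm).1 hflat
  have hβs : ∀ i j, ContDiffOn ℝ ∞ (fun u => β u i j) Ω := fun i j =>
    (contDiffOn_rotationCoeff hΩ hh hne i j).congr fun u hu => by rw [hβ u hu]
  refine (isUKSystemSolution_iff_isFlatConnection_deltaBeta hΩ hβs
    (fun u hu => by rw [hβ u hu, hsymm u hu])
    (fun u hu i => by rw [hβ u hu, rotationCoeff_apply_self]) hh).2 ⟨?_, ?_⟩
  · exact hdB.congr hΩ fun i u hu => by rw [deltaBeta, deltaBeta, hβ u hu]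
  · intro u hu i j hij
    rw [hβ u hu]
    exact pd_eq_rotationCoeff_mul (hne u hu) hij

/-- A solution of the system with nowhere-zero `h` is realized by a flat Lagrangian immersion, the
translation part of the frame at `λ = 1`. -/
theorem exists_immersion_of_isUKSystemSolution (hΩ : IsOpen Ω) (hsc : SimplyConnectedSpace Ω)
    (h0 : (0 : Params n) ∈ Ω) {β : Params n → Matrix (Fin n) (Fin n) ℝ}
    (hh : ∀ i, ContDiffOn ℝ ∞ (fun u => h u i) Ω) (hne : ∀ u ∈ Ω, ∀ i, h u i ≠ 0)
    (hq : IsUKSystemSolution Ω (qField β h)) :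
    (∀ u ∈ Ω, β u = rotationCoeff h u) ∧ ∃ f : Params n → Cn n,
      IsFlatLagrangianImmersion Ω f ∧ HasNondegenerateNormalBundle Ω f ∧
        HasFirstFF Ω f (fun u i => h u i ^ 2) ∧ HasSecondFF Ω f 1 := by
  have hc : IsPreconnected Ω := isPreconnected_iff_preconnectedSpace.2 inferInstance
  have hβs : ∀ i j, ContDiffOn ℝ ∞ (fun u => β u i j) Ω := fun i j =>
    hq.smooth (.inl i) (.inr (.inl j))
  have hs : ∀ u ∈ Ω, (β u)ᵀ = β u := fun u hu => (qField_mem_cartanP_iff β h).1 (hq.mem u hu)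
  have hd : ∀ u ∈ Ω, ∀ i, β u i i = 0 := hq.diag
  obtain ⟨hdB, hpd⟩ := (isUKSystemSolution_iff_isFlatConnection_deltaBeta hΩ hβs hs hd hh).1 hq
  have hβ : ∀ u ∈ Ω, β u = rotationCoeff h u := by
    intro u hu
    ext i j
    by_cases hij : i = j
    · subst hij; rw [hd u hu, rotationCoeff_apply_self]
    · rw [rotationCoeff, Matrix.of_apply, if_neg hij, hpd u hu i j hij,
        mul_div_cancel_right₀ _ (hne u hu j)]
  refine ⟨hβ, ?_⟩
  have hflat : IsFlatMetric Ω fun u => Matrix.diagonal fun i => h u i ^ 2 :=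
    (isFlatMetric_diagonal_iff hΩ hh hne fun u hu => by rw [← hβ u hu, hs u hu]).2
      (hdB.congr hΩ fun i u hu => by rw [deltaBeta, deltaBeta, hβ u hu])
  obtain ⟨E, X, hF, hFs⟩ := exists_isFrame_blockFrame hΩ hsc h0 hβs hh ((1 : ℝ) : ℂ)
    ((isFlatConnection_thetaForm_iff hΩ hβs hh _).2
      ((isUKSystemSolution_iff hβs hs hd hh).1 hq))
  have hX := contDiffOn_translation hFs
  obtain ⟨himm, hff, hsf⟩ := hF.immersion hΩ hc h0 hs hh hne hflat hX
  exact ⟨X, himm, hasNondegenerateNormalBundle hff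
    (fun u hu i => by have := hne u hu i; positivity) himm.lagrangian hsf, hff, hsf⟩

/-- The Lax pairs: flatness for all `λ` of either one-form is equivalent to the system. -/
theorem isUKSystemSolution_iff_forall_flat (hΩ : IsOpen Ω)
    {β : Params n → Matrix (Fin n) (Fin n) ℝ} (hβ : ∀ i j, ContDiffOn ℝ ∞ (fun u => β u i j) Ω)
    (hs : ∀ u ∈ Ω, (β u)ᵀ = β u) (hd : ∀ u ∈ Ω, ∀ i, β u i i = 0)
    (hh : ∀ i, ContDiffOn ℝ ∞ (fun u => h u i) Ω) :
    (IsUKSystemSolution Ω (qField β h) ↔ ∀ lam : ℂ, IsFlatConnection Ω (laxUK (qField β h) lam)) ∧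
    (IsUKSystemSolution Ω (qField β h) ↔ ∀ lam : ℂ, IsFlatConnection Ω (thetaForm β h lam)) := by
  rw [isUKSystemSolution_iff hβ hs hd hh]
  exact ⟨⟨fun H lam => (isFlatConnection_laxUK_iff hΩ hβ hh lam).2 H,
      fun H => (isFlatConnection_laxUK_iff hΩ hβ hh 0).1 (H 0)⟩,
    ⟨fun H lam => (isFlatConnection_thetaForm_iff hΩ hβ hh lam).2 H,
      fun H => (isFlatConnection_thetaForm_iff hΩ hβ hh 0).1 (H 0)⟩⟩

end Converse

end FlatLagrangian

end

theorem mainTheorem2 (n : ℕ) (Ω : Set (FlatLagrangian.Params n)) (hΩ : IsOpen Ω)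
    (h0 : (0 : FlatLagrangian.Params n) ∈ Ω) (hsc : SimplyConnectedSpace Ω) :
    -- the associated family of a flat Egoroff metric
    (∀ (φ : FlatLagrangian.Params n → ℝ) (h : FlatLagrangian.Params n → Fin n → ℝ),
      FlatLagrangian.IsFlatEgoroffMetric Ω φ →
      (∀ i, ContDiffOn ℝ ∞ (fun u => h u i) Ω) →
      (∀ u ∈ Ω, ∀ i, h u i ^ 2 = FlatLagrangian.pd i φ u) →
      (∀ lam : ℂ, FlatLagrangian.IsFlatConnection Ω
        (FlatLagrangian.thetaForm (FlatLagrangian.rotationCoeff h) h lam)) ∧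
      ∃ (E : FlatLagrangian.Params n → ℂ → Matrix (Fin n) (Fin n) ℂ)
        (X : FlatLagrangian.Params n → ℂ → FlatLagrangian.Cn n),
        -- the extended frame: existence, smoothness, uniqueness, holomorphy
        (∀ lam : ℂ, FlatLagrangian.IsFrame Ω
          (FlatLagrangian.thetaForm (FlatLagrangian.rotationCoeff h) h lam)
          (fun u => FlatLagrangian.blockFrame (E u lam) (X u lam))) ∧
        (∀ (lam : ℂ) (a b : Fin n ⊕ Unit), ContDiffOn ℝ ∞
          (fun u => FlatLagrangian.blockFrame (E u lam) (X u lam) a b) Ω) ∧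
        (∀ (lam : ℂ) (G : FlatLagrangian.Params n → Matrix (Fin n ⊕ Unit) (Fin n ⊕ Unit) ℂ),
          FlatLagrangian.IsFrame Ω
            (FlatLagrangian.thetaForm (FlatLagrangian.rotationCoeff h) h lam) G →
          ∀ u ∈ Ω, G u = FlatLagrangian.blockFrame (E u lam) (X u lam)) ∧
        (∀ u ∈ Ω, ∀ a b : Fin n ⊕ Unit, Differentiable ℂ
          (fun lam : ℂ => FlatLagrangian.blockFrame (E u lam) (X u lam) a b)) ∧
        (∀ lam : ℂ, FlatLagrangian.IsFrame Ω
          (FlatLagrangian.wForm (FlatLagrangian.rotationCoeff h) lam) (fun u => E u lam)) ∧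
        -- flat Lagrangian immersions for real parameter, degenerating to an Egoroff net
        (∀ lam : ℝ,
          FlatLagrangian.IsFlatLagrangianImmersion Ω (fun u => X u (lam : ℂ)) ∧
          FlatLagrangian.HasFirstFF Ω (fun u => X u (lam : ℂ))
            (fun u i => FlatLagrangian.pd i φ u) ∧
          FlatLagrangian.HasSecondFF Ω (fun u => X u (lam : ℂ)) lam) ∧
        (∃ x : FlatLagrangian.Params n → EuclideanSpace ℝ (Fin n),
          FlatLagrangian.IsEgoroffNet Ω x ∧
          ∀ u ∈ Ω, ∀ k, X u 0 k = ((x u k : ℝ) : ℂ))) ∧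
    -- the Lax pair of the system
    (∀ (β : FlatLagrangian.Params n → Matrix (Fin n) (Fin n) ℝ)
      (h : FlatLagrangian.Params n → Fin n → ℝ),
      (∀ i j, ContDiffOn ℝ ∞ (fun u => β u i j) Ω) →
      (∀ u ∈ Ω, (β u)ᵀ = β u) → (∀ u ∈ Ω, ∀ i, β u i i = 0) →
      (∀ i, ContDiffOn ℝ ∞ (fun u => h u i) Ω) →
      (FlatLagrangian.IsUKSystemSolution Ω (FlatLagrangian.qField β h) ↔
        (FlatLagrangian.IsFlatConnection Ω (FlatLagrangian.deltaBeta β) ∧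
          ∀ u ∈ Ω, ∀ i j, i ≠ j →
            FlatLagrangian.pd j (fun v => h v i) u = β u i j * h u j)) ∧
      (FlatLagrangian.IsUKSystemSolution Ω (FlatLagrangian.qField β h) ↔
        ∀ lam : ℂ, FlatLagrangian.IsFlatConnection Ω
          (FlatLagrangian.laxUK (FlatLagrangian.qField β h) lam)) ∧
      (FlatLagrangian.IsUKSystemSolution Ω (FlatLagrangian.qField β h) ↔
        ∀ lam : ℂ, FlatLagrangian.IsFlatConnection Ω (FlatLagrangian.thetaForm β h lam)) ∧
      (∀ (lam : ℝ) (j : Fin n), ∀ u ∈ Ω,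
        (FlatLagrangian.realify (FlatLagrangian.thetaForm β h (lam : ℂ) j u)).map Complex.ofReal
          = FlatLagrangian.laxUK (FlatLagrangian.qField β h) (lam : ℂ) j u)) ∧
    -- the system is the equation for flat Lagrangian immersions
    (∀ (β : FlatLagrangian.Params n → Matrix (Fin n) (Fin n) ℝ)
      (h : FlatLagrangian.Params n → Fin n → ℝ),
      (∀ i, ContDiffOn ℝ ∞ (fun u => h u i) Ω) → (∀ u ∈ Ω, ∀ i, h u i ≠ 0) →
      (FlatLagrangian.IsUKSystemSolution Ω (FlatLagrangian.qField β h) ↔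
        (∀ u ∈ Ω, β u = FlatLagrangian.rotationCoeff h u) ∧
        ∃ f : FlatLagrangian.Params n → FlatLagrangian.Cn n,
          FlatLagrangian.IsFlatLagrangianImmersion Ω f ∧
          FlatLagrangian.HasNondegenerateNormalBundle Ω f ∧
          FlatLagrangian.HasFirstFF Ω f (fun u i => h u i ^ 2) ∧
          FlatLagrangian.HasSecondFF Ω f 1)) := by
  have hc : IsPreconnected Ω := isPreconnected_iff_preconnectedSpace.2 inferInstance
  refine ⟨fun φ h hφ hh hsq => ?_, fun β h hβ hs hd hh => ?_, fun β h hh hne => ⟨fun hq => ?_, ?_⟩⟩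
  · have hne : ∀ u ∈ Ω, ∀ i, h u i ≠ 0 := fun u hu i hi => by
      have := hφ.pos u hu i
      rw [← hsq u hu, hi] at this
      simp at this
    have hβ := FlatLagrangian.contDiffOn_rotationCoeff hΩ hh hne
    -- the rotation coefficients are symmetric since `(hᵢ²)_{uₖ} = φ_{uᵢuₖ}`
    have hs : ∀ u ∈ Ω,
        (FlatLagrangian.rotationCoeff h u)ᵀ = FlatLagrangian.rotationCoeff h u := fun u hu =>
      FlatLagrangian.transpose_rotationCoeff
        (fun i => (hh i).differentiableAt_of_isOpen hΩ hu) (hne u hu) fun i k _ => by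
        rw [FlatLagrangian.pd_congr_of_eqOn hΩ (fun v hv => hsq v hv i) hu,
          FlatLagrangian.pd_congr_of_eqOn hΩ (fun v hv => hsq v hv k) hu]
        exact FlatLagrangian.pd_comm hΩ hφ.smooth hu k i
    have hdiag : FlatLagrangian.IsFlatMetric Ω fun u => Matrix.diagonal fun i => h u i ^ 2 :=
      hφ.flat.congr hΩ fun u hu => by simp only [hsq u hu]
    have hsys := (FlatLagrangian.isUKSystemSolution_iff_isFlatConnection_deltaBeta hΩ hβ hs
      (fun u _ => FlatLagrangian.rotationCoeff_apply_self h u) hh).2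
      ⟨(FlatLagrangian.isFlatMetric_diagonal_iff hΩ hh hne hs).1 hdiag,
        fun u hu i j hij => FlatLagrangian.pd_eq_rotationCoeff_mul (hne u hu) hij⟩
    have hflat := (FlatLagrangian.isUKSystemSolution_iff_forall_flat hΩ hβ hs
      (fun u _ => FlatLagrangian.rotationCoeff_apply_self h u) hh).2.1 hsys
    refine ⟨hflat, ?_⟩
    choose E X hF hFs using fun lam : ℂ =>
      FlatLagrangian.exists_isFrame_blockFrame hΩ hsc h0 hβ hh lam (hflat lam)
    have hX : ∀ lam, ContDiffOn ℝ ∞ (X lam) Ω := fun lam =>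
      FlatLagrangian.contDiffOn_translation (hFs lam)
    have himm := fun lam : ℝ => (hF lam).immersion hΩ hc h0 hs hh hne hdiag (hX lam)
    refine ⟨fun u lam => E lam u, fun u lam => X lam u, hF, hFs, fun lam G hG u hu => ?_,
      fun u hu a b => ?_, fun lam => (hF lam).rotation,
      fun lam => ⟨(himm lam).1, ?_, (himm lam).2.2⟩,
      fun u => WithLp.toLp 2 fun k => (X 0 u k).re, ?_,
      fun u hu k => (hF 0).translation_real hΩ hc h0 hβ hh hu k⟩
    · exact (hF lam).eqOn_of_pdMat_eq hΩ hc h0 (FlatLagrangian.contDiffOn_thetaForm hβ hh lam)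
        hG.differentiable (fun u hu i => hG.pdMat_eq hu i) hG.initial hu
    · exact FlatLagrangian.differentiable_blockFrame hΩ hsc h0 hβ hh hflat hF hu a b
    · intro u hu v w
      rw [(himm lam).2.1 u hu]
      simp only [hsq u hu]
    · have him0 := (himm 0).1
      have ho := fun u (hu : u ∈ Ω) => (hF (0 : ℝ)).inner_pd_translation hΩ hc h0 hs hu
      rw [Complex.ofReal_zero] at him0 ho
      exact FlatLagrangian.isEgoroffNet_of_real hΩ (hX 0) him0.immersion hφ.smooth
        (fun u hu i j => by rw [ho u hu, hsq u hu])
        fun u hu k => (hF 0).translation_real hΩ hc h0 hβ hh hu k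
  · have hlax := FlatLagrangian.isUKSystemSolution_iff_forall_flat hΩ hβ hs hd hh
    exact ⟨FlatLagrangian.isUKSystemSolution_iff_isFlatConnection_deltaBeta hΩ hβ hs hd hh, hlax.1,
      hlax.2, fun lam j u _ => FlatLagrangian.realify_thetaForm β h lam j u⟩
  · exact FlatLagrangian.exists_immersion_of_isUKSystemSolution hΩ hsc h0 hh hne hq
  · rintro ⟨hβ, f, hf, -, hff, hsf⟩
    exact FlatLagrangian.isUKSystemSolution_of_immersion hΩ hh hne hβ hf hff hsf
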